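/- **Setting.** Let $(\theta_j)_{j\ge1}$, $(\kappa_j)_{j\ge1}$ be non-negative real sequences such that $(\kappa_j)$ is non-arithmetic (there is no integer $j_0>1$ dividing every $j$ with $\kappa_j\ne0$) and $\kappa_j>0$ for some $j\ge2$. For a permutation $\sigma$ of $\{1,\dots,N\}$ let $C_j(\sigma)$ be the number of its cycles of length $j$, and let $$\tilde{\mathbb P}_N(\sigma)=\frac1{N!\,H_N}\prod_{j=1}^N(\theta_j+N\kappa_j)^{C_j(\sigma)},\qquad H_N=\frac1{N!}\sum_{\sigma}\prod_{j=1}^N(\theta_j+N\kappa_j)^{C_j(\sigma)} ,$$ which is defined whenever $H_N>0$. Let $L_1(\sigma)$ be the length of the cycle containing $1$, $L_2(\sigma)$ the length of the cycle containing the smallest element not in the first cycle, and so on ($L_j=0$ if there are fewer than $j$ cycles). For a function $g$ write $g^{\{n\}}(z)=z^n\,\frac{d^n g}{dz^n}(z)$, and $g^{\{n\}}(R)=\lim_{r\uparrow R}g^{\{n\}}(r)$. For $R,\eta>0$, $\varphi\in(0,\pi/2)$ put $\Delta_0=\{z\in\mathbb C:|z|<R|1+\eta e^{i\varphi}|,\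 z\ne R,\ |\arg(z-R)|>\varphi\}$. **Assumptions.** The power series $g_\theta(z)=\sum_{j\ge1}\frac{\theta_j}{j}z^j$ and $g_\kappa(z)=\sum_{j\ge1}\frac{\kappa_j}{j}z^j$ both have radius of convergence $R\in(0,\infty)$ and extend holomorphically to a domain $\Delta_0=\Delta_0(R,\eta,\varphi)$; $g_\kappa^{\{1\}}(R)<1$ (supercritical case); and for some $\theta^*>0$, $\delta>0$, as $z\to R$ in $\Delta_0$, $$g_\theta(z)=-\theta^*\log(1-z/R)+O\big((1-z/R)^{\delta}\big),\qquad g_\kappa(z)=g_\kappa(R)-g_\kappa^{\{1\}}(R)(1-z/R)+O\big((1-z/R)^{1+\delta}\big).$$ There are a non-integer $s>1$ with $g_\kappa^{\{n\}}(R)<\infty$ for $n<s$ and $g_\kappa^{\{n\}}(R)=\infty$ for $n>s$, a real constant $a_s\neq0$ and numbers $\delta_n>0$ such that, as $z\to R$ in $\Delta_0$, $$g_\kappa^{\{n\}}(z)=g_\kappa^{\{n\}}(R)\{1+O((1-z/R)^{\delta_n})\}\quad(0\le n<s),$$ $$g_\kappa^{\{n\}}(z)=\frac{\Gamma(-s+n)\,a_s}{\Gamma(-s)}(1-z/R)^{s-n}\{1+O((1-z/R)^{\delta_n})\}\quad(n>s),$$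 $$g_\theta^{\{n\}}(z)=\frac{\theta^*(n-1)!}{(1-z/R)^n}\{1+O((1-z/R)^{\delta_n})\}\quad(n\ge1).$$ **Modified stick-breaking process.** Let $\tilde\nu=1-g_\kappa^{\{1\}}(R)$. Let $(U_n)_{n\ge1}$ be uniform on $[0,1]$, $(B_n)_{n\ge1}$ have the $\mathrm{Beta}(1,\theta^*)$ distribution, all these variables being independent. Put $\eta_0=1$ and, for $n\ge1$, $$\xi_n=\mathbf 1\Big\{U_n\le\frac{\tilde\nu\,\eta_{n-1}}{1-\tilde\nu+\tilde\nu\,\eta_{n-1}}\Big\},\quad D_n=\xi_nB_n,\quad \eta_n=\prod_{j=1}^n(1-D_j),\quad X_n=\eta_{n-1}D_n .$$ **Theorem.** Under these assumptions $H_N>0$ for all sufficiently large $N$; $\tilde\nu>0$ is the limiting expected fraction of points in long cycles, $$\tilde\nu=\lim_{K\to\infty}\liminf_{N\to\infty}\frac1N\,\tilde{\mathbb E}_N\Big[\sum_{j>K}jC_j\Big];$$ and for each $m$, under $\tilde{\mathbb P}_N$, $$\frac1{N\tilde\nu}(L_1,\dots,L_m)\xrightarrow{\ d\ }(X_1,\dots,X_m),\qquad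 N\to\infty .$$ In particular, $L_1/(N\tilde\nu)$ converges in distribution to $X_1$, whose law is the sum of an atom of mass $1-\tilde\nu$ at $0$ and an absolutely continuous part on $(0,1)$ with density $\tilde\nu\,\theta^*(1-x)^{\theta^*-1}$. -/

import Mathlib

open MeasureTheory ProbabilityTheory Filter Topology Asymptotics Set
open scoped NNReal ENNReal

noncomputable section

namespace SurrogateSpatial

/-! ### The surrogate-spatial measure on permutations

Sequences indexed by the positive integers are functions on `ℕ` whose value at `0` is never used. -/

/-- Permutations of a finite set carry the discrete σ-algebra. -/
instance instMeasurableSpacePerm (N : ℕ) : MeasurableSpace (Equiv.Perm (Fin N)) := ⊤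

/-- The cycle count `C_j(σ)`: the number of cycles of length `j` in the cycle decomposition of `σ`,
fixed points being cycles of length one. -/
def cycleCount {N : ℕ} (σ : Equiv.Perm (Fin N)) (j : ℕ) : ℕ := σ.partition.parts.count j

/-- The product `∏_{j=1}^N (θ_j + N κ_j)^{C_j(σ)}`. -/
def weight (θ κ : ℕ → ℝ≥0) (N : ℕ) (σ : Equiv.Perm (Fin N)) : ℝ≥0 :=
  ∏ j ∈ Finset.Icc 1 N, (θ j + N * κ j) ^ cycleCount σ j

/-- The normalization constant `H_N`. -/
def normConst (θ κ : ℕ → ℝ≥0) (N : ℕ) : ℝ≥0 :=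
  (∑ σ : Equiv.Perm (Fin N), weight θ κ N σ) / (N.factorial : ℝ≥0)

open Classical in
/-- The surrogate-spatial measure on the permutations of `N` elements, which gives `σ` the mass
`weight σ / (N! H_N)`. It makes sense only if `H_N ≠ 0`; for other `N` the point mass at
the identity is used as a placeholder, so that the object is a probability measure for all `N`. -/
def surrogateMeasure (θ κ : ℕ → ℝ≥0) (N : ℕ) : Measure (Equiv.Perm (Fin N)) :=
  if normConst θ κ N = 0 then Measure.dirac 1
  else ∑ σ : Equiv.Perm (Fin N),
    ((weight θ κ N σ / ((N.factorial : ℝ≥0) * normConst θ κ N) : ℝ≥0) : ℝ≥0∞) • Measure.dirac σ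

instance instIsProbabilityMeasureSurrogate (θ κ : ℕ → ℝ≥0) (N : ℕ) :
    IsProbabilityMeasure (surrogateMeasure θ κ N) := by
  unfold surrogateMeasure
  split_ifs with h
  · infer_instance
  · constructor
    have hN : (N.factorial : ℝ≥0) ≠ 0 := by exact_mod_cast Nat.factorial_ne_zero N
    have hS : (N.factorial : ℝ≥0) * normConst θ κ N = ∑ σ : Equiv.Perm (Fin N), weight θ κ N σ := by
      unfold normConst
      field_simp
    simp only [Measure.coe_finsetSum, Finset.sum_apply, Measure.smul_apply, measure_univ,
      smul_eq_mul, mul_one]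
    rw [← ENNReal.ofNNReal_finsetSum, ← Finset.sum_div, ← hS, div_self (mul_ne_zero hN h)]
    rfl

/-! ### Lexicographically ordered cycle lengths -/

open Classical in
/-- The set of elements of the cycle of `σ` that contains `i`. -/
def cycleSet {N : ℕ} (σ : Equiv.Perm (Fin N)) (i : Fin N) : Finset (Fin N) :=
  Finset.univ.filter fun k => σ.SameCycle i k

/-- The union of the first `n` cycles of `σ`, where every new cycle is the one that contains
the smallest element not in the previous cycles. -/
def firstCycles {N : ℕ} (σ : Equiv.Perm (Fin N)) : ℕ → Finset (Fin N)
  | 0 => ∅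
  | n + 1 =>
    if h : (firstCycles σ n)ᶜ.Nonempty then
      firstCycles σ n ∪ cycleSet σ ((firstCycles σ n)ᶜ.min' h)
    else firstCycles σ n

/-- `lexLength σ n` is the length `L_{n+1}(σ)` of the cycle number `n + 1` of `σ` in the
lexicographic order: the cycle containing the smallest element not in the first `n` cycles.
It is `0` if `σ` has at most `n` cycles. -/
def lexLength {N : ℕ} (σ : Equiv.Perm (Fin N)) (n : ℕ) : ℕ :=
  if h : (firstCycles σ n)ᶜ.Nonempty then (cycleSet σ ((firstCycles σ n)ᶜ.min' h)).card else 0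

/-! ### The expected fraction of points in long cycles -/

/-- `ν̃_K = liminf_N N⁻¹ E_N[∑_{j > K} j C_j]`. -/
def longFraction (θ κ : ℕ → ℝ≥0) (K : ℕ) : ℝ :=
  liminf (fun N : ℕ => (1 / (N : ℝ)) *
    ∫ σ, (∑ j ∈ Finset.Ioc K N, (j : ℝ) * (cycleCount σ j : ℝ)) ∂(surrogateMeasure θ κ N)) atTop

/-! ### Generating functions -/

/-- The power series `∑_{j ≥ 1} (a_j / j) z^j` (its coefficient at `j = 0` is `a 0 / 0 = 0`). -/
def genSeries (a : ℕ → ℝ≥0) : FormalMultilinearSeries ℂ ℂ ℂ :=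
  FormalMultilinearSeries.ofScalars ℂ fun j : ℕ => (((a j : ℝ) / (j : ℝ) : ℝ) : ℂ)

/-- The modified derivative `g^{n}(z) = z^n (d/dz)^n g(z)`. -/
def modDeriv (g : ℂ → ℂ) (n : ℕ) (z : ℂ) : ℂ := z ^ n * iteratedDeriv n g z

/-- The domain `Δ₀(R, η, φ)`. -/
def domainDelta (R η φ : ℝ) : Set ℂ :=
  {z : ℂ | ‖z‖ < ‖(R : ℂ) * (1 + η * Complex.exp (φ * Complex.I))‖ ∧ z ≠ R ∧
    φ < |Complex.arg (z - R)|}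

/-! ### The modified stick-breaking process

For given values `u n = U_{n+1}` and `b n = B_{n+1}` of the driving variables. -/

/-- `u*(x) = ν x / (1 - ν + ν x)`. -/
def uStar (ν x : ℝ) : ℝ := ν * x / (1 - ν + ν * x)

/-- `D = ξ B`, where `ξ` is the indicator of `U ≤ u*(x)` and `x` is the previous `η`. -/
def stickD (ν x u b : ℝ) : ℝ := (if u ≤ uStar ν x then 1 else 0) * b

/-- `η_0 = 1`, `η_n = η_{n-1} (1 - D_n)`. -/
def stickEta (ν : ℝ) (u b : ℕ → ℝ) : ℕ → ℝ
  | 0 => 1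
  | n + 1 => stickEta ν u b n * (1 - stickD ν (stickEta ν u b n) (u n) (b n))

/-- `stickX ν u b n` is `X_{n+1} = η_n D_{n+1}`. -/
def stickX (ν : ℝ) (u b : ℕ → ℝ) (n : ℕ) : ℝ :=
  stickEta ν u b n * stickD ν (stickEta ν u b n) (u n) (b n)

end SurrogateSpatial

end

open SurrogateSpatial

namespace SurrogateSpatial

/-! Put T_j = θ_j R^j and K_j = κ_j R^j. Cycle lengths add up to N, so this replacement multiplies
every weight by R^N and leaves the measure unchanged. Let h_N(n) be the coefficient of z^n in exp
∑_j (T_j + N K_j) z^j / j. Splitting off the cycle of a chosen point shows that, when n points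
remain, the next cycle has length l with probability (T_l + N K_l) h_N(n - l) / (n h_N(n)). The
ordered cycle lengths are thus governed by a Markov chain on the number of remaining points, and
only ratios of the h_N(n) matter (`sum_permFixing_eq`, `sum_lexFrom`).

Let c = ∑ K_j = g_κ^{1}(R) < 1. After division by exp(N ∑ K_j / j), the factor containing K is the
generating function of a sum of N independent compound Poisson variables of mean c, which
concentrates at cN. The factor containing T resembles (1 - z)^(-θ*) and its k-th coefficient is
asymptotic to a constant times k^(θ* - 1). Hence h_N(n), so normalized, behaves like A N^(θ* - 1) (v
- c)^(θ* - 1) when n / N → v > c (`tendsto_rpow_mul_mixedCoeff`). A law of large numbers suffices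
for this, together with an o(1/N) bound on point probabilities above the mean. The inputs K_j =
O(j^(-s)) and T_j = θ* + O(j^(-d)) come from the behaviour of the generating functions at R by
Cauchy's formula (`exists_scaled_le_rpow`, `exists_abs_scaled_sub_le_rpow`).

Now let n / N → v = c + νx. A fixed length l has limiting probability K_l / v, with total c / v = 1
- u*(x). Lengths near νxbN have, in the variable b, the limiting density u*(x) θ* (1 - b)^(θ* - 1).
These are exactly the two alternatives in a step of the stick-breaking process from η = x. Fatou's
lemma and induction on m bound the liminf of the expectation of every non-negative bounded
continuous function from below by its stick-breaking value (`Supercritical.le_liminf_lexSum`). No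
mass can escape, since both sides are probability measures, so this one-sided bound already gives
weak convergence. -/

/-! ### Coefficient estimates from the singular behaviour at R -/

/-- The Poisson kernel of the circle of radius ρ at the point ρ² reproduces the constant 1. On that
circle |z - ρ²| = ρ |1 - z|, so the kernel is a multiple of |1 - z|^(-2). -/
theorem intervalIntegral_inv_norm_one_sub_sq {ρ : ℝ} (h0 : 0 < ρ) (h1 : ρ < 1) :
    ∫ t : ℝ in (0)..(2 * Real.pi), (‖1 - circleMap 0 ρ t‖ ^ 2)⁻¹ = 2 * Real.pi / (1 - ρ ^ 2) := by
  have hw : ((ρ ^ 2 : ℝ) : ℂ) ∈ Metric.ball (0 : ℂ) ρ := by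
    simp only [Metric.mem_ball, dist_zero_right, Complex.norm_real, Real.norm_eq_abs]
    rw [abs_of_pos (by positivity)]
    nlinarith
  have hf : DiffContOnCl ℂ (fun _ : ℂ => (1 : ℂ)) (Metric.ball (0 : ℂ) ρ) := diffContOnCl_const
  have key := hf.circleAverage_poissonKernel_smul' hw
  have hρ : (1 - ρ ^ 2) ≠ 0 := by nlinarith
  have hpt : ∀ t : ℝ, ((‖circleMap 0 ρ t - 0‖ ^ 2 - ‖((ρ ^ 2 : ℝ) : ℂ) - 0‖ ^ 2) /
      ‖circleMap 0 ρ t - 0 - (((ρ ^ 2 : ℝ) : ℂ) - 0)‖ ^ 2) • (1 : ℂ)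
      = (((1 - ρ ^ 2) * (‖1 - circleMap 0 ρ t‖ ^ 2)⁻¹ : ℝ) : ℂ) := by
    intro t
    set z := circleMap 0 ρ t with hz
    have hzn : ‖z‖ = ρ := by rw [hz]; simp [abs_of_pos h0]
    have h2 : ‖z - ((ρ ^ 2 : ℝ) : ℂ)‖ = ρ * ‖1 - z‖ := by
      have e1 : ((ρ ^ 2 : ℝ) : ℂ) = z * (starRingEnd ℂ) z := by
        rw [Complex.mul_conj, Complex.normSq_eq_norm_sq, hzn]
      have e2 : z - z * (starRingEnd ℂ) z = z * (starRingEnd ℂ) (1 - z) := by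
        simp; ring
      rw [e1, e2, norm_mul, hzn, Complex.norm_conj]
    simp only [sub_zero]
    rw [h2, hzn, Complex.norm_real, Real.norm_eq_abs, abs_of_pos (by positivity)]
    have h3 : (ρ ^ 2 - (ρ ^ 2) ^ 2) / (ρ * ‖1 - z‖) ^ 2 = (1 - ρ ^ 2) * (‖1 - z‖ ^ 2)⁻¹ := by
      rw [mul_pow]
      have : ρ ^ 2 ≠ 0 := by positivity
      rw [div_eq_mul_inv, mul_inv]
      field_simp
    rw [h3]
    simp
  rw [Real.circleAverage_def] at key
  simp_rw [hpt] at key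
  rw [intervalIntegral.integral_ofReal, intervalIntegral.integral_const_mul] at key
  have key2 : (2 * Real.pi)⁻¹ * ((1 - ρ ^ 2) *
      ∫ t : ℝ in (0)..(2 * Real.pi), (‖1 - circleMap 0 ρ t‖ ^ 2)⁻¹) = 1 := by
    rw [Complex.real_smul] at key
    exact_mod_cast key
  have hpi := Real.pi_pos.ne'
  field_simp at key2 ⊢
  linarith

/-- Cauchy's formula on the circle of radius R j / (j + 1). Two powers of the singularity are
integrated exactly and the remaining β - 2 are bounded by the distance 1/(j + 1) of the circle from
the singular point. This yields the exponent β - 1, one better than the sup bound. -/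
theorem norm_iteratedDeriv_zero_mul_pow_le {f : ℂ → ℂ} {R A β : ℝ} (hR : 0 < R)
    (hβ : 2 ≤ β) (hf : DifferentiableOn ℂ f (Metric.ball 0 R))
    (hb : ∀ z : ℂ, R / 2 ≤ ‖z‖ → ‖z‖ < R → ‖f z‖ ≤ A * ‖1 - z / R‖ ^ (-β)) (j : ℕ) (hj : 1 ≤ j) :
    ‖iteratedDeriv j f 0‖ * R ^ j ≤ j.factorial * (3 * A * ((j : ℝ) + 1) ^ (β - 1)) := by
  have hj1 : (1 : ℝ) ≤ j := by exact_mod_cast hj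
  set ρ : ℝ := j / (j + 1) with hρ
  have hρ0 : 0 < ρ := by positivity
  have hρ1 : ρ < 1 := by rw [hρ, div_lt_one (by positivity)]; linarith
  have hρ2 : 1 / 2 ≤ ρ := by rw [hρ, div_le_div_iff₀ (by norm_num) (by positivity)]; linarith
  have h1ρ : 1 - ρ = 1 / (j + 1) := by rw [hρ]; field_simp; ring
  have hA : 0 ≤ A := by
    have := (norm_nonneg _).trans (hb ((R / 2 : ℝ) : ℂ)
      (by rw [Complex.norm_real, Real.norm_eq_abs, abs_of_pos (by positivity)])
      (by rw [Complex.norm_real, Real.norm_eq_abs, abs_of_pos (by positivity)]; linarith))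
    refine nonneg_of_mul_nonneg_left this (Real.rpow_pos_of_pos ?_ _)
    rw [norm_pos_iff]
    intro h
    have hR' : (R : ℂ) ≠ 0 := by exact_mod_cast hR.ne'
    push_cast at h
    field_simp at h
    norm_num at h
  lift R to ℝ≥0 using hR.le
  set r : ℝ≥0 := ⟨R * ρ, by positivity⟩ with hr
  have hrr : (r : ℝ) = R * ρ := rfl
  have hr0 : 0 < r := by
    have : (0 : ℝ) < r := by rw [hrr]; positivity
    exact_mod_cast this
  have hrR : (r : ℝ) < R := by rw [hrr]; nlinarith
  have hps := (hf.mono (Metric.closedBall_subset_ball hrR)).hasFPowerSeriesOnBall hr0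
  have h1 := hps.factorial_smul 1 j
  rw [← iteratedDeriv_eq_iteratedFDeriv] at h1
  have h2 : ‖iteratedDeriv j f 0‖ ≤ j.factorial * ‖cauchyPowerSeries f 0 r j‖ := by
    rw [← h1, nsmul_eq_mul, norm_mul]
    simp only [Complex.norm_natCast]
    gcongr
    refine ((cauchyPowerSeries f 0 r j).le_opNorm _).trans ?_
    simp
  have h3 := norm_cauchyPowerSeries_le f 0 r j
  have hcirc : ∀ t : ℝ, circleMap 0 r t / (R : ℝ) = circleMap 0 ρ t := by
    intro t
    have hR' : ((R : ℝ) : ℂ) ≠ 0 := by exact_mod_cast hR.ne'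
    simp only [circleMap, hrr]
    push_cast
    field_simp
    ring
  have hlow : ∀ t : ℝ, 1 - ρ ≤ ‖1 - circleMap 0 ρ t‖ := by
    intro t
    have := norm_sub_norm_le (1 : ℂ) (circleMap 0 ρ t)
    simpa [abs_of_pos hρ0] using this
  have hpt : ∀ t : ℝ, ‖f (circleMap 0 r t)‖ ≤
      A * (1 - ρ) ^ (2 - β) * (‖1 - circleMap 0 ρ t‖ ^ 2)⁻¹ := by
    intro t
    have hn : ‖circleMap 0 r t‖ = R * ρ := by simp [hrr, abs_of_pos hρ0]
    refine (hb _ (by rw [hn]; nlinarith) (by rw [hn]; nlinarith)).trans ?_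
    rw [hcirc]
    have hpos : 0 < ‖1 - circleMap 0 ρ t‖ := lt_of_lt_of_le (by linarith) (hlow t)
    have : ‖1 - circleMap 0 ρ t‖ ^ (-β) = ‖1 - circleMap 0 ρ t‖ ^ (2 - β) *
        (‖1 - circleMap 0 ρ t‖ ^ 2)⁻¹ := by
      rw [← Real.rpow_natCast, ← Real.rpow_neg hpos.le, ← Real.rpow_add hpos]
      congr 1; push_cast; ring
    rw [this, mul_assoc]
    gcongr A * (?_ * _)
    exact Real.rpow_le_rpow_of_nonpos (by linarith) (hlow t) (by linarith)
  have hcont : Continuous fun t : ℝ => (‖1 - circleMap 0 ρ t‖ ^ 2)⁻¹ := by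
    refine Continuous.inv₀ (by fun_prop) fun t => ?_
    have : 0 < ‖1 - circleMap 0 ρ t‖ := lt_of_lt_of_le (by linarith) (hlow t)
    positivity
  have hcont2 : Continuous fun t : ℝ => f (circleMap 0 r t) := by
    refine hf.continuousOn.comp_continuous (by fun_prop) fun t => ?_
    simp only [Metric.mem_ball, dist_zero_right, norm_circleMap_zero]
    rw [abs_of_pos (by exact_mod_cast hr0)]
    exact hrR
  have h4 : ∫ t : ℝ in (0)..(2 * Real.pi), ‖f (circleMap 0 r t)‖ ≤
      A * (1 - ρ) ^ (2 - β) * (2 * Real.pi / (1 - ρ ^ 2)) := by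
    rw [← intervalIntegral_inv_norm_one_sub_sq hρ0 hρ1, ← intervalIntegral.integral_const_mul]
    exact intervalIntegral.integral_mono_on (by positivity)
      (hcont2.norm.intervalIntegrable _ _) ((hcont.const_mul _).intervalIntegrable _ _)
      fun t _ => hpt t
  have h5 : (1 - ρ) ^ (2 - β) / (1 - ρ ^ 2) ≤ ((j : ℝ) + 1) ^ (β - 1) := by
    have hpos : (0 : ℝ) < 1 - ρ := by linarith
    have e : ((j : ℝ) + 1) ^ (β - 1) = (1 - ρ) ^ (2 - β) / (1 - ρ) := by
      rw [h1ρ, one_div, Real.inv_rpow (by positivity), ← Real.rpow_neg (by positivity), div_inv_eq_mul,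
        ← Real.rpow_add_one (by positivity)]
      congr 1; ring
    rw [e]
    have : 0 ≤ (1 - ρ) ^ (2 - β) := by positivity
    gcongr
    nlinarith
  -- The cost of a radius smaller than R is (1 + 1/j)^j ≤ e, which produces the constant 3.
  have h6 : (ρ⁻¹) ^ j ≤ 3 := by
    have e : ρ⁻¹ = (j : ℝ)⁻¹ + 1 := by rw [hρ]; field_simp; ring
    rw [e]
    calc ((j : ℝ)⁻¹ + 1) ^ j ≤ (Real.exp ((j : ℝ)⁻¹)) ^ j := by
          gcongr; exact Real.add_one_le_exp _
      _ = Real.exp 1 := by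
          rw [← Real.exp_nat_mul]; congr 1; field_simp
      _ ≤ 3 := Real.exp_one_lt_d9.le.trans (by norm_num)
  have hr' : |(r : ℝ)|⁻¹ ^ j * (R : ℝ) ^ j = (ρ⁻¹) ^ j := by
    rw [abs_of_pos (by exact_mod_cast hr0), ← mul_pow, hrr]
    congr 1; field_simp
  calc ‖iteratedDeriv j f 0‖ * (R : ℝ) ^ j
      ≤ (j.factorial * (((2 * Real.pi)⁻¹ * (A * (1 - ρ) ^ (2 - β) * (2 * Real.pi / (1 - ρ ^ 2))))
          * |(r : ℝ)|⁻¹ ^ j)) * (R : ℝ) ^ j := by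
        gcongr
        refine h2.trans ?_
        gcongr
        refine h3.trans ?_
        gcongr
    _ = j.factorial * (A * ((1 - ρ) ^ (2 - β) / (1 - ρ ^ 2)) * (|(r : ℝ)|⁻¹ ^ j * (R : ℝ) ^ j)) := by
        have := Real.pi_pos.ne'
        field_simp
    _ ≤ j.factorial * (A * ((j : ℝ) + 1) ^ (β - 1) * 3) := by
        rw [hr']
        gcongr
    _ = _ := by ring

/-- An open subset of `domainDelta R η φ` that contains the closed disc of radius `R` except `R`. -/
theorem exists_isOpen_subset_domainDelta {R η φ : ℝ} (hR : 0 < R) (hη : 0 < η) (hφ : 0 < φ)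
    (hφ' : φ < Real.pi / 2) :
    ∃ V : Set ℂ, IsOpen V ∧ V ⊆ domainDelta R η φ ∧ ∀ z : ℂ, ‖z‖ ≤ R → z ≠ R → z ∈ V := by
  -- Left of the line re z = R the argument of z - R exceeds π/2 > φ in absolute value, and the
  -- closed disc meets that line only at R.
  refine ⟨{z | ‖z‖ < ‖(R : ℂ) * (1 + η * Complex.exp (φ * Complex.I))‖ ∧ z.re < R},
    (isOpen_lt continuous_norm continuous_const).inter
      (isOpen_lt Complex.continuous_re continuous_const), ?_, ?_⟩
  · rintro z ⟨hz1, hz2⟩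
    refine ⟨hz1, ?_, ?_⟩
    · rintro rfl
      simp at hz2
    · refine hφ'.trans ?_
      by_contra h
      push Not at h
      rw [Complex.abs_arg_le_pi_div_two_iff] at h
      simp at h
      linarith
  · intro z hz hzR
    have hcos : 0 < Real.cos φ := Real.cos_pos_of_mem_Ioo ⟨by linarith, hφ'⟩
    constructor
    · refine hz.trans_lt ?_
      rw [norm_mul, Complex.norm_real, Real.norm_eq_abs, abs_of_pos hR]
      have : 1 < ‖(1 + η * Complex.exp (φ * Complex.I) : ℂ)‖ := by
        refine lt_of_lt_of_le ?_ (Complex.re_le_norm _)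
        simp [Complex.exp_re]
        positivity
      nlinarith
    · have h1 : z.re ≤ ‖z‖ := Complex.re_le_norm z
      rcases lt_or_eq_of_le (h1.trans hz) with h | h
      · exact h
      · exfalso
        apply hzR
        have h2 : ‖z‖ = R := le_antisymm hz (h ▸ h1)
        have h3 := Complex.sq_norm z
        rw [Complex.normSq_apply, h2, h] at h3
        have : z.im = 0 := by nlinarith
        exact Complex.ext (by simpa using h) (by simpa using this)

theorem differentiableOn_iteratedDeriv {f : ℂ → ℂ} {V : Set ℂ} (hV : IsOpen V)
    (hf : DifferentiableOn ℂ f V) (n : ℕ) : DifferentiableOn ℂ (iteratedDeriv n f) V := by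
  induction n with
  | zero => simpa using hf
  | succ n ih =>
    rw [iteratedDeriv_succ]
    exact ih.deriv hV

/-- Near R the bound is the hypothesis; the rest of the closed disc is a compact subset of V, on
which F is bounded. -/
theorem exists_bound_of_isBigO {R η φ β : ℝ} (hR : 0 < R) (hβ : 0 ≤ β) {V : Set ℂ} (hVΔ : V ⊆ domainDelta R η φ)
    (hV : ∀ z : ℂ, ‖z‖ ≤ R → z ≠ R → z ∈ V) {F : ℂ → ℂ} (hF : ContinuousOn F V)
    (hO : F =O[𝓝[domainDelta R η φ] (R : ℂ)] fun z : ℂ => ‖1 - z / R‖ ^ (-β)) :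
    ∃ A : ℝ, 0 ≤ A ∧ ∀ z : ℂ, ‖z‖ < R → ‖F z‖ ≤ A * ‖1 - z / R‖ ^ (-β) := by
  have hR' : (R : ℂ) ≠ 0 := by exact_mod_cast hR.ne'
  obtain ⟨C, hC0, hC⟩ := hO.exists_pos
  rw [isBigOWith_iff, eventually_nhdsWithin_iff, Metric.eventually_nhds_iff] at hC
  obtain ⟨ε, hε, hC⟩ := hC
  have hK : IsCompact (Metric.closedBall (0 : ℂ) R \ Metric.ball (R : ℂ) ε) :=
    (isCompact_closedBall _ _).diff Metric.isOpen_ball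
  have hKV : Metric.closedBall (0 : ℂ) R \ Metric.ball (R : ℂ) ε ⊆ V := by
    rintro z ⟨hz1, hz2⟩
    refine hV z (by simpa using hz1) ?_
    rintro rfl
    exact hz2 (Metric.mem_ball_self hε)
  obtain ⟨M, hM⟩ := hK.exists_bound_of_continuousOn (hF.mono hKV)
  -- On the disc |1 - z/R| ≤ 2, so its power -β is at least 2^(-β).
  refine ⟨max C (M * 2 ^ β), le_max_of_le_left hC0.le, fun z hz => ?_⟩
  have hzR : z ≠ R := by
    rintro rfl
    simp [abs_of_pos hR] at hz
  have hpos : 0 < ‖1 - z / R‖ := by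
    rw [norm_pos_iff, sub_ne_zero]
    intro h
    apply hzR
    field_simp at h
    exact h.symm
  by_cases hd : dist z R < ε
  · have h1 := hC hd (hVΔ (hV z hz.le hzR))
    rw [Real.norm_of_nonneg (by positivity)] at h1
    refine h1.trans ?_
    gcongr
    exact le_max_left _ _
  · have h1 := hM z ⟨by simpa using hz.le, by simpa using hd⟩
    have h2 : ‖1 - z / R‖ ≤ 2 := by
      refine (norm_sub_le _ _).trans ?_
      rw [norm_one, norm_div, Complex.norm_real, Real.norm_eq_abs, abs_of_pos hR]
      have : ‖z‖ / R ≤ 1 := by rw [div_le_one hR]; exact hz.le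
      linarith
    have h3 : (2 : ℝ) ^ (-β) ≤ ‖1 - z / R‖ ^ (-β) :=
      Real.rpow_le_rpow_of_nonpos hpos h2 (by linarith)
    have hM0 : 0 ≤ M := (norm_nonneg _).trans h1
    calc ‖F z‖ ≤ M := h1
      _ = M * 2 ^ β * 2 ^ (-β) := by
        rw [mul_assoc, ← Real.rpow_add (by norm_num)]; simp
      _ ≤ max C (M * 2 ^ β) * ‖1 - z / R‖ ^ (-β) := by
        gcongr
        exact le_max_right _ _

theorem iteratedDeriv_zero_eq_coeff {a : ℕ → ℝ≥0} {R : ℝ} {g : ℂ → ℂ} (hR : 0 < R)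
    (hrad : (genSeries a).radius = ENNReal.ofReal R)
    (hg : ∀ z : ℂ, ‖z‖ < R → g z = (genSeries a).sum z) (j : ℕ) :
    iteratedDeriv j g 0 = j.factorial * (((a j : ℝ) / j : ℝ) : ℂ) := by
  have h1 : HasFPowerSeriesOnBall (genSeries a).sum (genSeries a) 0 (genSeries a).radius :=
    (genSeries a).hasFPowerSeriesOnBall (by rw [hrad]; simpa using hR)
  have h2 := h1.factorial_smul 1 j
  rw [← iteratedDeriv_eq_iteratedFDeriv] at h2
  have h3 : iteratedDeriv j g 0 = iteratedDeriv j (genSeries a).sum 0 := by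
    refine Filter.EventuallyEq.iteratedDeriv_eq j ?_
    filter_upwards [Metric.ball_mem_nhds (0 : ℂ) hR] with z hz
    exact hg z (by simpa using hz)
  rw [h3, ← h2, nsmul_eq_mul]
  congr 1
  simp [genSeries, FormalMultilinearSeries.ofScalars]

theorem iteratedDeriv_iteratedDeriv (m n : ℕ) (f : ℂ → ℂ) :
    iteratedDeriv m (iteratedDeriv n f) = iteratedDeriv (m + n) f := by
  simp only [iteratedDeriv_eq_iterate, Function.iterate_add, Function.comp]

/-- The sequence `a_j R^j`, `j ≥ 1`, set to `0` at `0`. -/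
noncomputable def scaled (a : ℕ → ℝ≥0) (R : ℝ) (j : ℕ) : ℝ := if j = 0 then 0 else (a j : ℝ) * R ^ j

theorem scaled_nonneg {a : ℕ → ℝ≥0} {R : ℝ} (hR : 0 < R) (j : ℕ) : 0 ≤ scaled a R j := by
  unfold scaled
  split_ifs <;> positivity

theorem exists_forall_le_of_eventually {u v : ℕ → ℝ} {n₀ : ℕ} {C : ℝ}
    (hv : ∀ j, 1 ≤ j → 0 < v j) (h : ∀ j, n₀ ≤ j → |u j| ≤ C * v j) :
    ∃ C' : ℝ, 0 ≤ C' ∧ ∀ j, 1 ≤ j → |u j| ≤ C' * v j := by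
  refine ⟨|C| + ∑ i ∈ Finset.Ico 1 n₀, |u i| / v i, ?_, fun j hj => ?_⟩
  · refine add_nonneg (abs_nonneg _) (Finset.sum_nonneg fun i hi => ?_)
    exact div_nonneg (abs_nonneg _) (hv i (Finset.mem_Ico.1 hi).1).le
  · rw [add_mul]
    have hs : 0 ≤ ∑ i ∈ Finset.Ico 1 n₀, |u i| / v i := Finset.sum_nonneg fun i hi =>
      div_nonneg (abs_nonneg _) (hv i (Finset.mem_Ico.1 hi).1).le
    by_cases hjn : n₀ ≤ j
    · have := h j hjn
      have h1 : C * v j ≤ |C| * v j := by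
        have := (hv j hj).le
        gcongr
        exact le_abs_self C
      have h2 := mul_nonneg hs (hv j hj).le
      linarith
    · have h1 : |u j| / v j ≤ ∑ i ∈ Finset.Ico 1 n₀, |u i| / v i :=
        Finset.single_le_sum (f := fun i => |u i| / v i)
          (fun i hi => div_nonneg (abs_nonneg _) (hv i (Finset.mem_Ico.1 hi).1).le)
          (Finset.mem_Ico.2 ⟨hj, not_le.1 hjn⟩)
      rw [div_le_iff₀ (hv j hj)] at h1
      have h2 := mul_nonneg (abs_nonneg C) (hv j hj).le
      linarith

/-- After n ≥ s + 2 derivatives the singularity has exponent n - s ≥ 2 and the Cauchy estimate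
applies. Differentiation multiplies the coefficients by at least (j + 1)^n, which is divided out
again. -/
theorem exists_scaled_le_rpow {κ : ℕ → ℝ≥0} {R η φ s a : ℝ} {gκ : ℂ → ℂ}
    (hR : 0 < R) (hη : 0 < η) (hφ : 0 < φ) (hφ' : φ < Real.pi / 2)
    (hκ_radius : (genSeries κ).radius = ENNReal.ofReal R)
    (hgκ : ∀ z : ℂ, ‖z‖ < R → gκ z = (genSeries κ).sum z)
    (hgκ_holo : DifferentiableOn ℂ gκ (domainDelta R η φ)) (hs : 1 < s)
    (hgκ_high : ∀ n : ℕ, s < n → ∃ d : ℝ, 0 < d ∧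
      (fun z : ℂ => modDeriv gκ n z -
          ((Real.Gamma (-s + n) * a / Real.Gamma (-s) : ℝ) : ℂ) * (1 - z / R) ^ ((s - n : ℝ) : ℂ))
        =O[𝓝[domainDelta R η φ] (R : ℂ)] fun z : ℂ => ‖1 - z / R‖ ^ (s - n + d)) :
    ∃ C : ℝ, 0 ≤ C ∧ ∀ j, 1 ≤ j → scaled κ R j ≤ C * (j : ℝ) ^ (-s) := by
  obtain ⟨V, hVo, hVΔ, hV⟩ := exists_isOpen_subset_domainDelta hR hη hφ hφ'
  obtain ⟨n, hn⟩ := exists_nat_ge (s + 2)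
  obtain ⟨d, hd, hO⟩ := hgκ_high n (by linarith)
  have hdiff := differentiableOn_iteratedDeriv hVo (hgκ_holo.mono hVΔ) n
  have hballV : Metric.ball (0 : ℂ) R ⊆ V := fun z hz => hV z (by simpa using (le_of_lt (by simpa using hz))) (by
    rintro rfl
    simp [abs_of_pos hR] at hz)
  have hR' : (R : ℂ) ≠ 0 := by exact_mod_cast hR.ne'
  have htend : Tendsto (fun z : ℂ => ‖1 - z / R‖) (𝓝[domainDelta R η φ] (R : ℂ)) (𝓝 0) := by
    have : ContinuousAt (fun z : ℂ => ‖1 - z / R‖) R := by fun_prop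
    have h2 := this.tendsto
    simp only [div_self hR', sub_self, norm_zero] at h2
    exact h2.mono_left nhdsWithin_le_nhds
  have hpos : ∀ᶠ z : ℂ in 𝓝[domainDelta R η φ] (R : ℂ), 0 < ‖1 - z / R‖ := by
    filter_upwards [self_mem_nhdsWithin] with z hz
    rw [norm_pos_iff, sub_ne_zero]
    intro h
    apply hz.2.1
    field_simp at h
    exact h.symm
  have hO2 : (fun z : ℂ => modDeriv gκ n z) =O[𝓝[domainDelta R η φ] (R : ℂ)]
      fun z : ℂ => ‖1 - z / R‖ ^ (-((n : ℝ) - s)) := by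
    have e1 : (fun z : ℂ => ‖1 - z / R‖ ^ (s - n + d)) =O[𝓝[domainDelta R η φ] (R : ℂ)]
        fun z : ℂ => ‖1 - z / R‖ ^ (-((n : ℝ) - s)) := by
      refine IsBigO.of_bound 1 ?_
      filter_upwards [hpos, htend.eventually_le_const (zero_lt_one)] with z hz hz1
      rw [Real.norm_of_nonneg (by positivity), Real.norm_of_nonneg (by positivity), one_mul]
      exact Real.rpow_le_rpow_of_exponent_ge hz hz1 (by linarith)
    have e2 : (fun z : ℂ => ((Real.Gamma (-s + n) * a / Real.Gamma (-s) : ℝ) : ℂ) *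
        (1 - z / R) ^ ((s - n : ℝ) : ℂ)) =O[𝓝[domainDelta R η φ] (R : ℂ)]
        fun z : ℂ => ‖1 - z / R‖ ^ (-((n : ℝ) - s)) := by
      refine IsBigO.of_bound ‖((Real.Gamma (-s + n) * a / Real.Gamma (-s) : ℝ) : ℂ)‖ ?_
      filter_upwards with z
      rw [norm_mul, Complex.norm_cpow_real, Real.norm_of_nonneg (by positivity), neg_sub]
    refine ((hO.trans e1).add e2).congr_left fun z => by ring
  have hcont : ContinuousOn (fun z : ℂ => modDeriv gκ n z) V := by
    unfold modDeriv
    exact (continuousOn_pow n).mul hdiff.continuousOn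
  obtain ⟨A, hA0, hA⟩ := exists_bound_of_isBigO hR (by linarith : 0 ≤ (n : ℝ) - s) hVΔ hV
    hcont hO2
  have hb : ∀ z : ℂ, R / 2 ≤ ‖z‖ → ‖z‖ < R →
      ‖iteratedDeriv n gκ z‖ ≤ ((2 / R) ^ n * A) * ‖1 - z / R‖ ^ (-((n : ℝ) - s)) := by
    intro z hz1 hz2
    have h1 := hA z hz2
    unfold modDeriv at h1
    rw [norm_mul, norm_pow] at h1
    have h2 : (R / 2) ^ n * ‖iteratedDeriv n gκ z‖ ≤ A * ‖1 - z / R‖ ^ (-((n : ℝ) - s)) :=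
      le_trans (by gcongr) h1
    calc ‖iteratedDeriv n gκ z‖ = (2 / R) ^ n * ((R / 2) ^ n * ‖iteratedDeriv n gκ z‖) := by
          rw [← mul_assoc, ← mul_pow]; field_simp; simp
      _ ≤ _ := by rw [mul_assoc]; gcongr
  have hco := norm_iteratedDeriv_zero_mul_pow_le hR (by linarith : 2 ≤ (n : ℝ) - s) (hdiff.mono hballV) hb
  have main : ∀ j, n + 1 ≤ j → |scaled κ R j| ≤
      (3 * ((2 / R) ^ n * A) * R ^ n * (n + 1) ^ (s + 1)) * (j : ℝ) ^ (-s) := by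
    intro l hl
    obtain ⟨j, rfl⟩ := Nat.exists_eq_add_of_le' (Nat.le_of_succ_le hl)
    have hj : 1 ≤ j := by omega
    have h1 := hco j hj
    rw [iteratedDeriv_iteratedDeriv, iteratedDeriv_zero_eq_coeff hR hκ_radius hgκ, norm_mul,
      Complex.norm_natCast, Complex.norm_real, Real.norm_of_nonneg (by positivity)] at h1
    have hfac : (j.factorial : ℝ) * ((j : ℝ) + 1) ^ n ≤ (j + n).factorial := by
      have := Nat.factorial_mul_pow_le_factorial (m := j) (n := n)
      exact_mod_cast this
    have hjf : (0 : ℝ) < j.factorial := by positivity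
    rw [abs_of_nonneg (scaled_nonneg hR _)]
    have hjn0 : (0 : ℝ) < ((j + n : ℕ) : ℝ) := by positivity
    have hsc : scaled κ R (j + n) = (κ (j + n) : ℝ) * R ^ (j + n) := by
      unfold scaled; rw [if_neg (by omega)]
    have hj1 : (0 : ℝ) < (j : ℝ) + 1 := by positivity
    have h3 : ((j : ℝ) + 1) ^ n * (((κ (j + n) : ℝ) / ((j + n : ℕ) : ℝ)) * R ^ j) ≤
        3 * ((2 / R) ^ n * A) * ((j : ℝ) + 1) ^ ((n : ℝ) - s - 1) := by
      refine le_of_mul_le_mul_left ?_ hjf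
      refine le_trans ?_ h1
      rw [← mul_assoc, mul_assoc (((j + n).factorial : ℝ))]
      gcongr
    have h4 : (κ (j + n) : ℝ) * R ^ j ≤
        3 * ((2 / R) ^ n * A) * (((j : ℝ) + 1) ^ (-s - 1) * ((j + n : ℕ) : ℝ)) := by
      have e : ((j : ℝ) + 1) ^ ((n : ℝ) - s - 1) = ((j : ℝ) + 1) ^ n * ((j : ℝ) + 1) ^ (-s - 1) := by
        rw [← Real.rpow_natCast, ← Real.rpow_add hj1]; congr 1; ring
      rw [e] at h3
      have : (κ (j + n) : ℝ) / ((j + n : ℕ) : ℝ) * R ^ j ≤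
        3 * ((2 / R) ^ n * A) * ((j : ℝ) + 1) ^ (-s - 1) := by
        refine le_of_mul_le_mul_left ?_ (pow_pos hj1 n)
        linarith
      calc (κ (j + n) : ℝ) * R ^ j = (κ (j + n) : ℝ) / ((j + n : ℕ) : ℝ) * R ^ j * ((j + n : ℕ) : ℝ) := by
            field_simp
        _ ≤ 3 * ((2 / R) ^ n * A) * ((j : ℝ) + 1) ^ (-s - 1) * ((j + n : ℕ) : ℝ) := by gcongr
        _ = _ := by ring
    have h5 : ((j : ℝ) + 1) ^ (-s - 1) * ((j + n : ℕ) : ℝ) ≤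
        (n + 1) ^ (s + 1) * ((j + n : ℕ) : ℝ) ^ (-s) := by
      have h6 : ((j + n : ℕ) : ℝ) / (n + 1) ≤ (j : ℝ) + 1 := by
        rw [div_le_iff₀ (by positivity)]
        push_cast
        nlinarith [(Nat.cast_nonneg j : (0 : ℝ) ≤ j), (Nat.cast_nonneg n : (0 : ℝ) ≤ n),
          mul_nonneg (Nat.cast_nonneg j : (0 : ℝ) ≤ j) (Nat.cast_nonneg n : (0 : ℝ) ≤ n)]
      have h7 : ((j : ℝ) + 1) ^ (-s - 1) ≤ (((j + n : ℕ) : ℝ) / (n + 1)) ^ (-s - 1) :=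
        Real.rpow_le_rpow_of_nonpos (by positivity) h6 (by linarith)
      calc ((j : ℝ) + 1) ^ (-s - 1) * ((j + n : ℕ) : ℝ)
          ≤ (((j + n : ℕ) : ℝ) / (n + 1)) ^ (-s - 1) * ((j + n : ℕ) : ℝ) := by gcongr
        _ = _ := by
          rw [Real.div_rpow (by positivity) (by positivity), div_mul_eq_mul_div,
            ← Real.rpow_add_one (by positivity), show -s - 1 = -(s + 1) by ring,
            Real.rpow_neg (by positivity : (0 : ℝ) ≤ n + 1), div_inv_eq_mul, mul_comm]
          congr 2; ring
    rw [hsc, pow_add, ← mul_assoc]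
    calc (κ (j + n) : ℝ) * R ^ j * R ^ n ≤
        3 * ((2 / R) ^ n * A) * ((n + 1) ^ (s + 1) * ((j + n : ℕ) : ℝ) ^ (-s)) * R ^ n := by
          refine mul_le_mul_of_nonneg_right (h4.trans ?_) (by positivity)
          gcongr
      _ = _ := by ring
  obtain ⟨C, hC0, hC⟩ := exists_forall_le_of_eventually (v := fun j : ℕ => (j : ℝ) ^ (-s))
    (fun j hj => Real.rpow_pos_of_pos (by exact_mod_cast hj) _) main
  exact ⟨C, hC0, fun j hj => (le_abs_self _).trans (hC j hj)⟩

/-- The function 2θ*/(R - z)³ has the Taylor coefficients that θ_j R^j = θ* would give. Subtracting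
it from the third derivative lowers the exponent of the singularity from 3 to 3 - d, and the Cauchy
estimate bounds what is left. -/
theorem exists_abs_scaled_sub_le_rpow {θ : ℕ → ℝ≥0} {R η φ θs : ℝ} {gθ : ℂ → ℂ}
    (hR : 0 < R) (hη : 0 < η) (hφ : 0 < φ) (hφ' : φ < Real.pi / 2)
    (hθ_radius : (genSeries θ).radius = ENNReal.ofReal R)
    (hgθ : ∀ z : ℂ, ‖z‖ < R → gθ z = (genSeries θ).sum z)
    (hgθ_holo : DifferentiableOn ℂ gθ (domainDelta R η φ))
    (hgθ_deriv : ∀ n : ℕ, 1 ≤ n → ∃ d : ℝ, 0 < d ∧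
      (fun z : ℂ => modDeriv gθ n z - (θs : ℂ) * ((n - 1).factorial : ℂ) / (1 - z / R) ^ n)
        =O[𝓝[domainDelta R η φ] (R : ℂ)] fun z : ℂ => ‖1 - z / R‖ ^ (-(n : ℝ) + d)) :
    ∃ d : ℝ, 0 < d ∧ ∃ C : ℝ, 0 ≤ C ∧
      ∀ j, 1 ≤ j → |scaled θ R j - θs| ≤ C * (j : ℝ) ^ (-d) := by
  obtain ⟨V, hVo, hVΔ, hV⟩ := exists_isOpen_subset_domainDelta hR hη hφ hφ'
  obtain ⟨d₀, hd₀, hO⟩ := hgθ_deriv 3 (by norm_num)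
  -- The cap at 1 keeps 3 - d ≥ 2, both for the Cauchy estimate and to absorb the double pole in
  -- `e2`.
  set d := min d₀ 1 with hd
  have hd0 : 0 < d := lt_min hd₀ one_pos
  have hd1 : d ≤ 1 := min_le_right _ _
  have hR' : (R : ℂ) ≠ 0 := by exact_mod_cast hR.ne'
  have hVR : ∀ z ∈ V, (1 - z / R : ℂ) ≠ 0 := by
    intro z hz h
    rw [sub_eq_zero] at h
    refine (hVΔ hz).2.1 ?_
    field_simp at h
    exact h.symm
  have hVR2 : ∀ z ∈ V, (R - z : ℂ) ≠ 0 := fun z hz h => (hVΔ hz).2.1 (sub_eq_zero.1 h).symm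
  have hdiff := differentiableOn_iteratedDeriv hVo (hgθ_holo.mono hVΔ) 3
  have hcomp : DifferentiableOn ℂ (fun z : ℂ => (2 * θs : ℂ) * (1 / (R - z) ^ 3)) V := by
    refine DifferentiableOn.const_mul (DifferentiableOn.div (by fun_prop) (by fun_prop) ?_) _
    intro z hz
    exact pow_ne_zero _ (hVR2 z hz)
  set f : ℂ → ℂ := fun z => iteratedDeriv 3 gθ z - (2 * θs : ℂ) * (1 / (R - z) ^ 3) with hf
  have hfd : DifferentiableOn ℂ f V := hdiff.sub hcomp
  have hballV : Metric.ball (0 : ℂ) R ⊆ V := fun z hz =>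
    hV z (by simpa using (le_of_lt (by simpa using hz))) (by
      rintro rfl
      simp [abs_of_pos hR] at hz)
  have htend : Tendsto (fun z : ℂ => ‖1 - z / R‖) (𝓝[domainDelta R η φ] (R : ℂ)) (𝓝 0) := by
    have : ContinuousAt (fun z : ℂ => ‖1 - z / R‖) R := by fun_prop
    have h2 := this.tendsto
    simp only [div_self hR', sub_self, norm_zero] at h2
    exact h2.mono_left nhdsWithin_le_nhds
  have hzR : ∀ᶠ z : ℂ in 𝓝[domainDelta R η φ] (R : ℂ), z ≠ R := by
    filter_upwards [self_mem_nhdsWithin] with z hz using hz.2.1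
  have hpos : ∀ᶠ z : ℂ in 𝓝[domainDelta R η φ] (R : ℂ), 0 < ‖1 - z / R‖ := by
    filter_upwards [hzR] with z hz
    rw [norm_pos_iff, sub_ne_zero]
    intro h
    apply hz
    field_simp at h
    exact h.symm
  have hO2 : (fun z : ℂ => z ^ 3 * f z) =O[𝓝[domainDelta R η φ] (R : ℂ)]
      fun z : ℂ => ‖1 - z / R‖ ^ (-(3 - d)) := by
    have e1 : (fun z : ℂ => ‖1 - z / R‖ ^ (-((3 : ℕ) : ℝ) + d₀)) =O[𝓝[domainDelta R η φ] (R : ℂ)]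
        fun z : ℂ => ‖1 - z / R‖ ^ (-(3 - d)) := by
      refine IsBigO.of_bound 1 ?_
      filter_upwards [hpos, htend.eventually_le_const (zero_lt_one)] with z hz hz1
      rw [Real.norm_of_nonneg (by positivity), Real.norm_of_nonneg (by positivity), one_mul]
      refine Real.rpow_le_rpow_of_exponent_ge hz hz1 ?_
      have := min_le_left d₀ 1
      push_cast
      linarith
    -- Replacing 1/(1 - w)³ by w³/(1 - w)³, with w = z/R, changes it by (1 + w + w²)/(1 - w)².
    have e2 : (fun z : ℂ => (2 * θs : ℂ) * ((1 + z / R + (z / R) ^ 2) / (1 - z / R) ^ 2))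
        =O[𝓝[domainDelta R η φ] (R : ℂ)] fun z : ℂ => ‖1 - z / R‖ ^ (-(3 - d)) := by
      refine IsBigO.of_bound (‖(2 * θs : ℂ)‖ * 7) ?_
      filter_upwards [hpos, htend.eventually_le_const (zero_lt_one)] with z hz hz1
      have h1 : ‖z / R‖ ≤ 2 := by
        calc ‖z / (R : ℂ)‖ = ‖1 - (1 - z / (R : ℂ))‖ := by congr 1; ring
          _ ≤ 1 + 1 := (norm_sub_le _ _).trans (by rw [norm_one]; linarith)
          _ = 2 := by norm_num
      have h2 : ‖1 + z / R + (z / R) ^ 2‖ ≤ 7 := by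
        refine (norm_add_le _ _).trans ?_
        have := norm_add_le (1 : ℂ) (z / R)
        rw [norm_one] at this
        rw [norm_pow]
        nlinarith [norm_nonneg (z / R)]
      rw [norm_mul, norm_div, norm_pow, Real.norm_of_nonneg (by positivity), mul_assoc]
      gcongr ?_ * ?_
      rw [div_eq_mul_inv]
      gcongr ?_ * ?_
      rw [← Real.rpow_natCast, ← Real.rpow_neg hz.le]
      refine Real.rpow_le_rpow_of_exponent_ge hz hz1 ?_
      push_cast
      linarith
    refine ((hO.trans e1).add e2).congr' ?_ EventuallyEq.rfl
    filter_upwards [hzR] with z hz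
    have h1 : (R - z : ℂ) ≠ 0 := sub_ne_zero.2 (Ne.symm hz)
    have h2 : (1 - z / R : ℂ) = (R - z) / R := by field_simp
    simp only [hf, modDeriv, h2]
    have h3 : (((3 - 1 : ℕ).factorial : ℕ) : ℂ) = 2 := by norm_num [Nat.factorial]
    rw [h3]
    field_simp
    ring
  have hcont : ContinuousOn (fun z : ℂ => z ^ 3 * f z) V :=
    (continuousOn_pow 3).mul hfd.continuousOn
  obtain ⟨A, hA0, hA⟩ := exists_bound_of_isBigO hR (by linarith : 0 ≤ 3 - d) hVΔ hV hcont hO2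
  have hb : ∀ z : ℂ, R / 2 ≤ ‖z‖ → ‖z‖ < R →
      ‖f z‖ ≤ ((2 / R) ^ 3 * A) * ‖1 - z / R‖ ^ (-(3 - d)) := by
    intro z hz1 hz2
    have h1 := hA z hz2
    rw [norm_mul, norm_pow] at h1
    have h2 : (R / 2) ^ 3 * ‖f z‖ ≤ A * ‖1 - z / R‖ ^ (-(3 - d)) :=
      le_trans (by gcongr) h1
    calc ‖f z‖ = (2 / R) ^ 3 * ((R / 2) ^ 3 * ‖f z‖) := by
          rw [← mul_assoc, ← mul_pow]; field_simp
      _ ≤ _ := by rw [mul_assoc]; gcongr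
  have hco := norm_iteratedDeriv_zero_mul_pow_le hR (by linarith : 2 ≤ 3 - d) (hfd.mono hballV) hb
  have h0V : (0 : ℂ) ∈ V := hballV (Metric.mem_ball_self hR)
  have hcoef : ∀ j : ℕ, iteratedDeriv j f 0 =
      j.factorial * ((((j + 1) * (j + 2) * ((θ (j + 3) : ℝ) - θs * (R ^ (j + 3))⁻¹) : ℝ)) : ℂ) := by
    intro j
    have hAt1 : ContDiffAt ℂ j (iteratedDeriv 3 gθ) 0 :=
      ((hdiff.analyticOnNhd hVo) 0 h0V).contDiffAt
    have hAt2 : ContDiffAt ℂ j (fun z : ℂ => 1 / ((R : ℂ) - z) ^ 3) 0 := by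
      have hcomp' : DifferentiableOn ℂ (fun z : ℂ => 1 / ((R : ℂ) - z) ^ 3) V := by
        refine DifferentiableOn.div (by fun_prop) (by fun_prop) ?_
        intro z hz
        exact pow_ne_zero _ (hVR2 z hz)
      exact ((hcomp'.analyticOnNhd hVo) 0 h0V).contDiffAt
    have e1 : f = iteratedDeriv 3 gθ - (fun z : ℂ => (2 * θs : ℂ) * (1 / ((R : ℂ) - z) ^ 3)) := rfl
    rw [e1, iteratedDeriv_sub hAt1 (contDiffAt_const.mul hAt2), iteratedDeriv_const_mul_field,
      iteratedDeriv_iteratedDeriv, iteratedDeriv_zero_eq_coeff hR hθ_radius hgθ]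
    have h2 := (Complex.one_div_sub_pow_hasFPowerSeriesOnBall_zero 2 hR').factorial_smul 1 j
    rw [← iteratedDeriv_eq_iteratedFDeriv] at h2
    rw [← h2]
    have h3 : ((Nat.choose (2 + j) 2 : ℕ) : ℂ) = (j + 1) * (j + 2) / 2 := by
      rw [Nat.cast_choose_two]; push_cast; ring
    have h4 : (((j + 3).factorial : ℕ) : ℂ) = (j + 3) * ((j + 2) * ((j + 1) * j.factorial)) := by
      rw [Nat.factorial_succ, Nat.factorial_succ, Nat.factorial_succ]; push_cast; ring
    have h5 : ((j : ℂ) + 3) ≠ 0 := by exact_mod_cast (by omega : j + 3 ≠ 0)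
    simp only [FormalMultilinearSeries.ofScalars, nsmul_eq_mul]
    simp
    rw [h3, h4, show j + 2 + 1 = j + 3 by ring]
    field_simp
  refine ⟨d, hd0, ?_⟩
  refine exists_forall_le_of_eventually (n₀ := 4)
    (C := 3 * ((2 / R) ^ 3 * A) * R ^ 3 * 4 ^ d)
    (fun j hj => Real.rpow_pos_of_pos (by exact_mod_cast hj) _) ?_
  intro l hl
  obtain ⟨j, rfl⟩ := Nat.exists_eq_add_of_le' (Nat.le_of_succ_le hl)
  have hj : 1 ≤ j := by omega
  have h1 := hco j hj
  rw [hcoef, norm_mul, Complex.norm_natCast, Complex.norm_real, Real.norm_eq_abs, abs_mul,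
    abs_of_pos (by positivity : (0 : ℝ) < (j + 1) * (j + 2)), mul_assoc] at h1
  have h2 := le_of_mul_le_mul_left h1 (by positivity : (0 : ℝ) < j.factorial)
  have hj1 : (0 : ℝ) < (j : ℝ) + 1 := by positivity
  have hsc : scaled θ R (j + 3) - θs =
      ((θ (j + 3) : ℝ) - θs * (R ^ (j + 3))⁻¹) * R ^ j * R ^ 3 := by
    unfold scaled; rw [if_neg (by omega), mul_assoc, ← pow_add]
    field_simp
  have e : ((j : ℝ) + 1) ^ (3 - d - 1) = ((j : ℝ) + 1) ^ 2 * ((j : ℝ) + 1) ^ (-d) := by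
    rw [← Real.rpow_natCast, ← Real.rpow_add hj1]; congr 1; push_cast; ring
  rw [e] at h2
  have h3 : |(θ (j + 3) : ℝ) - θs * (R ^ (j + 3))⁻¹| * R ^ j ≤
      3 * ((2 / R) ^ 3 * A) * ((j : ℝ) + 1) ^ (-d) := by
    refine le_of_mul_le_mul_left ?_ (pow_pos hj1 2)
    calc ((j : ℝ) + 1) ^ 2 * (|(θ (j + 3) : ℝ) - θs * (R ^ (j + 3))⁻¹| * R ^ j)
        ≤ ((j + 1) * (j + 2)) * |(θ (j + 3) : ℝ) - θs * (R ^ (j + 3))⁻¹| * R ^ j := by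
          rw [← mul_assoc]; gcongr; nlinarith
      _ ≤ _ := by linarith
  have h5 : ((j : ℝ) + 1) ^ (-d) ≤ 4 ^ d * ((j + 3 : ℕ) : ℝ) ^ (-d) := by
    have h6 : ((j + 3 : ℕ) : ℝ) / 4 ≤ (j : ℝ) + 1 := by
      rw [div_le_iff₀ (by norm_num)]
      push_cast
      linarith [(Nat.cast_nonneg j : (0 : ℝ) ≤ j)]
    refine (Real.rpow_le_rpow_of_nonpos (by positivity) h6 (by linarith)).trans (le_of_eq ?_)
    rw [Real.div_rpow (by positivity) (by positivity), Real.rpow_neg (by norm_num : (0 : ℝ) ≤ 4),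
      div_inv_eq_mul, mul_comm]
  rw [hsc, abs_mul, abs_mul, abs_of_pos (pow_pos hR j), abs_of_pos (pow_pos hR 3)]
  calc |(θ (j + 3) : ℝ) - θs * (R ^ (j + 3))⁻¹| * R ^ j * R ^ 3
      ≤ 3 * ((2 / R) ^ 3 * A) * (4 ^ d * ((j + 3 : ℕ) : ℝ) ^ (-d)) * R ^ 3 := by
        refine mul_le_mul_of_nonneg_right (h3.trans ?_) (by positivity)
        gcongr
    _ = _ := by ring

theorem summable_scaled {κ : ℕ → ℝ≥0} {R s C : ℝ} (hR : 0 < R) (hs : 1 < s)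
    (hC : ∀ j, 1 ≤ j → scaled κ R j ≤ C * (j : ℝ) ^ (-s)) : Summable (scaled κ R) := by
  rw [← summable_nat_add_iff 1]
  have : Summable fun j : ℕ => C * ((j + 1 : ℕ) : ℝ) ^ (-s) :=
    ((summable_nat_add_iff 1).2 (Real.summable_nat_rpow.2 (by linarith))).mul_left C
  exact Summable.of_nonneg_of_le (fun j => scaled_nonneg hR _) (fun j => hC _ (by omega)) this

/-- For r < R the modified first derivative is ∑ κ_j r^j; dominated convergence lets r tend to R. -/
theorem hasSum_scaled {κ : ℕ → ℝ≥0} {R η φ c₁ : ℝ} {gκ : ℂ → ℂ}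
    (hR : 0 < R) (hη : 0 < η) (hφ : 0 < φ) (hφ' : φ < Real.pi / 2)
    (hκ_radius : (genSeries κ).radius = ENNReal.ofReal R)
    (hgκ : ∀ z : ℂ, ‖z‖ < R → gκ z = (genSeries κ).sum z)
    (hgκ_holo : DifferentiableOn ℂ gκ (domainDelta R η φ))
    (hsum : Summable (scaled κ R))
    (hc : Tendsto (fun r : ℝ => modDeriv gκ 1 (r : ℂ)) (𝓝[<] R) (𝓝 (c₁ : ℂ))) :
    HasSum (scaled κ R) c₁ := by
  obtain ⟨V, hVo, hVΔ, hV⟩ := exists_isOpen_subset_domainDelta hR hη hφ hφ'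
  have hballV : Metric.ball (0 : ℂ) R ⊆ V := fun z hz =>
    hV z (by simpa using (le_of_lt (by simpa using hz))) (by
      rintro rfl
      simp [abs_of_pos hR] at hz)
  have hdiff := (differentiableOn_iteratedDeriv hVo (hgκ_holo.mono hVΔ) 1).mono hballV
  have hser : ∀ r : ℝ, 0 ≤ r → r < R → modDeriv gκ 1 (r : ℂ) = ((∑' j, scaled κ r j : ℝ) : ℂ) := by
    intro r hr0 hrR
    have h1 := Complex.hasSum_taylorSeries_on_ball hdiff (z := (r : ℂ))
      (by simpa [abs_of_nonneg hr0] using hrR)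
    have h2 : ∀ n : ℕ, ((n.factorial : ℂ))⁻¹ • ((r : ℂ) - 0) ^ n •
        iteratedDeriv n (iteratedDeriv 1 gκ) 0 = ((κ (n + 1) : ℝ) : ℂ) * (r : ℂ) ^ n := by
      intro n
      rw [iteratedDeriv_iteratedDeriv, iteratedDeriv_zero_eq_coeff hR hκ_radius hgκ]
      have hn : ((n : ℂ) + 1) ≠ 0 := by exact_mod_cast (by omega : n + 1 ≠ 0)
      have hf : (n.factorial : ℂ) ≠ 0 := by exact_mod_cast n.factorial_ne_zero
      simp only [smul_eq_mul, Nat.factorial_succ]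
      push_cast
      field_simp
      ring
    simp_rw [h2] at h1
    have h3 := h1.mul_left (r : ℂ)
    have h4 : HasSum (fun n => ((scaled κ r (n + 1) : ℝ) : ℂ)) (modDeriv gκ 1 (r : ℂ)) := by
      unfold modDeriv
      rw [pow_one]
      refine h3.congr_fun fun n => ?_
      unfold scaled
      rw [if_neg (by omega)]
      push_cast
      ring
    have h5 : HasSum (fun n => ((scaled κ r n : ℝ) : ℂ)) (modDeriv gκ 1 (r : ℂ)) := by
      refine (hasSum_nat_add_iff' 1).1 ?_
      simpa [scaled] using h4
    rw [← h5.tsum_eq, Complex.ofReal_tsum]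
  have hlim : Tendsto (fun r : ℝ => ∑' j, scaled κ r j) (𝓝[<] R) (𝓝 (∑' j, scaled κ R j)) := by
    refine tendsto_tsum_of_dominated_convergence hsum (fun j => ?_) ?_
    · have : Continuous fun r : ℝ => scaled κ r j := by
        unfold scaled
        split_ifs <;> fun_prop
      exact (this.tendsto R).mono_left nhdsWithin_le_nhds
    · filter_upwards [Ioo_mem_nhdsLT hR] with r hr j
      have h0 := hr.1
      rw [Real.norm_of_nonneg (scaled_nonneg hr.1 j)]
      unfold scaled
      split_ifs
      · rfl
      · gcongr
        exact hr.2.le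
  have h1 : Tendsto (fun r : ℝ => ((∑' j, scaled κ r j : ℝ) : ℂ)) (𝓝[<] R) (𝓝 (c₁ : ℂ)) := by
    refine hc.congr' ?_
    filter_upwards [Ioo_mem_nhdsLT hR] with r hr using hser r hr.1.le hr.2
  have h2 : Tendsto (fun r : ℝ => ((∑' j, scaled κ r j : ℝ) : ℂ)) (𝓝[<] R)
      (𝓝 ((∑' j, scaled κ R j : ℝ) : ℂ)) := (Complex.continuous_ofReal.tendsto _).comp hlim
  have h3 := tendsto_nhds_unique h1 h2
  rw [Complex.ofReal_inj.1 h3]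
  exact hsum.hasSum

/-! ### Coefficients of exponentials of power series -/

/-- The formal power series `∑_{j ≥ 1} (w_j / j) X^j`. -/
noncomputable def logSeries (w : ℕ → ℝ) : PowerSeries ℝ := PowerSeries.mk fun j => w j / j

/-- The coefficient of `X^n` in `exp (∑_{j ≥ 1} (w_j / j) X^j)`. -/
noncomputable def expCoeff (w : ℕ → ℝ) (n : ℕ) : ℝ :=
  PowerSeries.coeff n ((PowerSeries.exp ℝ).subst (logSeries w))

theorem constantCoeff_logSeries (w : ℕ → ℝ) : PowerSeries.constantCoeff (logSeries w) = 0 := by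
  simp [logSeries]

theorem hasSubst_logSeries (w : ℕ → ℝ) : PowerSeries.HasSubst (logSeries w) :=
  PowerSeries.HasSubst.of_constantCoeff_zero' (constantCoeff_logSeries w)

/-- Formal substitution as a sum over the powers of the inner series. For fixed n only finitely many
terms are nonzero, so it is also a convergent real series. -/
theorem hasSum_coeff_pow (w : ℕ → ℝ) (n : ℕ) :
    HasSum (fun k : ℕ => PowerSeries.coeff n (logSeries w ^ k) / k.factorial) (expCoeff w n) := by
  have hfin := PowerSeries.coeff_subst_finite' (hasSubst_logSeries w) (PowerSeries.exp ℝ) n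
  have h := PowerSeries.coeff_subst' (hasSubst_logSeries w) (PowerSeries.exp ℝ) n
  have e : ∀ k : ℕ, PowerSeries.coeff k (PowerSeries.exp ℝ) • PowerSeries.coeff n (logSeries w ^ k)
      = PowerSeries.coeff n (logSeries w ^ k) / k.factorial := by
    intro k
    rw [PowerSeries.coeff_exp]
    simp [div_eq_inv_mul]
  simp_rw [e] at h hfin
  replace hfin : (Function.support fun k : ℕ =>
    PowerSeries.coeff n (logSeries w ^ k) / (k.factorial : ℝ)).Finite := hfin
  unfold expCoeff
  rw [h, finsum_eq_sum_of_support_subset _ (s := hfin.toFinset) (by simp)]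
  exact hasSum_sum_of_ne_finset_zero fun k hk => by
    rw [Set.Finite.mem_toFinset, Function.mem_support, not_not] at hk
    exact hk

theorem expCoeff_zero (w : ℕ → ℝ) : expCoeff w 0 = 1 := by
  have h := hasSum_coeff_pow w 0
  refine h.unique ?_
  have e : ∀ k : ℕ, PowerSeries.coeff 0 (logSeries w ^ k) / k.factorial
      = if k = 0 then (1 : ℝ) else 0 := by
    intro k
    rw [PowerSeries.coeff_zero_eq_constantCoeff_apply, map_pow, constantCoeff_logSeries]
    rcases eq_or_ne k 0 with rfl | hk
    · simp
    · simp [hk]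
  simp_rw [e]
  exact hasSum_ite_eq 0 1

/-- The coefficients of F' = F · L', where F is the exponential of L. -/
theorem succ_mul_expCoeff (w : ℕ → ℝ) (n : ℕ) :
    ((n : ℝ) + 1) * expCoeff w (n + 1) =
      ∑ p ∈ Finset.HasAntidiagonal.antidiagonal n, expCoeff w p.1 * w (p.2 + 1) := by
  have h := congrArg (PowerSeries.coeff n)
    (PowerSeries.derivative_subst (f := PowerSeries.exp ℝ) (hasSubst_logSeries w))
  rw [PowerSeries.derivative_exp, PowerSeries.coeff_derivative, PowerSeries.coeff_mul] at h
  rw [mul_comm]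
  unfold expCoeff
  rw [h]
  refine Finset.sum_congr rfl fun p _ => ?_
  congr 1
  rw [PowerSeries.coeff_derivative, logSeries, PowerSeries.coeff_mk]
  push_cast
  field_simp

theorem mul_expCoeff (w : ℕ → ℝ) (n : ℕ) :
    (n : ℝ) * expCoeff w n = ∑ l ∈ Finset.Icc 1 n, w l * expCoeff w (n - l) := by
  cases n with
  | zero => simp
  | succ n =>
    push_cast
    rw [succ_mul_expCoeff]
    refine Finset.sum_nbij' (fun p => p.2 + 1) (fun l => (n + 1 - l, l - 1)) ?_ ?_ ?_ ?_ ?_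
    · intro p hp
      have := Finset.HasAntidiagonal.mem_antidiagonal.1 hp
      rw [Finset.mem_Icc]; omega
    · intro l hl
      rw [Finset.mem_Icc] at hl
      rw [Finset.HasAntidiagonal.mem_antidiagonal]; dsimp only; omega
    · intro p hp
      have := Finset.HasAntidiagonal.mem_antidiagonal.1 hp
      ext <;> dsimp only <;> omega
    · intro l hl
      rw [Finset.mem_Icc] at hl
      dsimp only; omega
    · intro p hp
      have := Finset.HasAntidiagonal.mem_antidiagonal.1 hp
      rw [mul_comm, show n + 1 - (p.2 + 1) = p.1 by omega]

/-- The recursion determines the sequence from its initial value; this identifies products,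
rescalings and explicit sequences as exponential coefficients. -/
theorem eq_expCoeff {w : ℕ → ℝ} {u : ℕ → ℝ} (h0 : u 0 = 1)
    (h : ∀ n : ℕ, ((n : ℝ) + 1) * u (n + 1) = ∑ p ∈ Finset.HasAntidiagonal.antidiagonal n, u p.1 * w (p.2 + 1))
    (n : ℕ) : u n = expCoeff w n := by
  induction n using Nat.strong_induction_on with
  | _ n ih =>
    cases n with
    | zero => rw [h0, expCoeff_zero]
    | succ n =>
      have h1 : ((n : ℝ) + 1) * u (n + 1) = ((n : ℝ) + 1) * expCoeff w (n + 1) := by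
        rw [h, succ_mul_expCoeff]
        refine Finset.sum_congr rfl fun p hp => ?_
        rw [ih _ (by have := Finset.HasAntidiagonal.mem_antidiagonal.1 hp; omega)]
      exact mul_left_cancel₀ (by positivity) h1

theorem expCoeff_add (w w' : ℕ → ℝ) (n : ℕ) :
    expCoeff (w + w') n =
      ∑ p ∈ Finset.HasAntidiagonal.antidiagonal n, expCoeff w p.1 * expCoeff w' p.2 := by
  set P := (PowerSeries.exp ℝ).subst (logSeries w) with hP
  set Q := (PowerSeries.exp ℝ).subst (logSeries w') with hQ
  have key : ∀ m, PowerSeries.coeff m (P * Q) = expCoeff (w + w') m := by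
    refine eq_expCoeff ?_ ?_
    · rw [PowerSeries.coeff_mul]
      have h1 := expCoeff_zero w
      have h2 := expCoeff_zero w'
      unfold expCoeff at h1 h2
      simp only [Finset.Nat.antidiagonal_zero, Finset.sum_singleton]
      rw [h1, h2, mul_one]
    · intro m
      have hd : PowerSeries.derivative ℝ (P * Q) =
          P * Q * (PowerSeries.derivative ℝ (logSeries w) +
            PowerSeries.derivative ℝ (logSeries w')) := by
        rw [Derivation.leibniz, hP, hQ, PowerSeries.derivative_subst (hasSubst_logSeries w),
          PowerSeries.derivative_subst (hasSubst_logSeries w'), PowerSeries.derivative_exp]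
        simp only [smul_eq_mul]
        ring
      have h := congrArg (PowerSeries.coeff m) hd
      rw [PowerSeries.coeff_derivative] at h
      rw [mul_comm, h, PowerSeries.coeff_mul]
      refine Finset.sum_congr rfl fun p _ => ?_
      congr 1
      rw [map_add, PowerSeries.coeff_derivative, PowerSeries.coeff_derivative, logSeries, logSeries,
        PowerSeries.coeff_mk, PowerSeries.coeff_mk]
      simp only [Pi.add_apply]
      push_cast
      field_simp
  rw [← key, PowerSeries.coeff_mul]
  rfl

/-- The recursion only adds and multiplies, so a majorant of the weights gives a majorant of the
coefficients. -/
theorem abs_expCoeff_le {w w' : ℕ → ℝ} (h : ∀ j, 1 ≤ j → |w j| ≤ w' j) (n : ℕ) :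
    |expCoeff w n| ≤ expCoeff w' n := by
  induction n using Nat.strong_induction_on with
  | _ n ih =>
    cases n with
    | zero => simp [expCoeff_zero]
    | succ n =>
      have hn : (0 : ℝ) < (n : ℝ) + 1 := by positivity
      refine le_of_mul_le_mul_left ?_ hn
      rw [← abs_of_pos hn, ← abs_mul, abs_of_pos hn, succ_mul_expCoeff, succ_mul_expCoeff]
      refine (Finset.abs_sum_le_sum_abs _ _).trans (Finset.sum_le_sum fun p hp => ?_)
      rw [abs_mul]
      have h1 := ih p.1 (by have := Finset.HasAntidiagonal.mem_antidiagonal.1 hp; omega)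
      gcongr
      · exact (abs_nonneg _).trans h1
      · exact h _ (by omega)

theorem expCoeff_nonneg {w : ℕ → ℝ} (h : ∀ j, 1 ≤ j → 0 ≤ w j) (n : ℕ) : 0 ≤ expCoeff w n :=
  (abs_nonneg _).trans (abs_expCoeff_le (w := w) (w' := w)
    (fun j hj => by rw [abs_of_nonneg (h j hj)]) n)

theorem expCoeff_mul_pow (w : ℕ → ℝ) (r : ℝ) (n : ℕ) :
    expCoeff (fun j => w j * r ^ j) n = expCoeff w n * r ^ n := by
  symm
  refine eq_expCoeff (u := fun n => expCoeff w n * r ^ n) (by simp [expCoeff_zero]) (fun n => ?_) n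
  rw [← mul_assoc, succ_mul_expCoeff, Finset.sum_mul]
  refine Finset.sum_congr rfl fun p hp => ?_
  rw [← Finset.HasAntidiagonal.mem_antidiagonal.1 hp]
  ring

theorem expCoeff_one (n : ℕ) : expCoeff (fun _ => 1) n = 1 := by
  symm
  refine eq_expCoeff (u := fun _ => 1) rfl (fun n => ?_) n
  simp

/-- The constant weight 1 corresponds to 1/(1 - z), and multiplication by it forms partial sums. -/
theorem expCoeff_add_one (w : ℕ → ℝ) (n : ℕ) :
    expCoeff (w + fun _ => 1) n = ∑ i ∈ Finset.range (n + 1), expCoeff w i := by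
  rw [expCoeff_add]
  simp only [expCoeff_one, mul_one]
  exact Finset.Nat.sum_antidiagonal_eq_sum_range_succ (f := fun i _ => expCoeff w i) n

theorem hasSum_coeff_logSeries_pow {w : ℕ → ℝ} (hw : Summable fun j => |w j| / j) (k : ℕ) :
    Summable (fun n => |PowerSeries.coeff n (logSeries w ^ k)|) ∧
      ∑' n, |PowerSeries.coeff n (logSeries w ^ k)| ≤ (∑' j, |w j| / j) ^ k ∧
      ∑' n, PowerSeries.coeff n (logSeries w ^ k) = (∑' j, w j / j) ^ k := by
  have hT : ∀ j : ℕ, |w j / j| = |w j| / j := fun j => by rw [abs_div, Nat.abs_cast]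
  have hT0 : Summable fun j : ℕ => |w j / j| := by simpa only [hT] using hw
  induction k with
  | zero =>
    have e : ∀ n, PowerSeries.coeff n (logSeries w ^ 0) = if n = 0 then (1 : ℝ) else 0 := by
      intro n; rw [pow_zero, PowerSeries.coeff_one]
    have e' : ∀ n, |PowerSeries.coeff n (logSeries w ^ 0)| = if n = 0 then (1 : ℝ) else 0 := by
      intro n; rw [e]; split_ifs <;> simp
    simp_rw [e', e]
    refine ⟨(hasSum_ite_eq 0 (1 : ℝ)).summable, ?_, ?_⟩
    · rw [tsum_ite_eq, pow_zero]
    · rw [tsum_ite_eq, pow_zero]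
  | succ k ih =>
    obtain ⟨h1, h2, h3⟩ := ih
    have e : ∀ n, PowerSeries.coeff n (logSeries w ^ (k + 1)) =
        ∑ p ∈ Finset.HasAntidiagonal.antidiagonal n, PowerSeries.coeff p.1 (logSeries w ^ k) * (w p.2 / p.2) := by
      intro n
      rw [pow_succ, PowerSeries.coeff_mul]
      simp only [logSeries, PowerSeries.coeff_mk]
    have ebd : ∀ n, |PowerSeries.coeff n (logSeries w ^ (k + 1))| ≤
        ∑ p ∈ Finset.HasAntidiagonal.antidiagonal n, |PowerSeries.coeff p.1 (logSeries w ^ k)| * |w p.2 / p.2| := by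
      intro n
      rw [e]
      refine (Finset.abs_sum_le_sum_abs _ _).trans (le_of_eq ?_)
      simp only [abs_mul]
    have hs := summable_norm_sum_mul_antidiagonal_of_summable_norm
      (f := fun n => |PowerSeries.coeff n (logSeries w ^ k)|) (g := fun j : ℕ => |w j / j|)
      (by simpa only [Real.norm_eq_abs, abs_abs] using h1) (by simpa only [Real.norm_eq_abs, abs_abs] using hT0)
    have hs' : Summable fun n => ∑ p ∈ Finset.HasAntidiagonal.antidiagonal n,
        |PowerSeries.coeff p.1 (logSeries w ^ k)| * |w p.2 / p.2| := hs.of_norm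
    have hsum : Summable fun n => |PowerSeries.coeff n (logSeries w ^ (k + 1))| :=
      Summable.of_nonneg_of_le (fun _ => abs_nonneg _) ebd hs'
    refine ⟨hsum, ?_, ?_⟩
    · refine (hsum.tsum_le_tsum ebd hs').trans ?_
      rw [← tsum_mul_tsum_eq_tsum_sum_antidiagonal_of_summable_norm
        (f := fun n => |PowerSeries.coeff n (logSeries w ^ k)|) (g := fun j : ℕ => |w j / j|)
        (by simpa only [Real.norm_eq_abs, abs_abs] using h1) (by simpa only [Real.norm_eq_abs, abs_abs] using hT0), pow_succ]
      simp only [hT]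
      refine mul_le_mul_of_nonneg_right h2 (tsum_nonneg fun j => by positivity)
    · simp_rw [e]
      rw [← tsum_mul_tsum_eq_tsum_sum_antidiagonal_of_summable_norm
        (f := fun n => PowerSeries.coeff n (logSeries w ^ k)) (g := fun j : ℕ => w j / j)
        (by simpa only [Real.norm_eq_abs, abs_abs] using h1) (by simpa only [Real.norm_eq_abs, abs_abs] using hT0), h3, pow_succ]

/-- The double series over the powers k and the indices n converges absolutely, being dominated by
T^k / k!. Summing over n first gives the exponential series, summing over k first gives the
coefficients. -/
theorem hasSum_expCoeff {w : ℕ → ℝ} (hw : Summable fun j => |w j| / j) :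
    HasSum (expCoeff w) (Real.exp (∑' j, w j / j)) := by
  set T := ∑' j, |w j| / j
  have hsum : Summable fun p : ℕ × ℕ =>
      PowerSeries.coeff p.2 (logSeries w ^ p.1) / (p.1.factorial : ℝ) := by
    refine Summable.of_norm ?_
    refine (summable_prod_of_nonneg fun p => norm_nonneg _).2 ⟨fun k => ?_, ?_⟩
    · simp only [norm_div, Real.norm_eq_abs, Nat.abs_cast]
      exact (hasSum_coeff_logSeries_pow hw k).1.div_const _
    · refine Summable.of_nonneg_of_le (fun k => tsum_nonneg fun n => norm_nonneg _) (fun k => ?_)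
        (Real.summable_pow_div_factorial T)
      simp only [norm_div, Real.norm_eq_abs, Nat.abs_cast]
      rw [tsum_div_const]
      gcongr
      exact (hasSum_coeff_logSeries_pow hw k).2.1
  have h1 : ∑' p : ℕ × ℕ, PowerSeries.coeff p.2 (logSeries w ^ p.1) / (p.1.factorial : ℝ) =
      Real.exp (∑' j, w j / j) := by
    rw [hsum.tsum_prod, Real.exp_eq_exp_ℝ, NormedSpace.exp_eq_tsum_div]
    refine tsum_congr fun k => ?_
    dsimp only
    rw [tsum_div_const, (hasSum_coeff_logSeries_pow hw k).2.2]
  have h2 := hsum.hasSum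
  rw [h1] at h2
  have h3 := (Equiv.prodComm ℕ ℕ).hasSum_iff.2 h2
  refine h3.prod_fiberwise fun n => ?_
  exact hasSum_coeff_pow w n

theorem summable_abs_expCoeff {w : ℕ → ℝ} (hw : Summable fun j => |w j| / j) :
    Summable fun n => |expCoeff w n| := by
  refine Summable.of_nonneg_of_le (fun _ => abs_nonneg _)
    (fun n => abs_expCoeff_le (w' := fun j => |w j|) (fun _ _ => le_rfl) n) ?_
  exact (hasSum_expCoeff (w := fun j => |w j|) (by simpa using hw)).summable

theorem succ_mul_expCoeff_const (s : ℝ) (n : ℕ) :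
    ((n : ℝ) + 1) * expCoeff (fun _ => s) (n + 1) = (s + n) * expCoeff (fun _ => s) n := by
  cases n with
  | zero =>
    have := succ_mul_expCoeff (fun _ => s) 0
    simp only [expCoeff_zero] at this ⊢
    rw [this]
    simp [expCoeff_zero]
  | succ n =>
    have h1 := succ_mul_expCoeff (fun _ => s) (n + 1)
    have h2 := succ_mul_expCoeff (fun _ => s) n
    rw [Finset.Nat.sum_antidiagonal_eq_sum_range_succ
      (f := fun i _ => expCoeff (fun _ => s) i * s)] at h1 h2
    rw [Finset.sum_range_succ, ← h2] at h1
    rw [h1]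
    push_cast
    ring

theorem expCoeff_const (s : ℝ) (n : ℕ) :
    expCoeff (fun _ => s) n = (∏ j ∈ Finset.range n, (s + j)) / n.factorial := by
  induction n with
  | zero => simp [expCoeff_zero]
  | succ n ih =>
    have h := succ_mul_expCoeff_const s n
    rw [ih] at h
    rw [Finset.prod_range_succ, Nat.factorial_succ, eq_div_iff (by positivity)]
    push_cast
    have hn : (n.factorial : ℝ) ≠ 0 := by positivity
    field_simp at h
    linarith

/-- These are the coefficients of (1 - z)^(-s); Euler's limit formula for the Gamma function gives
their growth. -/
theorem tendsto_rpow_mul_expCoeff_const {s : ℝ} (hs : 0 < s) :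
    Tendsto (fun n : ℕ => (n : ℝ) ^ (1 - s) * expCoeff (fun _ => s) n) atTop
      (𝓝 (Real.Gamma s)⁻¹) := by
  have h1 := (Real.GammaSeq_tendsto_Gamma s).inv₀ (Real.Gamma_pos_of_pos hs).ne'
  have h2 : Tendsto (fun n : ℕ => (n : ℝ) / (n + s)) atTop (𝓝 1) :=
    tendsto_natCast_div_add_atTop s
  have h3 := h1.mul h2
  rw [mul_one] at h3
  refine h3.congr' ?_
  filter_upwards [eventually_gt_atTop 0] with n hn
  have hn0 : (0 : ℝ) < n := by exact_mod_cast hn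
  rw [expCoeff_const, Real.GammaSeq, Finset.prod_range_succ, Real.rpow_sub hn0, Real.rpow_one]
  have hp : 0 < (n : ℝ) ^ s := Real.rpow_pos_of_pos hn0 _
  have hf : (0 : ℝ) < n.factorial := by positivity
  have hs' : 0 < s + n := by positivity
  rw [add_comm (n : ℝ) s]
  field_simp

/-- By the recursion (n + 1) e_{n+1} is the convolution of the absolutely summable sequence e with
ε, which tends to 0; dominated convergence applies. -/
theorem tendsto_mul_expCoeff_zero {ε : ℕ → ℝ} (h0 : Tendsto ε atTop (𝓝 0))
    (hsum : Summable fun j => |ε j| / j) :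
    Tendsto (fun n : ℕ => (n : ℝ) * expCoeff ε n) atTop (𝓝 0) := by
  rw [← tendsto_add_atTop_iff_nat 1]
  obtain ⟨M, hM⟩ := h0.norm.bddAbove_range
  have hM' : ∀ j, |ε j| ≤ M := fun j => hM ⟨j, rfl⟩
  have hM0 : 0 ≤ M := (abs_nonneg _).trans (hM' 0)
  have key : Tendsto (fun n : ℕ => ∑' i : ℕ, if i ≤ n then expCoeff ε i * ε (n - i + 1) else 0)
      atTop (𝓝 (∑' _ : ℕ, (0 : ℝ))) := by
    refine tendsto_tsum_of_dominated_convergence (bound := fun i => |expCoeff ε i| * M)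
      ((summable_abs_expCoeff hsum).mul_right M) (fun i => ?_) (Eventually.of_forall fun n i => ?_)
    · have h1 : Tendsto (fun n : ℕ => ε (n - i + 1)) atTop (𝓝 0) :=
        h0.comp ((tendsto_add_atTop_nat 1).comp (tendsto_sub_atTop_nat i))
      have h2 := h1.const_mul (expCoeff ε i)
      rw [mul_zero] at h2
      refine h2.congr' ?_
      filter_upwards [eventually_ge_atTop i] with n hn
      rw [if_pos hn]
    · split_ifs
      · rw [norm_mul]
        exact mul_le_mul_of_nonneg_left (hM' _) (norm_nonneg _)
      · rw [norm_zero]; positivity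
  rw [tsum_zero] at key
  refine key.congr fun n => ?_
  push_cast
  rw [succ_mul_expCoeff, Finset.Nat.sum_antidiagonal_eq_sum_range_succ
    (f := fun i j => expCoeff ε i * ε (j + 1))]
  rw [tsum_eq_sum (s := Finset.range (n + 1))]
  · refine Finset.sum_congr rfl fun i hi => ?_
    rw [if_pos (by simpa [Nat.lt_succ_iff] using hi)]
  · intro i hi
    rw [if_neg (by simpa [Nat.lt_succ_iff] using hi)]

/-- The series is (1 - z)^(-s) times exp ∑ ε_j z^j / j. The second factor has absolutely summable
coefficients of size o(1/n), so asymptotically it contributes only its value at 1. The convolution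
is cut at j = n/2. -/
theorem tendsto_rpow_mul_expCoeff {s : ℝ} (hs : 0 < s) {ε : ℕ → ℝ} (h0 : Tendsto ε atTop (𝓝 0))
    (hsum : Summable fun j => |ε j| / j) :
    Tendsto (fun n : ℕ => (n : ℝ) ^ (1 - s) * expCoeff (fun j => s + ε j) n) atTop
      (𝓝 ((Real.Gamma s)⁻¹ * Real.exp (∑' j, ε j / j))) := by
  set u := expCoeff (fun _ => s) with hu
  set e := expCoeff ε with he
  have hu0 : ∀ n, 0 ≤ u n := fun n => expCoeff_nonneg (fun _ _ => hs.le) n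
  have hulim := tendsto_rpow_mul_expCoeff_const hs
  obtain ⟨C, hC⟩ := hulim.bddAbove_range
  have hC' : ∀ n : ℕ, (n : ℝ) ^ (1 - s) * u n ≤ C := fun n => hC ⟨n, rfl⟩
  have hC0 : 0 ≤ C := le_trans (by have := hu0 0; positivity) (hC' 0)
  -- For 2j ≤ n the indices n and n - j differ by a factor of at most 2. This gives the dominating
  -- sequence 2C|e_j|.
  have hratio : ∀ n j : ℕ, 2 * j ≤ n → 1 ≤ n → (n : ℝ) ^ (1 - s) ≤ 2 * ((n - j : ℕ) : ℝ) ^ (1 - s) := by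
    intro n j hj hn
    have hn0 : (0 : ℝ) < n := by exact_mod_cast hn
    have hk0 : (0 : ℝ) < ((n - j : ℕ) : ℝ) := by
      have : 0 < n - j := by omega
      exact_mod_cast this
    have hle : ((n - j : ℕ) : ℝ) ≤ n := by exact_mod_cast Nat.sub_le n j
    have hle2 : (n : ℝ) ≤ 2 * ((n - j : ℕ) : ℝ) := by exact_mod_cast (by omega : n ≤ 2 * (n - j))
    rcases le_total s 1 with h | h
    · calc (n : ℝ) ^ (1 - s) ≤ (2 * ((n - j : ℕ) : ℝ)) ^ (1 - s) :=
            Real.rpow_le_rpow hn0.le hle2 (by linarith)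
        _ = 2 ^ (1 - s) * ((n - j : ℕ) : ℝ) ^ (1 - s) := Real.mul_rpow (by norm_num) hk0.le
        _ ≤ 2 ^ (1 : ℝ) * ((n - j : ℕ) : ℝ) ^ (1 - s) := by
            gcongr
            · norm_num
            · linarith
        _ = _ := by rw [Real.rpow_one]
    · have h1 : (n : ℝ) ^ (1 - s) ≤ ((n - j : ℕ) : ℝ) ^ (1 - s) :=
        Real.rpow_le_rpow_of_nonpos hk0 hle (by linarith)
      have h2 : 0 ≤ ((n - j : ℕ) : ℝ) ^ (1 - s) := by positivity
      linarith
  have habs := summable_abs_expCoeff hsum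
  -- the terms with small index in the second factor
  have hA : Tendsto (fun n : ℕ => ∑' j : ℕ, if 2 * j ≤ n then (n : ℝ) ^ (1 - s) * u (n - j) * e j else 0)
      atTop (𝓝 (∑' j : ℕ, (Real.Gamma s)⁻¹ * e j)) := by
    refine tendsto_tsum_of_dominated_convergence (bound := fun j => 2 * C * |e j|)
      (habs.mul_left _) (fun j => ?_) ?_
    · have h1 : Tendsto (fun n : ℕ => ((n - j : ℕ) : ℝ) ^ (1 - s) * u (n - j)) atTop
          (𝓝 (Real.Gamma s)⁻¹) := hulim.comp (tendsto_sub_atTop_nat j)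
      have h2 : Tendsto (fun n : ℕ => ((n : ℝ) / ((n - j : ℕ) : ℝ)) ^ (1 - s)) atTop (𝓝 1) := by
        have h3 : Tendsto (fun n : ℕ => ((n : ℝ) / ((n - j : ℕ) : ℝ))) atTop (𝓝 1) := by
          rw [← tendsto_add_atTop_iff_nat j]
          have h4 : Tendsto (fun n : ℕ => 1 + (j : ℝ) / n) atTop (𝓝 (1 + 0)) :=
            tendsto_const_nhds.add (tendsto_const_div_atTop_nhds_zero_nat (j : ℝ))
          rw [add_zero] at h4
          refine h4.congr' ?_
          filter_upwards [eventually_gt_atTop 0] with n hn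
          have hn0 : (n : ℝ) ≠ 0 := by positivity
          rw [Nat.add_sub_cancel]
          push_cast
          field_simp
        have := h3.rpow_const (p := 1 - s) (Or.inl one_ne_zero)
        rwa [Real.one_rpow] at this
      have h3 := (h1.mul h2).mul_const (e j)
      rw [mul_one] at h3
      refine h3.congr' ?_
      filter_upwards [eventually_ge_atTop (2 * j + 1)] with n hn
      rw [if_pos (by omega)]
      have hk0 : (0 : ℝ) < ((n - j : ℕ) : ℝ) := by
        have : 0 < n - j := by omega
        exact_mod_cast this
      rw [Real.div_rpow (by positivity) hk0.le]
      have : ((n - j : ℕ) : ℝ) ^ (1 - s) ≠ 0 := (Real.rpow_pos_of_pos hk0 _).ne'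
      field_simp
    · filter_upwards [eventually_ge_atTop 1] with n hn j
      split_ifs with h
      · rw [norm_mul, Real.norm_of_nonneg (by have := hu0 (n - j); positivity), Real.norm_eq_abs]
        refine mul_le_mul_of_nonneg_right ?_ (abs_nonneg _)
        calc (n : ℝ) ^ (1 - s) * u (n - j) ≤ 2 * ((n - j : ℕ) : ℝ) ^ (1 - s) * u (n - j) := by
              have := hu0 (n - j)
              gcongr
              exact hratio n j h hn
          _ ≤ 2 * C := by rw [mul_assoc]; gcongr; exact hC' _
      · rw [norm_zero]; positivity
  -- the terms with large index in the second factor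
  have hB : Tendsto (fun n : ℕ => ∑ j ∈ Finset.range (n + 1),
      if 2 * j ≤ n then 0 else (n : ℝ) ^ (1 - s) * u (n - j) * e j) atTop (𝓝 0) := by
    -- The partial sums of u are the coefficients with exponent s + 1, hence of order n^s. With
    -- n|e_j| small for j > n/2 this controls the second half of the convolution.
    have h1 := tendsto_rpow_mul_expCoeff_const (s := s + 1) (by linarith)
    obtain ⟨D, hD⟩ := h1.bddAbove_range
    have hD' : ∀ n : ℕ, (n : ℝ) ^ (-s) * ∑ i ∈ Finset.range (n + 1), u i ≤ D := by
      intro n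
      have h2 : (n : ℝ) ^ (1 - (s + 1)) * expCoeff (fun _ => s + 1) n ≤ D := hD ⟨n, rfl⟩
      have h3 := expCoeff_add_one (fun _ => s) n
      rw [hu, ← h3]
      convert! h2 using 3
      ring
    have hD0 : 0 ≤ D :=
      le_trans (mul_nonneg (by positivity) (Finset.sum_nonneg fun i _ => hu0 i)) (hD' 0)
    rw [Metric.tendsto_atTop]
    intro τ hτ
    have h2 := tendsto_mul_expCoeff_zero h0 hsum
    obtain ⟨n₀, hn₀⟩ := Metric.tendsto_atTop.1 h2 (τ / (2 * (D + 1))) (by positivity)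
    refine ⟨2 * n₀ + 1, fun n hn => ?_⟩
    have hn0 : (0 : ℝ) < n := by exact_mod_cast (by omega : 0 < n)
    rw [dist_zero_right]
    have hterm : ∀ j ∈ Finset.range (n + 1),
        ‖if 2 * j ≤ n then 0 else (n : ℝ) ^ (1 - s) * u (n - j) * e j‖ ≤
          (τ / (D + 1)) * ((n : ℝ) ^ (-s) * u (n - j)) := by
      intro j hj
      have := hu0 (n - j)
      split_ifs with h
      · rw [norm_zero]; positivity
      · have h3 := hn₀ j (by omega)
        rw [dist_zero_right, norm_mul, Real.norm_of_nonneg (by positivity), ← he] at h3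
        have h4 : (n : ℝ) * ‖e j‖ ≤ τ / (D + 1) := by
          have h5 : (n : ℝ) ≤ 2 * j := by exact_mod_cast (by omega : n ≤ 2 * j)
          calc (n : ℝ) * ‖e j‖ ≤ 2 * j * ‖e j‖ := by gcongr
            _ ≤ 2 * (τ / (2 * (D + 1))) := by linarith
            _ = _ := by field_simp
        rw [norm_mul, Real.norm_of_nonneg (by positivity), show 1 - s = -s + 1 by ring,
          Real.rpow_add_one hn0.ne']
        calc (n : ℝ) ^ (-s) * n * u (n - j) * ‖e j‖ = (n * ‖e j‖) * ((n : ℝ) ^ (-s) * u (n - j)) := by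
              ring
          _ ≤ _ := by gcongr
    refine (norm_sum_le_of_le _ hterm).trans_lt ?_
    rw [← Finset.mul_sum, ← Finset.mul_sum]
    have h5 : ∑ j ∈ Finset.range (n + 1), u (n - j) = ∑ i ∈ Finset.range (n + 1), u i := by
      have := Finset.sum_range_reflect u (n + 1)
      simpa using this
    rw [h5]
    calc τ / (D + 1) * ((n : ℝ) ^ (-s) * ∑ i ∈ Finset.range (n + 1), u i) ≤ τ / (D + 1) * D := by
          gcongr
          exact hD' n
      _ < τ := by
          rw [div_mul_eq_mul_div, div_lt_iff₀ (by positivity)]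
          nlinarith
  have hAB := hA.add hB
  rw [add_zero, tsum_mul_left, (hasSum_expCoeff hsum).tsum_eq] at hAB
  refine hAB.congr fun n => ?_
  have hfin : ∑' j : ℕ, (if 2 * j ≤ n then (n : ℝ) ^ (1 - s) * u (n - j) * e j else 0) =
      ∑ j ∈ Finset.range (n + 1), if 2 * j ≤ n then (n : ℝ) ^ (1 - s) * u (n - j) * e j else 0 := by
    refine tsum_eq_sum fun j hj => ?_
    rw [if_neg]
    simp at hj
    omega
  rw [hfin, ← Finset.sum_add_distrib]
  have hadd : expCoeff (fun j => s + ε j) n = ∑ j ∈ Finset.range (n + 1), u (n - j) * e j := by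
    have h1 := expCoeff_add (fun _ => s) ε n
    have h2 : (fun j => s + ε j) = (fun _ => s) + ε := rfl
    rw [h2, h1]
    rw [← Finset.Nat.sum_antidiagonal_swap]
    exact Finset.Nat.sum_antidiagonal_eq_sum_range_succ (f := fun i j => u j * e i) n
  rw [hadd, Finset.mul_sum]
  refine Finset.sum_congr rfl fun j _ => ?_
  split_ifs <;> ring

theorem exists_sum_expCoeff_le {s : ℝ} (hs : 0 < s) {ε : ℕ → ℝ} (h0 : Tendsto ε atTop (𝓝 0))
    (hsum : Summable fun j => |ε j| / j) :
    ∃ D : ℝ, ∀ n : ℕ, 1 ≤ n →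
      ∑ i ∈ Finset.range (n + 1), expCoeff (fun j => s + ε j) i ≤ D * (n : ℝ) ^ s := by
  obtain ⟨D, hD⟩ := (tendsto_rpow_mul_expCoeff (s := s + 1) (by linarith) h0 hsum).bddAbove_range
  refine ⟨D, fun n hn => ?_⟩
  have hn0 : (0 : ℝ) < n := by exact_mod_cast hn
  have h2 : (n : ℝ) ^ (1 - (s + 1)) * expCoeff (fun j => s + 1 + ε j) n ≤ D := hD ⟨n, rfl⟩
  have h3 := expCoeff_add_one (fun j => s + ε j) n
  have h4 : ((fun j => s + ε j) + fun _ => (1 : ℝ)) = fun j => s + 1 + ε j := by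
    ext j; simp only [Pi.add_apply]; ring
  rw [← h3, h4]
  rw [show 1 - (s + 1) = -s by ring, Real.rpow_neg hn0.le, inv_mul_le_iff₀ (by positivity)] at h2
  linarith

theorem tendsto_rpow_mul_expCoeff_comp {s : ℝ} (hs : 0 < s) {ε : ℕ → ℝ}
    (h0 : Tendsto ε atTop (𝓝 0)) (hsum : Summable fun j => |ε j| / j)
    {ι : Type*} {l : Filter ι} {N k : ι → ℕ} {y : ℝ} (hy : 0 < y) (hN : Tendsto N l atTop)
    (hk : Tendsto (fun i => (k i : ℝ) / N i) l (𝓝 y)) :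
    Tendsto (fun i => (N i : ℝ) ^ (1 - s) * expCoeff (fun j => s + ε j) (k i)) l
      (𝓝 ((Real.Gamma s)⁻¹ * Real.exp (∑' j, ε j / j) * y ^ (s - 1))) := by
  have hNr : Tendsto (fun i => (N i : ℝ)) l atTop := tendsto_natCast_atTop_atTop.comp hN
  have hkr : Tendsto (fun i => (k i : ℝ)) l atTop := by
    refine (hNr.atTop_mul_pos hy hk).congr' ?_
    filter_upwards [hNr.eventually_gt_atTop 0] with i hi
    field_simp
  have hk' : Tendsto k l atTop := tendsto_natCast_atTop_iff.1 hkr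
  have h1 := (tendsto_rpow_mul_expCoeff hs h0 hsum).comp hk'
  have h2 := hk.rpow_const (p := s - 1) (Or.inl hy.ne')
  refine (h1.mul h2).congr' ?_
  filter_upwards [hNr.eventually_gt_atTop 0, hkr.eventually_gt_atTop 0] with i hi hi'
  simp only [Function.comp]
  rw [Real.div_rpow hi'.le hi.le, show 1 - s = -(s - 1) by ring, Real.rpow_neg hi.le,
    Real.rpow_neg hi'.le]
  have := (Real.rpow_pos_of_pos hi' (s - 1)).ne'
  field_simp

/-! ### Sums of compound Poisson variables and the mixed coefficients -/

/-- The probability that a sum of `N` independent compound Poisson variables with generating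
function `exp (∑_j (K_j / j) (z^j - 1))` equals `n`. -/
noncomputable def poissonSumProb (K : ℕ → ℝ) (N n : ℕ) : ℝ :=
  Real.exp (-(N * ∑' j, K j / j)) * expCoeff (fun j => N * K j) n

section poissonSums

variable {K : ℕ → ℝ} {c₁ : ℝ}

theorem summable_div_of_summable (hK0 : ∀ j, 0 ≤ K j) (hK : Summable K) :
    Summable fun j : ℕ => K j / j := by
  refine Summable.of_nonneg_of_le (fun j => div_nonneg (hK0 j) (Nat.cast_nonneg j)) (fun j => ?_) hK
  rcases Nat.eq_zero_or_pos j with rfl | hj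
  · simpa using hK0 0
  · exact div_le_self (hK0 j) (by exact_mod_cast hj)

theorem poissonSumProb_nonneg (hK0 : ∀ j, 0 ≤ K j) (N n : ℕ) : 0 ≤ poissonSumProb K N n :=
  mul_nonneg (Real.exp_pos _).le (expCoeff_nonneg (fun j _ => mul_nonneg (Nat.cast_nonneg N) (hK0 j)) n)

theorem hasSum_poissonSumProb_mul_pow (hK0 : ∀ j, 0 ≤ K j) (hK : Summable K) (N : ℕ) {r : ℝ}
    (hr0 : 0 ≤ r) (hr1 : r ≤ 1) :
    HasSum (fun n => poissonSumProb K N n * r ^ n)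
      (Real.exp (-(N * ∑' j : ℕ, K j / j * (1 - r ^ j)))) := by
  have hs := summable_div_of_summable hK0 hK
  have hsr : Summable fun j : ℕ => K j / j * r ^ j := by
    refine Summable.of_nonneg_of_le (fun j => mul_nonneg (div_nonneg (hK0 j) (Nat.cast_nonneg j))
      (pow_nonneg hr0 j)) (fun j => ?_) hs
    exact mul_le_of_le_one_right (div_nonneg (hK0 j) (Nat.cast_nonneg j)) (pow_le_one₀ hr0 hr1)
  have hw : Summable fun j : ℕ => |(N : ℝ) * K j * r ^ j| / j := by
    refine (hsr.mul_left (N : ℝ)).congr fun j => ?_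
    rw [abs_of_nonneg (mul_nonneg (mul_nonneg (Nat.cast_nonneg N) (hK0 j)) (pow_nonneg hr0 j))]
    ring
  have h1 := (hasSum_expCoeff hw).mul_left (Real.exp (-(N * ∑' j, K j / j)))
  have e : Real.exp (-(N * ∑' j, K j / j)) * Real.exp (∑' j : ℕ, (N : ℝ) * K j * r ^ j / j) =
      Real.exp (-(N * ∑' j : ℕ, K j / j * (1 - r ^ j))) := by
    rw [← Real.exp_add]
    congr 1
    have e1 : ∑' j : ℕ, (N : ℝ) * K j * r ^ j / j = N * ∑' j : ℕ, K j / j * r ^ j := by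
      rw [← tsum_mul_left]
      exact tsum_congr fun j => by ring
    have e2 : ∑' j : ℕ, K j / j * (1 - r ^ j) = ∑' j : ℕ, K j / j - ∑' j : ℕ, K j / j * r ^ j := by
      rw [← hs.tsum_sub hsr]
      exact tsum_congr fun j => by ring
    rw [e1, e2]
    ring
  rw [e] at h1
  refine h1.congr_fun fun n => ?_
  rw [expCoeff_mul_pow (fun j => (N : ℝ) * K j) r n]
  unfold poissonSumProb
  ring

theorem hasSum_poissonSumProb (hK0 : ∀ j, 0 ≤ K j) (hK : Summable K) (N : ℕ) :
    HasSum (poissonSumProb K N) 1 := by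
  have := hasSum_poissonSumProb_mul_pow hK0 hK N zero_le_one le_rfl
  simpa using this

/-- The Laplace transform of the sum divided by N tends to that of the constant c₁. Each term
converges by differentiation at 0, and 1 - exp(-x) ≤ x supplies the dominating series t ∑ K_j. -/
theorem tendsto_laplace (hK0 : ∀ j, 0 ≤ K j) (hK : HasSum K c₁) (hK00 : K 0 = 0) {t : ℝ}
    (ht : 0 ≤ t) :
    Tendsto (fun N : ℕ => Real.exp (-(N * ∑' j : ℕ, K j / j * (1 - Real.exp (-(t / N)) ^ j))))
      atTop (𝓝 (Real.exp (-(t * c₁)))) := by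
  refine (Real.continuous_exp.tendsto _).comp (Tendsto.neg ?_)
  rw [← hK.tsum_eq, ← tsum_mul_left]
  simp_rw [← tsum_mul_left]
  have hpow : ∀ N j : ℕ, Real.exp (-(t / N)) ^ j = Real.exp (-(t * j / N)) := by
    intro N j
    rw [← Real.exp_nat_mul]; congr 1; ring
  refine tendsto_tsum_of_dominated_convergence (bound := fun j => t * K j) (hK.summable.mul_left t)
    (fun j => ?_) ?_
  · rcases Nat.eq_zero_or_pos j with rfl | hj
    · simp [hK00]
    have hj0 : (0 : ℝ) < j := by exact_mod_cast hj
    have h1 : HasDerivAt (fun x : ℝ => 1 - Real.exp (-(t * j * x))) (t * j) 0 := by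
      have h := (((hasDerivAt_id (0 : ℝ)).const_mul (t * j)).neg.exp).const_sub 1
      simpa using h
    have h2 := h1.tendsto_slope_zero_right
    have h3 : Tendsto (fun N : ℕ => ((N : ℝ))⁻¹) atTop (𝓝[>] 0) :=
      tendsto_inv_atTop_nhdsGT_zero.comp tendsto_natCast_atTop_atTop
    have h4 := (h2.comp h3).const_mul (K j / j)
    have e : K j / j * (t * j) = t * K j := by field_simp
    rw [e] at h4
    refine h4.congr fun N => ?_
    rw [hpow]
    simp only [Function.comp, smul_eq_mul]
    simp [div_eq_mul_inv]
    ring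
  · filter_upwards [eventually_gt_atTop 0] with N hN j
    have hN0 : (0 : ℝ) < N := by exact_mod_cast hN
    rw [hpow]
    have h1 : 1 - Real.exp (-(t * j / N)) ≤ t * j / N := by
      have := Real.add_one_le_exp (-(t * j / N)); linarith
    have h2 : 0 ≤ 1 - Real.exp (-(t * j / N)) := by
      have : Real.exp (-(t * j / N)) ≤ 1 := Real.exp_le_one_iff.2 (by
        have : 0 ≤ t * j / N := by positivity
        linarith)
      linarith
    have hKj := div_nonneg (hK0 j) (Nat.cast_nonneg (α := ℝ) j)
    rw [Real.norm_of_nonneg (by positivity)]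
    rcases Nat.eq_zero_or_pos j with rfl | hj
    · simp [hK00]
    have hj0 : (0 : ℝ) < j := by exact_mod_cast hj
    calc (N : ℝ) * (K j / j * (1 - Real.exp (-(t * j / N)))) ≤ N * (K j / j * (t * j / N)) := by
          gcongr
      _ = t * K j := by field_simp

/-- The sum of `N` variables is concentrated near `c₁ N`. -/
theorem tendsto_far_mass (hK0 : ∀ j, 0 ≤ K j) (hK : HasSum K c₁) (hK00 : K 0 = 0) {ε : ℝ}
    (hε : 0 < ε) :
    Tendsto (fun N : ℕ => ∑' n : ℕ, if |(n : ℝ) / N - c₁| ≤ ε then 0 else poissonSumProb K N n)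
      atTop (𝓝 0) := by
  -- Chebyshev's inequality is applied to the bounded variable exp(-S/N) instead of S/N, whose
  -- variance would require ∑ j K_j to be finite. The Laplace transform at 1 and 2 gives the mean
  -- square distance of exp(-S/N) from e.
  set e := Real.exp (-c₁) with he
  set L : ℕ → ℝ → ℝ := fun N t =>
    Real.exp (-(N * ∑' j : ℕ, K j / j * (1 - Real.exp (-(t / N)) ^ j))) with hL
  have hsum : ∀ (N : ℕ) (t : ℝ), 0 ≤ t → HasSum (fun n : ℕ =>
      poissonSumProb K N n * Real.exp (-(t / N)) ^ n) (L N t) := fun N t ht =>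
    hasSum_poissonSumProb_mul_pow hK0 hK.summable N (Real.exp_pos _).le
      (Real.exp_le_one_iff.2 (by have : 0 ≤ t / N := by positivity
                                 linarith))
  have hvar : ∀ N : ℕ, HasSum (fun n : ℕ =>
      poissonSumProb K N n * (Real.exp (-((n : ℝ) / N)) - e) ^ 2)
      (L N 2 - 2 * e * L N 1 + e ^ 2) := by
    intro N
    have h := ((hsum N 2 (by norm_num)).sub ((hsum N 1 (by norm_num)).mul_left (2 * e))).add
      ((hasSum_poissonSumProb hK0 hK.summable N).mul_left (e ^ 2))
    rw [mul_one] at h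
    refine h.congr_fun fun n => ?_
    have e2 : Real.exp (-(2 / (N : ℝ))) ^ n = Real.exp (-((n : ℝ) / N)) ^ 2 := by
      rw [← Real.exp_nat_mul, ← Real.exp_nat_mul]; congr 1; push_cast; ring
    have e1 : Real.exp (-(1 / (N : ℝ))) ^ n = Real.exp (-((n : ℝ) / N)) := by
      rw [← Real.exp_nat_mul]; congr 1; ring
    rw [e1, e2]
    ring
  have hlim : Tendsto (fun N => L N 2 - 2 * e * L N 1 + e ^ 2) atTop (𝓝 0) := by
    have h1 := tendsto_laplace hK0 hK hK00 (t := 1) (by norm_num)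
    have h2 := tendsto_laplace hK0 hK hK00 (t := 2) (by norm_num)
    have h3 := (h2.sub (h1.const_mul (2 * e))).add_const (e ^ 2)
    convert! h3 using 2
    have : Real.exp (-(2 * c₁)) = e ^ 2 := by
      rw [he, ← Real.exp_nat_mul]; congr 1; push_cast; ring
    rw [this, one_mul, ← he]
    ring
  set δ := min (e - Real.exp (-(c₁ + ε))) (Real.exp (-(c₁ - ε)) - e) with hδ
  have hδ0 : 0 < δ := by
    refine lt_min ?_ ?_ <;> rw [sub_pos, he] <;> exact Real.exp_lt_exp.2 (by linarith)
  have hlow : ∀ N n : ℕ, ¬ |(n : ℝ) / N - c₁| ≤ ε →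
      δ ^ 2 ≤ (Real.exp (-((n : ℝ) / N)) - e) ^ 2 := by
    intro N n h
    rw [not_le, lt_abs] at h
    rcases h with h | h
    · have h1 : Real.exp (-((n : ℝ) / N)) ≤ Real.exp (-(c₁ + ε)) := Real.exp_le_exp.2 (by linarith)
      have h2 : δ ≤ e - Real.exp (-(c₁ + ε)) := min_le_left _ _
      nlinarith
    · have h1 : Real.exp (-(c₁ - ε)) ≤ Real.exp (-((n : ℝ) / N)) := Real.exp_le_exp.2 (by linarith)
      have h2 : δ ≤ Real.exp (-(c₁ - ε)) - e := min_le_right _ _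
      nlinarith
  have hlim2 := hlim.div_const (δ ^ 2)
  rw [zero_div] at hlim2
  refine squeeze_zero (fun N => tsum_nonneg fun n => ?_) (fun N => ?_) hlim2
  · split_ifs
    · exact le_rfl
    · exact poissonSumProb_nonneg hK0 N n
  · have h1 := (hvar N).div_const (δ ^ 2)
    rw [← h1.tsum_eq]
    have hle : ∀ n : ℕ, (if |(n : ℝ) / N - c₁| ≤ ε then 0 else poissonSumProb K N n) ≤
        poissonSumProb K N n * (Real.exp (-((n : ℝ) / N)) - e) ^ 2 / δ ^ 2 := by
      intro n
      have hq := poissonSumProb_nonneg hK0 N n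
      split_ifs with h
      · positivity
      · rw [le_div_iff₀ (by positivity)]
        exact mul_le_mul_of_nonneg_left (hlow N n h) hq
    refine Summable.tsum_le_tsum hle (Summable.of_nonneg_of_le (fun n => ?_) hle h1.summable)
      h1.summable
    split_ifs
    · exact le_rfl
    · exact poissonSumProb_nonneg hK0 N n

/-- The recursion n q_n = N ∑ K_l q_{n-l}. For n ≥ (c₁ + ε)N, a bound B valid at the points reached
by jumps of length at most w improves to (c₁ B + T)/(c₁ + ε), where T pays for the longer jumps.
This map contracts with ratio c₁/(c₁ + ε) towards T/ε, and i is the number of jumps of length w for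
which there is room. -/
theorem poissonSumProb_le_pow_add (hK0 : ∀ j, 0 ≤ K j) (hK : HasSum K c₁) {ε T : ℝ} (hc₁ : 0 ≤ c₁)
    (hε : 0 < ε) (hT : 0 ≤ T) {N w : ℕ} (hN : 0 < N) (hw : ∀ l, w < l → K l ≤ T) (i n : ℕ)
    (hn : (c₁ + ε) * N + i * w ≤ n) :
    poissonSumProb K N n ≤ (c₁ / (c₁ + ε)) ^ i + T / ε := by
  have hq0 := poissonSumProb_nonneg hK0 N
  have hqs := hasSum_poissonSumProb hK0 hK.summable N
  have hN0 : (0 : ℝ) < N := by exact_mod_cast hN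
  induction i generalizing n with
  | zero =>
    rw [pow_zero]
    have h1 : poissonSumProb K N n ≤ 1 := le_hasSum hqs n fun j _ => hq0 j
    have : 0 ≤ T / ε := by positivity
    linarith
  | succ i ih =>
    set B := (c₁ / (c₁ + ε)) ^ i + T / ε with hB
    have hB0 : 0 ≤ B := by positivity
    have hrec : (n : ℝ) * poissonSumProb K N n =
        ∑ l ∈ Finset.Icc 1 n, N * (K l * poissonSumProb K N (n - l)) := by
      unfold poissonSumProb
      rw [mul_left_comm, mul_expCoeff, Finset.mul_sum]
      exact Finset.sum_congr rfl fun l _ => by ring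
    have hterm : ∀ l ∈ Finset.Icc 1 n, (N : ℝ) * (K l * poissonSumProb K N (n - l)) ≤
        N * (K l * B + T * poissonSumProb K N (n - l)) := by
      intro l hl
      rw [Finset.mem_Icc] at hl
      refine mul_le_mul_of_nonneg_left ?_ hN0.le
      have hTq := mul_nonneg hT (hq0 (n - l))
      by_cases hlw : l ≤ w
      · have h1 : poissonSumProb K N (n - l) ≤ B := by
          refine ih (n - l) ?_
          rw [Nat.cast_sub hl.2]
          have h2 : (l : ℝ) ≤ w := by exact_mod_cast hlw
          push_cast at hn
          linarith
        have := mul_le_mul_of_nonneg_left h1 (hK0 l)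
        linarith
      · have := mul_le_mul_of_nonneg_right (hw l (not_le.1 hlw)) (hq0 (n - l))
        have := mul_nonneg (hK0 l) hB0
        linarith
    have h1 := Finset.sum_le_sum hterm
    rw [← hrec, ← Finset.mul_sum, Finset.sum_add_distrib, ← Finset.sum_mul, ← Finset.mul_sum] at h1
    have h2 : ∑ l ∈ Finset.Icc 1 n, K l ≤ c₁ := sum_le_hasSum _ (fun j _ => hK0 j) hK
    have h3 : ∑ l ∈ Finset.Icc 1 n, poissonSumProb K N (n - l) ≤ 1 := by
      have hinj : Set.InjOn (fun l => n - l) (Finset.Icc 1 n : Finset ℕ) := by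
        intro a ha b hb hab
        simp at ha hb hab
        omega
      rw [← Finset.sum_image (f := fun m => poissonSumProb K N m) hinj]
      exact sum_le_hasSum _ (fun j _ => hq0 j) hqs
    have h4 : (n : ℝ) * poissonSumProb K N n ≤ N * (c₁ * B + T) := by
      refine h1.trans ?_
      have := mul_le_mul_of_nonneg_right h2 hB0
      have := mul_le_mul_of_nonneg_left h3 hT
      refine mul_le_mul_of_nonneg_left ?_ hN0.le
      linarith
    have h5 : (c₁ + ε) * N ≤ n := by
      have : (0 : ℝ) ≤ ((i + 1 : ℕ) : ℝ) * w := by positivity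
      linarith
    have h6 : (c₁ + ε) * poissonSumProb K N n ≤ c₁ * B + T := by
      refine le_of_mul_le_mul_left ?_ hN0
      have := mul_le_mul_of_nonneg_right h5 (hq0 n)
      linarith
    have hcε : 0 < c₁ + ε := by linarith
    have h7 : poissonSumProb K N n ≤ (c₁ * B + T) / (c₁ + ε) := by
      rw [le_div_iff₀ hcε]; linarith
    refine h7.trans (le_of_eq ?_)
    rw [hB, pow_succ]
    field_simp
    ring

/-- The cutoff w is of order N^γ with 1/s < γ < 1. Long jumps then cost N w^(-s), which tends to 0,
while about N^(1-γ) contractions make the geometric term smaller than any power of N. -/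
theorem eventually_mul_poissonSumProb_le (hK0 : ∀ j, 0 ≤ K j) (hK : HasSum K c₁) (hc₁ : 0 ≤ c₁)
    {s C : ℝ} (hs : 1 < s) (hC0 : 0 ≤ C) (hC : ∀ j, 1 ≤ j → K j ≤ C * (j : ℝ) ^ (-s)) {ε τ : ℝ}
    (hε : 0 < ε) (hτ : 0 < τ) :
    ∀ᶠ N : ℕ in atTop, ∀ n : ℕ, (c₁ + ε) * N ≤ n → N * poissonSumProb K N n ≤ τ := by
  set γ := (1 + s⁻¹) / 2 with hγ
  have hs0 : 0 < s := by linarith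
  have hsinv : s⁻¹ < 1 := inv_lt_one_of_one_lt₀ hs
  have hsinv0 : 0 < s⁻¹ := by positivity
  have hγ0 : 0 < γ := by rw [hγ]; linarith
  have hγ1 : γ < 1 := by rw [hγ]; linarith
  have hγs : 1 < γ * s := by
    have : s * s⁻¹ = 1 := mul_inv_cancel₀ hs0.ne'
    rw [hγ]; nlinarith
  set w : ℕ → ℕ := fun N => ⌈(N : ℝ) ^ γ⌉₊ with hw
  -- Half of ε goes into the contraction ratio; the other half leaves room for i jumps of length w.
  set i : ℕ → ℕ := fun N => ⌊ε / 2 * N / w N⌋₊ with hi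
  set ρ := c₁ / (c₁ + ε / 2) with hρ
  have hρ0 : 0 ≤ ρ := by positivity
  have hρ1 : ρ < 1 := by rw [hρ, div_lt_one (by positivity)]; linarith
  -- With (1 - γ)p ≥ 1 the number N is at most a constant times (i + 1)^p, so N ρ^i is bounded by a
  -- polynomial in i times a geometric term.
  obtain ⟨p, hp⟩ := exists_nat_ge (1 - γ)⁻¹
  have hp' : 1 ≤ (1 - γ) * p := by
    rw [inv_le_iff_one_le_mul₀ (by linarith)] at hp; linarith
  have hwpos : ∀ N : ℕ, 0 < N → (0 : ℝ) < (N : ℝ) ^ γ := fun N hN =>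
    Real.rpow_pos_of_pos (by exact_mod_cast hN) _
  have hwlow : ∀ N : ℕ, (N : ℝ) ^ γ ≤ w N := fun N => Nat.le_ceil _
  have hwup : ∀ N : ℕ, 0 < N → (w N : ℝ) ≤ 2 * (N : ℝ) ^ γ := fun N hN => by
    have h1 : (1 : ℝ) ≤ (N : ℝ) ^ γ := Real.one_le_rpow (by exact_mod_cast hN) hγ0.le
    have h2 := (Nat.ceil_lt_add_one (hwpos N hN).le).le
    simp only [hw]
    linarith
  have hilow : ∀ N : ℕ, 0 < N → ε / 4 * (N : ℝ) ^ (1 - γ) ≤ (i N : ℝ) + 1 := fun N hN => by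
    have hN0 : (0 : ℝ) < N := by exact_mod_cast hN
    have hw0 : (0 : ℝ) < w N := (hwpos N hN).trans_le (hwlow N)
    refine le_trans ?_ (Nat.lt_floor_add_one (ε / 2 * N / w N)).le
    rw [Real.rpow_sub hN0, Real.rpow_one, le_div_iff₀ hw0]
    calc ε / 4 * (N / (N : ℝ) ^ γ) * w N ≤ ε / 4 * (N / (N : ℝ) ^ γ) * (2 * (N : ℝ) ^ γ) := by
          have := hwup N hN
          gcongr
      _ = ε / 2 * N := by
          have := (hwpos N hN).ne'
          field_simp
          ring
  have hitend : Tendsto i atTop atTop := by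
    have h1 : Tendsto (fun N : ℕ => ε / 4 * (N : ℝ) ^ (1 - γ)) atTop atTop :=
      ((tendsto_rpow_atTop (by linarith)).comp tendsto_natCast_atTop_atTop).const_mul_atTop
        (by positivity)
    have h2 : Tendsto (fun N : ℕ => (i N : ℝ) + 1) atTop atTop :=
      tendsto_atTop_mono' _ ((eventually_gt_atTop 0).mono hilow) h1
    exact tendsto_natCast_atTop_iff.1 (by simpa using tendsto_atTop_add_const_right _ (-1) h2)
  have hgeom : Tendsto (fun N : ℕ => (4 / ε) ^ p * (((i N : ℝ) + 1) ^ p * ρ ^ (i N))) atTop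
      (𝓝 ((4 / ε) ^ p * 0)) := by
    refine Tendsto.const_mul _ ?_
    have h1 : Tendsto (fun k : ℕ => ((k : ℝ) + 1) ^ p * ρ ^ k) atTop (𝓝 0) := by
      have h2 := tendsto_pow_const_mul_const_pow_of_abs_lt_one p (r := ρ)
        (by rwa [abs_of_nonneg hρ0])
      have h3 : Tendsto (fun k : ℕ => 2 ^ p * ((k : ℝ) ^ p * ρ ^ k)) atTop (𝓝 0) := by
        simpa using h2.const_mul ((2 : ℝ) ^ p)
      refine squeeze_zero' (Eventually.of_forall fun k => by positivity) ?_ h3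
      filter_upwards [eventually_ge_atTop 1] with k hk
      have hk1 : (1 : ℝ) ≤ k := by exact_mod_cast hk
      rw [← mul_assoc, ← mul_pow]
      gcongr
      linarith
    exact h1.comp hitend
  rw [mul_zero] at hgeom
  have hpoly : Tendsto (fun N : ℕ => C / (ε / 2) * (N : ℝ) ^ (-(γ * s - 1))) atTop
      (𝓝 (C / (ε / 2) * 0)) :=
    ((tendsto_rpow_neg_atTop (by linarith)).comp tendsto_natCast_atTop_atTop).const_mul _
  have hboth := hgeom.add hpoly
  rw [mul_zero, add_zero] at hboth
  filter_upwards [hboth.eventually_le_const hτ, eventually_gt_atTop 0] with N hNτ hN n hn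
  refine le_trans ?_ hNτ
  have hN0 : (0 : ℝ) < N := by exact_mod_cast hN
  have hT : 0 ≤ C * (w N : ℝ) ^ (-s) := by positivity
  have hw0 : (0 : ℝ) < w N := (hwpos N hN).trans_le (hwlow N)
  have hmain := poissonSumProb_le_pow_add hK0 hK (ε := ε / 2) (T := C * (w N : ℝ) ^ (-s)) hc₁
    (by positivity) hT hN (w := w N) (fun l hl => by
      refine (hC l (by omega)).trans ?_
      refine mul_le_mul_of_nonneg_left ?_ hC0
      exact Real.rpow_le_rpow_of_nonpos hw0 (by exact_mod_cast hl.le) (by linarith)) (i N) n (by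
      have h1 : (i N : ℝ) * w N ≤ ε / 2 * N := by
        rw [← le_div_iff₀ hw0]
        exact Nat.floor_le (by positivity)
      linarith)
  have h1 : (N : ℝ) ≤ (4 / ε) ^ p * ((i N : ℝ) + 1) ^ p := by
    have h2 : (N : ℝ) ^ (1 - γ) ≤ 4 / ε * ((i N : ℝ) + 1) := by
      have := hilow N hN
      rw [div_mul_eq_mul_div, le_div_iff₀ hε]
      linarith
    calc (N : ℝ) = (N : ℝ) ^ (1 : ℝ) := (Real.rpow_one _).symm
      _ ≤ (N : ℝ) ^ ((1 - γ) * p) :=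
          Real.rpow_le_rpow_of_exponent_le (by exact_mod_cast hN) hp'
      _ = ((N : ℝ) ^ (1 - γ)) ^ p := by rw [Real.rpow_mul hN0.le, Real.rpow_natCast]
      _ ≤ (4 / ε * ((i N : ℝ) + 1)) ^ p := by gcongr
      _ = _ := mul_pow _ _ _
  have h2 : (N : ℝ) * (C * (w N : ℝ) ^ (-s) / (ε / 2)) ≤
      C / (ε / 2) * (N : ℝ) ^ (-(γ * s - 1)) := by
    have h3 : (w N : ℝ) ^ (-s) ≤ ((N : ℝ) ^ γ) ^ (-s) :=
      Real.rpow_le_rpow_of_nonpos (hwpos N hN) (hwlow N) (by linarith)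
    have h4 : ((N : ℝ) ^ γ) ^ (-s) * N = (N : ℝ) ^ (-(γ * s - 1)) := by
      rw [← Real.rpow_mul hN0.le, ← Real.rpow_add_one hN0.ne']
      congr 1; ring
    rw [← h4]
    calc (N : ℝ) * (C * (w N : ℝ) ^ (-s) / (ε / 2)) = C / (ε / 2) * ((w N : ℝ) ^ (-s) * N) := by ring
      _ ≤ _ := by gcongr
  calc (N : ℝ) * poissonSumProb K N n ≤ N * (ρ ^ i N + C * (w N : ℝ) ^ (-s) / (ε / 2)) := by
        gcongr
    _ = N * ρ ^ i N + N * (C * (w N : ℝ) ^ (-s) / (ε / 2)) := by ring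
    _ ≤ ((4 / ε) ^ p * ((i N : ℝ) + 1) ^ p) * ρ ^ i N + C / (ε / 2) * (N : ℝ) ^ (-(γ * s - 1)) := by
        gcongr
    _ = _ := by ring

/-- The coefficient of `z^n` in `exp (∑_j (T_j / j) z^j) exp (N ∑_j (K_j / j) (z^j - 1))`. -/
noncomputable def mixedCoeff (T K : ℕ → ℝ) (N n : ℕ) : ℝ :=
  Real.exp (-(N * ∑' j, K j / j)) * expCoeff (fun j => T j + N * K j) n

theorem mixedCoeff_eq_sum (T K : ℕ → ℝ) (N n : ℕ) :
    mixedCoeff T K N n =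
      ∑ j ∈ Finset.range (n + 1), poissonSumProb K N j * expCoeff T (n - j) := by
  unfold mixedCoeff poissonSumProb
  have h1 := expCoeff_add (fun j => (N : ℝ) * K j) T n
  rw [Finset.Nat.sum_antidiagonal_eq_sum_range_succ
    (f := fun i j => expCoeff (fun j => (N : ℝ) * K j) i * expCoeff T j)] at h1
  have h2 : (fun j => T j + N * K j) = (fun j => (N : ℝ) * K j) + T := by
    ext j; simp only [Pi.add_apply]; ring
  rw [h2, h1, Finset.mul_sum]
  exact Finset.sum_congr rfl fun j _ => by ring

/-- A uniform form of the limit, obtained by letting pairs (N, k) run along the filter on which N →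
∞ and k/N → y. -/
theorem exists_eventually_near {s : ℝ} (hs : 0 < s) {ε : ℕ → ℝ}
    (h0 : Tendsto ε atTop (𝓝 0)) (hsum : Summable fun j => |ε j| / j) {y τ : ℝ} (hy : 0 < y)
    (hτ : 0 < τ) :
    ∃ ε₀ > 0, ∀ᶠ N : ℕ in atTop, ∀ k : ℕ, |(k : ℝ) / N - y| ≤ ε₀ →
      |(N : ℝ) ^ (1 - s) * expCoeff (fun j => s + ε j) k -
        (Real.Gamma s)⁻¹ * Real.exp (∑' j, ε j / j) * y ^ (s - 1)| ≤ τ := by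
  set l : Filter (ℕ × ℕ) := comap (fun p : ℕ × ℕ => (p.2 : ℝ) / p.1) (𝓝 y) ⊓ comap Prod.fst atTop
    with hl
  have hN : Tendsto (fun p : ℕ × ℕ => p.1) l atTop := tendsto_comap.mono_left inf_le_right
  have hk : Tendsto (fun p : ℕ × ℕ => (p.2 : ℝ) / p.1) l (𝓝 y) :=
    tendsto_comap.mono_left inf_le_left
  have h := tendsto_rpow_mul_expCoeff_comp hs h0 hsum hy hN hk
  have h2 := (Metric.tendsto_nhds.1 h) τ hτ
  have hb := ((Metric.nhds_basis_closedBall (x := y)).comap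
    (fun p : ℕ × ℕ => (p.2 : ℝ) / p.1)).inf ((atTop_basis (α := ℕ)).comap (Prod.fst (α := ℕ) (β := ℕ)))
  obtain ⟨⟨ε₀, N₀⟩, ⟨hε₀, -⟩, hsub⟩ := hb.eventually_iff.1 h2
  refine ⟨ε₀, hε₀, ?_⟩
  filter_upwards [eventually_ge_atTop N₀] with N hN k hk
  have := hsub (x := (N, k)) ⟨by simpa [Real.dist_eq] using hk, by simpa using hN⟩
  rw [Real.dist_eq] at this
  exact this.le

theorem exists_forall_rpow_mul_expCoeff_le {s : ℝ} (hs : 0 < s) {ε : ℕ → ℝ}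
    (h0 : Tendsto ε atTop (𝓝 0)) (hsum : Summable fun j => |ε j| / j) {y z : ℝ} (hy : 0 < y) :
    ∃ M : ℝ, ∀ N k : ℕ, 0 < N → y ≤ (k : ℝ) / N → (k : ℝ) / N ≤ z →
      |(N : ℝ) ^ (1 - s) * expCoeff (fun j => s + ε j) k| ≤ M := by
  obtain ⟨D, hD⟩ := (tendsto_rpow_mul_expCoeff hs h0 hsum).abs.bddAbove_range
  refine ⟨D * (y ^ (s - 1) + z ^ (s - 1)), fun N k hN h1 h2 => ?_⟩
  have hD' : |(k : ℝ) ^ (1 - s) * expCoeff (fun j => s + ε j) k| ≤ D := hD ⟨k, rfl⟩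
  have hN0 : (0 : ℝ) < N := by exact_mod_cast hN
  have hx : (0 : ℝ) < (k : ℝ) / N := hy.trans_le h1
  have hk0 : (0 : ℝ) < k := by
    have := mul_pos hx hN0
    rwa [div_mul_cancel₀ _ hN0.ne'] at this
  have e : (N : ℝ) ^ (1 - s) * expCoeff (fun j => s + ε j) k =
      ((k : ℝ) ^ (1 - s) * expCoeff (fun j => s + ε j) k) * ((k : ℝ) / N) ^ (s - 1) := by
    rw [Real.div_rpow hk0.le hN0.le, show 1 - s = -(s - 1) by ring, Real.rpow_neg hN0.le,
      Real.rpow_neg hk0.le]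
    have := (Real.rpow_pos_of_pos hk0 (s - 1)).ne'
    field_simp
  have hle : ((k : ℝ) / N) ^ (s - 1) ≤ y ^ (s - 1) + z ^ (s - 1) := by
    have hz : 0 < z := hx.trans_le h2
    have hy' := Real.rpow_pos_of_pos hy (s - 1)
    have hz' := Real.rpow_pos_of_pos hz (s - 1)
    rcases le_total 1 s with h | h
    · have := Real.rpow_le_rpow hx.le h2 (by linarith : 0 ≤ s - 1)
      linarith
    · have := Real.rpow_le_rpow_of_nonpos hy h1 (by linarith : s - 1 ≤ 0)
      linarith
  rw [e, abs_mul, abs_of_pos (Real.rpow_pos_of_pos hx _)]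
  have := (abs_nonneg _).trans hD'
  gcongr

/-- The mixed coefficient is the mean of b_{n-S}, where S is the compound Poisson sum and b the
coefficients of the other factor. Since S concentrates at c₁N, the typical index of b is (v - c₁)N.
The remaining values of S are negligible, but for two different reasons, below and above c₁N. -/
theorem tendsto_rpow_mul_mixedCoeff (hK0 : ∀ j, 0 ≤ K j) (hK : HasSum K c₁) (hK00 : K 0 = 0)
    (hc₁ : 0 ≤ c₁) {σ C : ℝ} (hσ : 1 < σ) (hC0 : 0 ≤ C)
    (hC : ∀ j, 1 ≤ j → K j ≤ C * (j : ℝ) ^ (-σ)) {s : ℝ} (hs : 0 < s) {ε : ℕ → ℝ}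
    (h0 : Tendsto ε atTop (𝓝 0)) (hsum : Summable fun j => |ε j| / j)
    (hT0 : ∀ j, 1 ≤ j → 0 ≤ s + ε j) {n : ℕ → ℕ} {v : ℝ} (hv : c₁ < v)
    (hn : Tendsto (fun N : ℕ => (n N : ℝ) / N) atTop (𝓝 v)) :
    Tendsto (fun N : ℕ => (N : ℝ) ^ (1 - s) * mixedCoeff (fun j => s + ε j) K N (n N)) atTop
      (𝓝 ((Real.Gamma s)⁻¹ * Real.exp (∑' j, ε j / j) * (v - c₁) ^ (s - 1))) := by
  set L := (Real.Gamma s)⁻¹ * Real.exp (∑' j, ε j / j) * (v - c₁) ^ (s - 1) with hL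
  set b := expCoeff (fun j => s + ε j) with hb
  set q := poissonSumProb K with hq
  have hb0 : ∀ k, 0 ≤ b k := fun k => expCoeff_nonneg hT0 k
  have hq0 : ∀ N j, 0 ≤ q N j := poissonSumProb_nonneg hK0
  have hqs : ∀ N, HasSum (q N) 1 := hasSum_poissonSumProb hK0 hK.summable
  have hy : 0 < v - c₁ := by linarith
  rw [Metric.tendsto_atTop']
  intro τ hτ
  obtain ⟨ε₀, hε₀, hnear⟩ := exists_eventually_near hs h0 hsum hy (τ := τ / 4) (by positivity)
  -- Both n/N and j/N may be off by δ, which together stay within ε₀. The second entry keeps j ≤ n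
  -- throughout the window around c₁N.
  set δ := min (ε₀ / 2) ((v - c₁) / 4) with hδ
  have hδ0 : 0 < δ := lt_min (by positivity) (by positivity)
  have hδ1 : δ ≤ ε₀ / 2 := min_le_left _ _
  have hδ2 : δ ≤ (v - c₁) / 4 := min_le_right _ _
  obtain ⟨M, hM⟩ := exists_forall_rpow_mul_expCoeff_le hs h0 hsum (y := (v - c₁) / 2) (z := v + δ)
    (by positivity)
  obtain ⟨D, hD⟩ := exists_sum_expCoeff_le hs h0 hsum
  have hfar := (tendsto_far_mass hK0 hK hK00 hδ0).const_mul (|M| + |L|)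
  rw [mul_zero] at hfar
  set B := |D| * (v + δ) ^ s with hB
  have hv0 : 0 < v + δ := by linarith
  have hB0 : 0 ≤ B := by positivity
  have hloc := eventually_mul_poissonSumProb_le hK0 hK hc₁ hσ hC0 hC hδ0
    (τ := τ / (4 * (B + 1))) (by positivity)
  obtain ⟨N₀, hN₀⟩ := eventually_atTop.1 (((hnear.and (hfar.eventually_le_const
    (by positivity : 0 < τ / 4))).and hloc).and ((Metric.tendsto_nhds.1 hn δ hδ0).and
    (eventually_gt_atTop 0)))
  refine ⟨N₀, fun N hN => ?_⟩
  obtain ⟨⟨⟨h1, h2⟩, h3⟩, h4, h5⟩ := hN₀ N hN.le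
  clear hnear hfar hloc hN₀
  have hN0 : (0 : ℝ) < N := by exact_mod_cast h5
  rw [Real.dist_eq, abs_lt] at h4
  set m := n N with hm
  have hm0 : 1 ≤ m := by
    by_contra h
    have : m = 0 := by omega
    rw [this] at h4
    simp at h4
    linarith
  set g : ℕ → ℝ := fun j => if j ≤ m then (N : ℝ) ^ (1 - s) * b (m - j) else 0 with hg
  have hNp : 0 < (N : ℝ) ^ (1 - s) := Real.rpow_pos_of_pos hN0 _
  have hg0 : ∀ j, 0 ≤ g j := by
    intro j
    simp only [hg]
    split_ifs
    · have := hb0 (m - j); positivity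
    · exact le_rfl
  have hgsum : HasSum (fun j => q N j * g j) ((N : ℝ) ^ (1 - s) * mixedCoeff (fun j => s + ε j) K N m) := by
    rw [mixedCoeff_eq_sum, Finset.mul_sum]
    have : ∀ j ∈ Finset.range (m + 1), (N : ℝ) ^ (1 - s) * (q N j * b (m - j)) = q N j * g j := by
      intro j hj
      simp only [hg]
      rw [if_pos (by simpa [Nat.lt_succ_iff] using hj)]
      ring
    rw [Finset.sum_congr rfl this]
    refine hasSum_sum_of_ne_finset_zero fun j hj => ?_
    simp only [hg]
    rw [if_neg (by simpa [Nat.lt_succ_iff] using hj), mul_zero]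
  have hdiff : HasSum (fun j => q N j * (g j - L))
      ((N : ℝ) ^ (1 - s) * mixedCoeff (fun j => s + ε j) K N m - L) := by
    have := hgsum.sub ((hqs N).mul_right L)
    rw [one_mul] at this
    refine this.congr_fun fun j => by ring
  set F : ℕ → ℝ := fun j => if |(j : ℝ) / N - c₁| ≤ δ then 0 else q N j with hF
  set G : ℕ → ℝ := fun j => if (c₁ + δ) * N ≤ j then q N j * g j else 0 with hG
  have hF0 : ∀ j, 0 ≤ F j := by
    intro j; simp only [hF]; split_ifs
    · exact le_rfl
    · exact hq0 N j
  have hFs : Summable F := by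
    refine Summable.of_nonneg_of_le hF0 (fun j => ?_) (hqs N).summable
    simp only [hF]
    split_ifs
    · exact hq0 N j
    · exact le_rfl
  have hG0 : ∀ j, 0 ≤ G j := by
    intro j; simp only [hG]; split_ifs
    · exact mul_nonneg (hq0 N j) (hg0 j)
    · exact le_rfl
  have hGs : Summable G := by
    refine Summable.of_nonneg_of_le hG0 (fun j => ?_) hgsum.summable
    simp only [hG]
    split_ifs
    · exact le_rfl
    · exact mul_nonneg (hq0 N j) (hg0 j)
  -- Within the window g is close to L; below it g is bounded by |M|; above it g need not be
  -- bounded, so the product q g is kept, as `G`.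
  have hpt : ∀ j, |q N j * (g j - L)| ≤ τ / 4 * q N j + (|M| + |L|) * F j + G j := by
    intro j
    have hqj := hq0 N j
    rw [abs_mul, abs_of_nonneg hqj]
    have hML : 0 ≤ |M| + |L| := by positivity
    by_cases hj : |(j : ℝ) / N - c₁| ≤ δ
    · have hj' := abs_le.1 hj
      have hjm : j ≤ m := by
        have : (j : ℝ) / N ≤ (m : ℝ) / N := by linarith
        rw [div_le_div_iff_of_pos_right hN0] at this
        exact_mod_cast this
      have h6 : |g j - L| ≤ τ / 4 := by
        simp only [hg]
        rw [if_pos hjm]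
        refine h1 (m - j) ?_
        rw [Nat.cast_sub hjm, sub_div, abs_le]
        constructor <;> linarith
      have h7 := mul_le_mul_of_nonneg_left h6 hqj
      have h8 := mul_nonneg hML (hF0 j)
      have h9 := hG0 j
      linarith
    · have hFj : F j = q N j := by simp only [hF]; rw [if_neg hj]
      rw [hFj]
      have h10 := mul_nonneg (by positivity : 0 ≤ τ / 4) hqj
      rcases lt_abs.1 (not_le.1 hj) with hj | hj
      · have hGj : G j = q N j * g j := by
          simp only [hG]; rw [if_pos]
          rw [← le_div_iff₀ hN0]; linarith
        rw [hGj]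
        have h6 : |g j - L| ≤ g j + |L| := by
          refine (abs_sub _ _).trans ?_
          rw [abs_of_nonneg (hg0 j)]
        have h7 := mul_le_mul_of_nonneg_left h6 hqj
        have h8 := mul_nonneg (abs_nonneg M) hqj
        linarith
      · have hjm : j ≤ m := by
          have : (j : ℝ) / N ≤ (m : ℝ) / N := by linarith
          rw [div_le_div_iff_of_pos_right hN0] at this
          exact_mod_cast this
        have hjN : 0 ≤ (j : ℝ) / N := by positivity
        have h6 : |g j - L| ≤ |M| + |L| := by
          refine (abs_sub _ _).trans ?_
          simp only [hg]
          rw [if_pos hjm]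
          have h7 := hM N (m - j) h5 (by rw [Nat.cast_sub hjm, sub_div (m : ℝ)]; linarith)
            (by rw [Nat.cast_sub hjm, sub_div (m : ℝ)]; linarith)
          have := le_abs_self M
          linarith
        have h7 := mul_le_mul_of_nonneg_left h6 hqj
        have h9 := hG0 j
        linarith
  -- Above the window m - j may be small, and if s < 1 the factor N^(1-s) b_{m-j} is then not
  -- uniformly bounded. Here N q is uniformly small and the sum of all b up to m is O(N^s).
  have hGsum : ∑' j, G j ≤ τ / 4 := by
    have h6 : ∑' j, G j = ∑ j ∈ Finset.range (m + 1), G j := by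
      refine tsum_eq_sum fun j hj => ?_
      have : g j = 0 := by
        simp only [hg]; rw [if_neg (by simpa [Nat.lt_succ_iff] using hj)]
      simp only [hG]
      rw [this, mul_zero, ite_self]
    rw [h6]
    have h7 : ∀ j ∈ Finset.range (m + 1), G j ≤ τ / (4 * (B + 1)) * (N : ℝ)⁻¹ * (N : ℝ) ^ (1 - s) * b (m - j) := by
      intro j hj
      have hbj := hb0 (m - j)
      simp only [hG]
      split_ifs with hc
      · have h8 : q N j ≤ τ / (4 * (B + 1)) * (N : ℝ)⁻¹ := by
          rw [← div_eq_mul_inv, le_div_iff₀ hN0, mul_comm]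
          exact h3 j hc
        simp only [hg]
        rw [if_pos (by simpa [Nat.lt_succ_iff] using hj), mul_assoc _ ((N : ℝ) ^ (1 - s))]
        gcongr
      · positivity
    refine (Finset.sum_le_sum h7).trans ?_
    rw [← Finset.mul_sum]
    have h8 : ∑ j ∈ Finset.range (m + 1), b (m - j) = ∑ i ∈ Finset.range (m + 1), b i := by
      have := Finset.sum_range_reflect b (m + 1)
      simpa using this
    rw [h8]
    have h9 : ∑ i ∈ Finset.range (m + 1), b i ≤ B * (N : ℝ) ^ s := by
      refine (hD m hm0).trans ?_
      have hmN : (m : ℝ) ≤ (v + δ) * N := by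
        rw [← div_le_iff₀ hN0]; linarith
      calc D * (m : ℝ) ^ s ≤ |D| * ((v + δ) * N) ^ s := by
            gcongr
            exact le_abs_self D
        _ = B * (N : ℝ) ^ s := by rw [Real.mul_rpow hv0.le hN0.le, hB]; ring
    calc τ / (4 * (B + 1)) * (N : ℝ)⁻¹ * (N : ℝ) ^ (1 - s) * ∑ i ∈ Finset.range (m + 1), b i
        ≤ τ / (4 * (B + 1)) * (N : ℝ)⁻¹ * (N : ℝ) ^ (1 - s) * (B * (N : ℝ) ^ s) := by gcongr
      _ = τ / (4 * (B + 1)) * B * ((N : ℝ)⁻¹ * ((N : ℝ) ^ (1 - s) * (N : ℝ) ^ s)) := by ring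
      _ = τ / (4 * (B + 1)) * B := by
          rw [← Real.rpow_add hN0, sub_add_cancel, Real.rpow_one, inv_mul_cancel₀ hN0.ne', mul_one]
      _ ≤ τ / 4 := by
          rw [div_mul_eq_mul_div, div_le_div_iff₀ (by positivity) (by norm_num)]
          nlinarith
  have hbound : HasSum (fun j => τ / 4 * q N j + (|M| + |L|) * F j + G j)
      (τ / 4 * 1 + (|M| + |L|) * ∑' j, F j + ∑' j, G j) :=
    (((hqs N).mul_left _).add (hFs.hasSum.mul_left _)).add hGs.hasSum
  have hfinal : |(N : ℝ) ^ (1 - s) * mixedCoeff (fun j => s + ε j) K N m - L| ≤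
      τ / 4 * 1 + (|M| + |L|) * ∑' j, F j + ∑' j, G j := by
    rw [← hdiff.tsum_eq, ← Real.norm_eq_abs]
    exact tsum_of_norm_bounded hbound hpt
  rw [Real.dist_eq]
  have h2' : (|M| + |L|) * ∑' j, F j ≤ τ / 4 := h2
  linarith

end poissonSums

/-! ### Splitting off cycles of permutations -/

section permutations

variable {N : ℕ}

theorem mem_cycleSet {σ : Equiv.Perm (Fin N)} {i k : Fin N} : k ∈ cycleSet σ i ↔ σ.SameCycle i k := by
  simp [cycleSet]

theorem self_mem_cycleSet (σ : Equiv.Perm (Fin N)) (i : Fin N) : i ∈ cycleSet σ i :=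
  mem_cycleSet.2 (Equiv.Perm.SameCycle.refl σ i)

theorem cycleSet_eq_of_mem {σ : Equiv.Perm (Fin N)} {i k : Fin N} (h : k ∈ cycleSet σ i) :
    cycleSet σ k = cycleSet σ i := by
  rw [mem_cycleSet] at h
  ext m
  rw [mem_cycleSet, mem_cycleSet]
  exact ⟨fun h' => h.trans h', fun h' => h.symm.trans h'⟩

theorem cycleSet_of_fixed {σ : Equiv.Perm (Fin N)} {i : Fin N} (h : σ i = i) :
    cycleSet σ i = {i} := by
  ext k
  rw [mem_cycleSet, Finset.mem_singleton]
  refine ⟨fun h' => ?_, fun h' => h' ▸ Equiv.Perm.SameCycle.refl σ _⟩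
  exact (h'.eq_of_left h).symm

theorem cycleSet_eq_support_cycleOf {σ : Equiv.Perm (Fin N)} {i : Fin N} (h : σ i ≠ i) :
    cycleSet σ i = (σ.cycleOf i).support := by
  ext k
  rw [mem_cycleSet, Equiv.Perm.mem_support_cycleOf_iff' h]

theorem cycleSet_congr {σ₁ σ₂ : Equiv.Perm (Fin N)} {A : Finset (Fin N)}
    (hmaps : ∀ i ∈ A, σ₁ i ∈ A) (heq : ∀ i ∈ A, σ₁ i = σ₂ i) {i : Fin N} (hi : i ∈ A) :
    cycleSet σ₁ i = cycleSet σ₂ i := by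
  have hpow : ∀ n : ℕ, (σ₁ ^ n) i ∈ A ∧ (σ₁ ^ n) i = (σ₂ ^ n) i := by
    intro n
    induction n with
    | zero => simpa using hi
    | succ n ih =>
      rw [pow_succ', pow_succ', Equiv.Perm.mul_apply, Equiv.Perm.mul_apply]
      exact ⟨hmaps _ ih.1, by rw [heq _ ih.1, ih.2]⟩
  ext k
  rw [mem_cycleSet, mem_cycleSet]
  constructor <;> intro h <;> obtain ⟨n, hn⟩ := h.exists_nat_pow_eq
  · exact ⟨n, by rw [zpow_natCast, ← (hpow n).2]; exact hn⟩
  · exact ⟨n, by rw [zpow_natCast, (hpow n).2]; exact hn⟩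

/-- Both sides count the points in cycles of length j. Length one is separate because the cycle type
does not record fixed points. -/
theorem mul_cycleCount (σ : Equiv.Perm (Fin N)) {j : ℕ} (hj : 1 ≤ j) :
    j * cycleCount σ j = (Finset.univ.filter fun i => (cycleSet σ i).card = j).card := by
  unfold cycleCount
  rw [Equiv.Perm.parts_partition, Multiset.count_add, Multiset.count_replicate]
  rcases Nat.eq_or_lt_of_le hj with rfl | hj2
  · have h1 : Multiset.count 1 σ.cycleType = 0 := by
      rw [Multiset.count_eq_zero]
      intro h
      have := Equiv.Perm.two_le_of_mem_cycleType h
      omega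
    rw [h1, if_pos rfl, zero_add, one_mul, ← Finset.card_compl]
    congr 1
    ext i
    simp only [Finset.mem_compl, Equiv.Perm.mem_support, not_not, Finset.mem_filter,
      Finset.mem_univ, true_and]
    constructor
    · intro h; rw [cycleSet_of_fixed h, Finset.card_singleton]
    · intro h
      obtain ⟨a, ha⟩ := Finset.card_eq_one.1 h
      have h2 : i ∈ cycleSet σ i := self_mem_cycleSet σ i
      have h3 : σ i ∈ cycleSet σ i :=
        mem_cycleSet.2 (Equiv.Perm.sameCycle_apply_right.2 (Equiv.Perm.SameCycle.refl σ i))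
      rw [ha, Finset.mem_singleton] at h2 h3
      rw [h3, ← h2]
  · rw [if_neg (by omega), add_zero, Equiv.Perm.cycleType_def, Multiset.count_map]
    have hset : (Finset.univ.filter fun i => (cycleSet σ i).card = j) =
        (σ.cycleFactorsFinset.filter fun c => j = (Finset.card ∘ Equiv.Perm.support) c).biUnion
          Equiv.Perm.support := by
      ext i
      simp only [Finset.mem_filter, Finset.mem_univ, true_and, Finset.mem_biUnion]
      constructor
      · intro h
        have hi : σ i ≠ i := by
          intro h'
          rw [cycleSet_of_fixed h', Finset.card_singleton] at h
          omega
        refine ⟨σ.cycleOf i, ⟨Equiv.Perm.cycleOf_mem_cycleFactorsFinset_iff.2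
          (Equiv.Perm.mem_support.2 hi), ?_⟩, ?_⟩
        · rw [Function.comp_apply, ← cycleSet_eq_support_cycleOf hi, h]
        · rw [← cycleSet_eq_support_cycleOf hi]; exact self_mem_cycleSet σ i
      · rintro ⟨c, ⟨hc, hcj⟩, hi⟩
        have h1 := (Equiv.Perm.eq_cycleOf_of_mem_cycleFactorsFinset_iff σ c hc i).2 hi
        have h2 : σ i ≠ i := by
          have := Equiv.Perm.mem_cycleFactorsFinset_support_le hc hi
          exact Equiv.Perm.mem_support.1 this
        rw [cycleSet_eq_support_cycleOf h2, ← h1, hcj]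
        rfl
    rw [hset, Finset.card_biUnion]
    · rw [Finset.sum_congr rfl (g := fun _ => j)]
      · rw [Finset.sum_const, smul_eq_mul, mul_comm]
        rfl
      · intro c hc
        exact (Finset.mem_filter.1 hc).2.symm
    · intro c hc d hd hcd
      exact Equiv.Perm.disjoint_iff_disjoint_support.1
        (Equiv.Perm.cycleFactorsFinset_pairwise_disjoint σ (Finset.mem_filter.1 hc).1
          (Finset.mem_filter.1 hd).1 hcd)

/-- The permutations that fix every element of `S`. -/
def permFixing (S : Finset (Fin N)) : Finset (Equiv.Perm (Fin N)) :=
  Finset.univ.filter fun σ => ∀ i ∈ S, σ i = i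

/-- The permutations that act on `C` as one cycle, containing `x`, and fix everything else. -/
def cyclicOn (C : Finset (Fin N)) (x : Fin N) : Finset (Equiv.Perm (Fin N)) :=
  Finset.univ.filter fun τ => (∀ i, i ∉ C → τ i = i) ∧ cycleSet τ x = C

theorem mem_permFixing {S : Finset (Fin N)} {σ : Equiv.Perm (Fin N)} :
    σ ∈ permFixing S ↔ ∀ i ∈ S, σ i = i := by simp [permFixing]

theorem mem_cyclicOn {C : Finset (Fin N)} {x : Fin N} {τ : Equiv.Perm (Fin N)} :
    τ ∈ cyclicOn C x ↔ (∀ i, i ∉ C → τ i = i) ∧ cycleSet τ x = C := by simp [cyclicOn]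

/-- Restriction to C turns these permutations into the full cycles of C, of which there are (|C| -
1)!; a singleton C only admits the identity. -/
theorem card_cyclicOn {C : Finset (Fin N)} {x : Fin N} (hx : x ∈ C) :
    (cyclicOn C x).card = (C.card - 1).factorial := by
  rcases Nat.lt_or_ge C.card 2 with h | h
  · have h1 : C.card = 1 := by have := Finset.card_pos.2 ⟨x, hx⟩; omega
    obtain ⟨a, rfl⟩ := Finset.card_eq_one.1 h1
    have hxa := Finset.mem_singleton.1 hx
    subst hxa
    have : cyclicOn {x} x = {1} := by
      ext τ
      rw [mem_cyclicOn, Finset.mem_singleton]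
      constructor
      · rintro ⟨h1, h2⟩
        ext i
        by_cases hi : i = x
        · subst hi
          have h3 : τ i ∈ cycleSet τ i :=
            mem_cycleSet.2 (Equiv.Perm.sameCycle_apply_right.2 (Equiv.Perm.SameCycle.refl τ i))
          rw [h2, Finset.mem_singleton] at h3
          rw [h3]; rfl
        · rw [h1 i (by simpa using hi)]; rfl
      · rintro rfl
        exact ⟨fun _ _ => rfl, cycleSet_of_fixed rfl⟩
    rw [this]
    simp
  · have h1 := Equiv.Perm.card_of_cycleType_singleton (α := {i // i ∈ C}) (n := C.card) h (by simp)
    rw [Fintype.card_coe, Nat.choose_self, mul_one] at h1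
    rw [← h1]
    symm
    have hsup : ∀ g : Equiv.Perm {i // i ∈ C}, g.cycleType = {C.card} →
        (Equiv.Perm.ofSubtype g).IsCycle ∧ (Equiv.Perm.ofSubtype g).support = C := by
      intro g hg
      have hcyc : (Equiv.Perm.ofSubtype g).IsCycle := by
        rw [← Equiv.Perm.card_cycleType_eq_one, Equiv.Perm.cycleType_ofSubtype, hg,
          Multiset.card_singleton]
      refine ⟨hcyc, ?_⟩
      have h2 := hcyc.cycleType
      rw [Equiv.Perm.cycleType_ofSubtype, hg, Multiset.singleton_inj] at h2
      refine Finset.eq_of_subset_of_card_le (fun i hi => ?_) h2.le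
      by_contra hiC
      exact (Equiv.Perm.mem_support.1 hi) (Equiv.Perm.ofSubtype_apply_of_not_mem g hiC)
    refine Finset.card_bij (fun g _ => Equiv.Perm.ofSubtype g) ?_ ?_ ?_
    · intro g hg
      obtain ⟨hcyc, hs⟩ := hsup g (Finset.mem_filter.1 hg).2
      rw [mem_cyclicOn]
      refine ⟨fun i hi => Equiv.Perm.ofSubtype_apply_of_not_mem g hi, ?_⟩
      have hxs : Equiv.Perm.ofSubtype g x ≠ x := Equiv.Perm.mem_support.1 (by rw [hs]; exact hx)
      ext k
      rw [mem_cycleSet, (Equiv.Perm.isCycle_iff_sameCycle hxs).1 hcyc, ← Equiv.Perm.mem_support, hs]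
    · intro a _ b _ hab
      exact Equiv.Perm.ofSubtype_injective hab
    · intro τ hτ
      obtain ⟨h2, h3⟩ := mem_cyclicOn.1 hτ
      have hxs : τ x ≠ x := by
        intro h'
        rw [cycleSet_of_fixed h'] at h3
        rw [← h3, Finset.card_singleton] at h
        omega
      have hC : ∀ i, i ∈ C ↔ τ i ≠ i := by
        intro i
        constructor
        · intro hi h'
          rw [← h3, mem_cycleSet] at hi
          exact hxs (hi.apply_eq_self_iff.2 h')
        · intro hi
          by_contra hiC
          exact hi (h2 i hiC)
      have hcyc : τ.IsCycle := by
        rw [Equiv.Perm.isCycle_iff_sameCycle hxs]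
        intro y
        rw [← mem_cycleSet, h3, hC]
      have hmem : ∀ i, τ i ∈ C ↔ i ∈ C := by
        intro i
        rw [hC, hC]
        simp
      have hof : Equiv.Perm.ofSubtype (τ.subtypePerm hmem) = τ :=
        Equiv.Perm.ofSubtype_subtypePerm hmem fun i hi => (hC i).2 hi
      refine ⟨τ.subtypePerm hmem, ?_, hof⟩
      rw [Finset.mem_filter]
      refine ⟨Finset.mem_univ _, ?_⟩
      rw [← Equiv.Perm.cycleType_ofSubtype, hof, hcyc.cycleType]
      congr 1
      congr 1
      ext i
      rw [Equiv.Perm.mem_support, hC]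

theorem cyclicOn_apply_mem {C : Finset (Fin N)} {x : Fin N} {τ : Equiv.Perm (Fin N)}
    (hτ : τ ∈ cyclicOn C x) {i : Fin N} (hi : i ∈ C) : τ i ∈ C := by
  obtain ⟨-, h⟩ := mem_cyclicOn.1 hτ
  rw [← h] at hi ⊢
  rw [mem_cycleSet] at hi ⊢
  exact Equiv.Perm.sameCycle_apply_right.2 hi

theorem permFixing_apply_notMem {S : Finset (Fin N)} {σ : Equiv.Perm (Fin N)}
    (hσ : σ ∈ permFixing S) {i : Fin N} (hi : i ∉ S) : σ i ∉ S := by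
  intro h
  have := mem_permFixing.1 hσ _ h
  exact hi ((σ.injective this) ▸ h)

section decomposition

variable {S C : Finset (Fin N)} {x : Fin N} {τ σ' : Equiv.Perm (Fin N)}

theorem mul_apply_of_mem (hσ' : σ' ∈ permFixing (S ∪ C)) {i : Fin N} (hi : i ∈ C) :
    (τ * σ') i = τ i := by
  rw [Equiv.Perm.mul_apply, mem_permFixing.1 hσ' i (Finset.mem_union_right _ hi)]

theorem mul_apply_of_notMem (hτ : τ ∈ cyclicOn C x) (hσ' : σ' ∈ permFixing (S ∪ C)) {i : Fin N}
    (hi : i ∉ C) : (τ * σ') i = σ' i := by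
  rw [Equiv.Perm.mul_apply]
  refine (mem_cyclicOn.1 hτ).1 _ fun h => hi ?_
  have := mem_permFixing.1 hσ' _ (Finset.mem_union_right S h)
  exact (σ'.injective this) ▸ h

theorem cycleSet_mul_of_mem (hτ : τ ∈ cyclicOn C x) (hσ' : σ' ∈ permFixing (S ∪ C)) {i : Fin N}
    (hi : i ∈ C) : cycleSet (τ * σ') i = C := by
  have h1 : cycleSet τ i = cycleSet (τ * σ') i :=
    cycleSet_congr (A := C) (fun i hi => cyclicOn_apply_mem hτ hi)
      (fun i hi => (mul_apply_of_mem hσ' hi).symm) hi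
  have h2 := (mem_cyclicOn.1 hτ).2
  rw [← h1, cycleSet_eq_of_mem (i := x) (by rw [h2]; exact hi), h2]

theorem cycleSet_mul_of_notMem (hτ : τ ∈ cyclicOn C x) (hσ' : σ' ∈ permFixing (S ∪ C)) {i : Fin N}
    (hi : i ∉ C) : cycleSet (τ * σ') i = cycleSet σ' i := by
  symm
  refine cycleSet_congr (A := Cᶜ) (fun k hk => ?_) (fun k hk => ?_) (Finset.mem_compl.2 hi)
  · rw [Finset.mem_compl] at hk ⊢
    refine permFixing_apply_notMem (S := C) ?_ hk
    exact mem_permFixing.2 fun i hi => mem_permFixing.1 hσ' i (Finset.mem_union_right _ hi)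
  · exact (mul_apply_of_notMem hτ hσ' (Finset.mem_compl.1 hk)).symm

end decomposition

/-- Every σ is uniquely τσ', with τ the cycle of x and σ' fixing C as well as S. -/
theorem sum_cycleSet_eq {S C : Finset (Fin N)} {x : Fin N} (hx : x ∈ C) (hCS : Disjoint C S)
    (F : Equiv.Perm (Fin N) → ℝ) :
    ∑ σ ∈ (permFixing S).filter (fun σ => cycleSet σ x = C), F σ =
      ∑ τ ∈ cyclicOn C x, ∑ σ' ∈ permFixing (S ∪ C), F (τ * σ') := by
  rw [← Finset.sum_product']
  have key : ∀ σ ∈ (permFixing S).filter (fun σ => cycleSet σ x = C),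
      (∀ i, i ∉ C → σ.cycleOf x i = i) ∧ (∀ i ∈ C, σ.cycleOf x i = σ i) := by
    intro σ hσ
    obtain ⟨-, h2⟩ := Finset.mem_filter.1 hσ
    constructor
    · intro i hi
      refine Equiv.Perm.cycleOf_apply_of_not_sameCycle ?_
      rwa [← mem_cycleSet, h2]
    · intro i hi
      refine Equiv.Perm.SameCycle.cycleOf_apply ?_
      rwa [← mem_cycleSet, h2]
  refine Finset.sum_bij' (fun σ _ => (σ.cycleOf x, (σ.cycleOf x)⁻¹ * σ)) (fun p _ => p.1 * p.2)
    ?_ ?_ ?_ ?_ ?_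
  · intro σ hσ
    obtain ⟨h1, h2⟩ := key σ hσ
    obtain ⟨h3, h4⟩ := Finset.mem_filter.1 hσ
    rw [Finset.mem_product]
    have hmaps : ∀ i ∈ C, σ i ∈ C := by
      intro i hi
      rw [← h4, mem_cycleSet] at hi ⊢
      exact Equiv.Perm.sameCycle_apply_right.2 hi
    refine ⟨mem_cyclicOn.2 ⟨h1, ?_⟩, mem_permFixing.2 fun i hi => ?_⟩
    · rw [← cycleSet_congr hmaps (fun i hi => (h2 i hi).symm) hx, h4]
    · dsimp only
      rw [Equiv.Perm.mul_apply, Equiv.Perm.inv_eq_iff_eq]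
      rcases Finset.mem_union.1 hi with h | h
      · rw [mem_permFixing.1 h3 i h, h1 i (Finset.disjoint_right.1 hCS h)]
      · exact (h2 i h).symm
  · rintro ⟨τ, σ'⟩ h
    obtain ⟨hτ, hσ'⟩ := Finset.mem_product.1 h
    rw [Finset.mem_filter]
    refine ⟨mem_permFixing.2 fun i hi => ?_, cycleSet_mul_of_mem hτ hσ' hx⟩
    dsimp only at hτ hσ' ⊢
    rw [mul_apply_of_notMem hτ hσ' (Finset.disjoint_right.1 hCS hi)]
    exact mem_permFixing.1 hσ' i (Finset.mem_union_left _ hi)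
  · intro σ _
    simp
  · rintro ⟨τ, σ'⟩ h
    obtain ⟨hτ, hσ'⟩ := Finset.mem_product.1 h
    dsimp only at hτ hσ' ⊢
    have hc : (τ * σ').cycleOf x = τ := by
      ext i
      congr 1
      by_cases hi : i ∈ C
      · rw [Equiv.Perm.SameCycle.cycleOf_apply, mul_apply_of_mem hσ' hi]
        rwa [← mem_cycleSet, cycleSet_mul_of_mem hτ hσ' hx]
      · rw [Equiv.Perm.cycleOf_apply_of_not_sameCycle, (mem_cyclicOn.1 hτ).1 i hi]
        rwa [← mem_cycleSet, cycleSet_mul_of_mem hτ hσ' hx]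
    rw [hc]
    simp
  · intro σ _
    simp

/-- There are binom(n-1, l-1) choices of C, (l-1)! cycles on it and a factor (n-l)! from the rest;
their product is (n-1)! for every l. Hence each cycle length enters with the same combinatorial
factor. -/
theorem sum_permFixing_eq {S : Finset (Fin N)} {x : Fin N} (hx : x ∉ S)
    (F : Equiv.Perm (Fin N) → ℝ) (v : ℕ → ℝ)
    (hF : ∀ C : Finset (Fin N), x ∈ C → Disjoint C S → ∀ τ ∈ cyclicOn C x,
      ∑ σ' ∈ permFixing (S ∪ C), F (τ * σ') = ((S ∪ C)ᶜ.card).factorial * v C.card) :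
    ∑ σ ∈ permFixing S, F σ = ((Sᶜ.card - 1).factorial : ℝ) * ∑ l ∈ Finset.Icc 1 Sᶜ.card, v l := by
  set n := Sᶜ.card with hn
  have hxS : x ∈ Sᶜ := Finset.mem_compl.2 hx
  have hn1 : 1 ≤ n := Finset.card_pos.2 ⟨x, hxS⟩
  -- Removing x makes the fibres range over all subsets of an (n-1)-element set.
  have hmaps : ∀ σ ∈ permFixing S, (cycleSet σ x).erase x ∈ (Sᶜ.erase x).powerset := by
    intro σ hσ
    rw [Finset.mem_powerset]
    refine Finset.erase_subset_erase x fun k hk => ?_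
    rw [Finset.mem_compl]
    intro hkS
    have h1 := cycleSet_eq_of_mem hk
    rw [cycleSet_of_fixed (mem_permFixing.1 hσ k hkS)] at h1
    have h2 := self_mem_cycleSet σ x
    rw [← h1, Finset.mem_singleton] at h2
    exact hx (h2 ▸ hkS)
  rw [← Finset.sum_fiberwise_of_maps_to hmaps]
  have hterm : ∀ D ∈ (Sᶜ.erase x).powerset,
      ∑ σ ∈ (permFixing S).filter (fun σ => (cycleSet σ x).erase x = D), F σ =
        (fun k => (k.factorial : ℝ) * ((n - 1 - k).factorial * v (k + 1))) D.card := by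
    intro D hD
    rw [Finset.mem_powerset] at hD
    have hxD : x ∉ D := fun h => Finset.notMem_erase x _ (hD h)
    have hfil : (permFixing S).filter (fun σ => (cycleSet σ x).erase x = D) =
        (permFixing S).filter (fun σ => cycleSet σ x = insert x D) := by
      refine Finset.filter_congr fun σ _ => ⟨fun h => ?_, fun h => ?_⟩
      · rw [← h, Finset.insert_erase (self_mem_cycleSet σ x)]
      · rw [h, Finset.erase_insert hxD]
    have hdisj : Disjoint (insert x D) S := by
      rw [Finset.disjoint_left]
      intro k hk
      rcases Finset.mem_insert.1 hk with rfl | hk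
      · exact hx
      · exact Finset.mem_compl.1 (Finset.mem_of_mem_erase (hD hk))
    have hcard : (insert x D).card = D.card + 1 := Finset.card_insert_of_notMem hxD
    have hcompl : (S ∪ insert x D)ᶜ.card = n - 1 - D.card := by
      have h1 : (S ∪ insert x D).card = S.card + (D.card + 1) := by
        rw [Finset.card_union_of_disjoint hdisj.symm, hcard]
      rw [Finset.card_compl, h1, hn, Finset.card_compl]
      omega
    rw [hfil, sum_cycleSet_eq (Finset.mem_insert_self x D) hdisj,
      Finset.sum_congr rfl (hF _ (Finset.mem_insert_self x D) hdisj), Finset.sum_const,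
      card_cyclicOn (Finset.mem_insert_self x D), hcard, hcompl, nsmul_eq_mul]
    simp
  rw [Finset.sum_congr rfl hterm, Finset.sum_powerset_apply_card (f := fun k =>
    (k.factorial : ℝ) * ((n - 1 - k).factorial * v (k + 1))), Finset.card_erase_of_mem hxS, ← hn,
    Finset.mul_sum, Nat.sub_add_cancel hn1]
  refine Finset.sum_nbij' (fun k => k + 1) (fun l => l - 1) ?_ ?_ ?_ ?_ ?_
  · intro k hk; rw [Finset.mem_range] at hk; rw [Finset.mem_Icc]; omega
  · intro l hl; rw [Finset.mem_Icc] at hl; rw [Finset.mem_range]; omega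
  · intro k _; simp
  · intro l hl; rw [Finset.mem_Icc] at hl; omega
  · intro k hk
    rw [Finset.mem_range] at hk
    have h1 := Nat.choose_mul_factorial_mul_factorial (n := n - 1) (k := k) (by omega)
    have h2 : ((n - 1).choose k : ℝ) * k.factorial * (n - 1 - k).factorial = (n - 1).factorial := by
      exact_mod_cast h1
    rw [nsmul_eq_mul, ← h2]
    ring

/-- The weight of the cycles outside `S`, written as a product over elements. -/
noncomputable def elemWeight (w : ℕ → ℝ) (S : Finset (Fin N)) (σ : Equiv.Perm (Fin N)) : ℝ :=
  ∏ i ∈ Sᶜ, w (cycleSet σ i).card ^ ((1 : ℝ) / (cycleSet σ i).card)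

/-- The lengths of the cycles of `σ` outside `S`, in lexicographic order. -/
noncomputable def lexFrom (σ : Equiv.Perm (Fin N)) (S : Finset (Fin N)) : ℕ → ℕ
  | 0 => if h : Sᶜ.Nonempty then (cycleSet σ (Sᶜ.min' h)).card else 0
  | n + 1 => lexFrom σ (if h : Sᶜ.Nonempty then S ∪ cycleSet σ (Sᶜ.min' h) else S) n

/-- The recursion of `lexFrom` peels off the front cycle and carries the set removed so far; this
suits induction on the number of remaining lengths. -/
theorem lexFrom_firstCycles (σ : Equiv.Perm (Fin N)) (k n : ℕ) :
    lexFrom σ (firstCycles σ k) n = lexLength σ (k + n) := by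
  induction n generalizing k with
  | zero => rfl
  | succ n ih =>
    have h1 : firstCycles σ (k + 1) = if h : (firstCycles σ k)ᶜ.Nonempty then
      firstCycles σ k ∪ cycleSet σ ((firstCycles σ k)ᶜ.min' h) else firstCycles σ k := rfl
    rw [lexFrom, ← h1, ih (k + 1)]
    congr 1
    omega

theorem lexFrom_empty (σ : Equiv.Perm (Fin N)) (n : ℕ) : lexFrom σ ∅ n = lexLength σ n := by
  have := lexFrom_firstCycles σ 0 n
  rwa [zero_add] at this

section decomposition

variable {S C : Finset (Fin N)} {x : Fin N} {τ σ' : Equiv.Perm (Fin N)}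

/-- The l points of a cycle carry w(l)^(1/l) each and together give w(l). The product over points
therefore factors along C and its complement. -/
theorem elemWeight_mul {w : ℕ → ℝ} (hw : ∀ j, 0 ≤ w j) (hx : x ∈ C) (hCS : Disjoint C S)
    (hτ : τ ∈ cyclicOn C x) (hσ' : σ' ∈ permFixing (S ∪ C)) :
    elemWeight w S (τ * σ') = w C.card * elemWeight w (S ∪ C) σ' := by
  unfold elemWeight
  have h1 : Sᶜ = C ∪ (S ∪ C)ᶜ := by
    ext i
    simp only [Finset.mem_compl, Finset.mem_union]
    have h' : i ∈ C → i ∉ S := fun hi => Finset.disjoint_left.1 hCS hi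
    tauto
  have h2 : Disjoint C (S ∪ C)ᶜ := by
    rw [Finset.disjoint_left]
    intro i hi h
    exact Finset.mem_compl.1 h (Finset.mem_union_right _ hi)
  rw [h1, Finset.prod_union h2]
  congr 1
  · rw [Finset.prod_congr rfl (g := fun _ => w C.card ^ ((1 : ℝ) / C.card))
      (fun i hi => by rw [cycleSet_mul_of_mem hτ hσ' hi]), Finset.prod_const, ← Real.rpow_natCast,
      ← Real.rpow_mul (hw _), one_div, inv_mul_cancel₀, Real.rpow_one]
    have := Finset.card_pos.2 ⟨x, hx⟩
    positivity
  · refine Finset.prod_congr rfl fun i hi => ?_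
    rw [cycleSet_mul_of_notMem hτ hσ' fun h =>
      Finset.mem_compl.1 hi (Finset.mem_union_right _ h)]

theorem lexFrom_mul (hτ : τ ∈ cyclicOn C x) (hσ' : σ' ∈ permFixing (S ∪ C)) (n : ℕ)
    {A : Finset (Fin N)} (hA : C ⊆ A) : lexFrom (τ * σ') A n = lexFrom σ' A n := by
  have hmin : ∀ {A : Finset (Fin N)} (_ : C ⊆ A) (h : Aᶜ.Nonempty),
      cycleSet (τ * σ') (Aᶜ.min' h) = cycleSet σ' (Aᶜ.min' h) := by
    intro A hA h
    exact cycleSet_mul_of_notMem hτ hσ' fun hC =>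
      Finset.mem_compl.1 (Finset.min'_mem _ h) (hA hC)
  induction n generalizing A with
  | zero =>
    unfold lexFrom
    split_ifs with h
    · rw [hmin hA h]
    · rfl
  | succ n ih =>
    unfold lexFrom
    split_ifs with h
    · rw [hmin hA h, ih (hA.trans Finset.subset_union_left)]
    · exact ih hA

theorem card_compl_union (hCS : Disjoint C S) : (S ∪ C)ᶜ.card = Sᶜ.card - C.card := by
  rw [Finset.card_compl, Finset.card_union_of_disjoint hCS.symm, Finset.card_compl]
  omega

end decomposition

theorem factorial_sub_one_mul {n : ℕ} (hn : 1 ≤ n) (a : ℝ) :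
    ((n - 1).factorial : ℝ) * (n * a) = n.factorial * a := by
  rw [← Nat.mul_factorial_pred (by omega : n ≠ 0)]
  push_cast
  ring

/-- Induction on the number of free points: conditioning on the cycle of one of them reproduces the
recursion n h_n = ∑ w_l h_{n-l}. -/
theorem sum_elemWeight {w : ℕ → ℝ} (hw : ∀ j, 0 ≤ w j) (S : Finset (Fin N)) :
    ∑ σ ∈ permFixing S, elemWeight w S σ = (Sᶜ.card).factorial * expCoeff w Sᶜ.card := by
  induction hn : Sᶜ.card using Nat.strong_induction_on generalizing S with
  | _ n ih =>
    rcases Finset.eq_empty_or_nonempty Sᶜ with h | ⟨x, hx⟩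
    · have h0 : n = 0 := by rw [← hn, h, Finset.card_empty]
      have h1 : permFixing S = {1} := by
        ext σ
        rw [mem_permFixing, Finset.mem_singleton]
        constructor
        · intro h'
          ext i
          have : i ∈ S := by
            by_contra hi
            have : i ∈ Sᶜ := Finset.mem_compl.2 hi
            rw [h] at this
            simp at this
          rw [h' i this]; rfl
        · rintro rfl i _; rfl
      rw [h1, Finset.sum_singleton, elemWeight, h, h0, expCoeff_zero]
      simp
    · have hn1 : 1 ≤ n := hn ▸ Finset.card_pos.2 ⟨x, hx⟩
      rw [sum_permFixing_eq (Finset.mem_compl.1 hx) _ (fun l => w l * expCoeff w (n - l)), hn,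
        ← mul_expCoeff, factorial_sub_one_mul hn1]
      intro C hxC hCS τ hτ
      rw [Finset.sum_congr rfl fun σ' hσ' => elemWeight_mul hw hxC hCS hτ hσ', ← Finset.mul_sum]
      have hc := card_compl_union hCS
      have hC1 := Finset.card_pos.2 ⟨x, hxC⟩
      rw [ih (n - C.card) (by omega) (S ∪ C) (by rw [hc, hn]), hc, hn]
      ring

/-- The sum of `f (L_1, …, L_m)` over the permutations of `n` elements, weighted by the product of
`w` over the cycle lengths, divided by `n!`. -/
noncomputable def lexSum (w : ℕ → ℝ) : (m n : ℕ) → ((Fin m → ℕ) → ℝ) → ℝ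
  | 0, n, f => expCoeff w n * f Fin.elim0
  | m + 1, n, f =>
    if n = 0 then lexSum w m 0 (fun v => f (Fin.cons 0 v))
    else (1 / (n : ℝ)) * ∑ l ∈ Finset.Icc 1 n, w l * lexSum w m (n - l) (fun v => f (Fin.cons l v))

/-- The least free point is split off with its cycle C; what remains is the same problem for S ∪ C
with one coordinate fewer. -/
theorem sum_lexFrom {w : ℕ → ℝ} (hw : ∀ j, 0 ≤ w j) (m : ℕ) (S : Finset (Fin N))
    (f : (Fin m → ℕ) → ℝ) :
    ∑ σ ∈ permFixing S, elemWeight w S σ * f (fun i => lexFrom σ S i) =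
      (Sᶜ.card).factorial * lexSum w m Sᶜ.card f := by
  induction m generalizing S with
  | zero =>
    have : ∀ σ : Equiv.Perm (Fin N), (fun i : Fin 0 => lexFrom σ S i) = Fin.elim0 :=
      fun σ => Subsingleton.elim _ _
    simp_rw [this]
    rw [← Finset.sum_mul, sum_elemWeight hw, lexSum, mul_assoc]
  | succ m ih =>
    by_cases h : Sᶜ.Nonempty
    · set x := Sᶜ.min' h with hx
      have hxS : x ∈ Sᶜ := Finset.min'_mem _ h
      have hn1 : 1 ≤ Sᶜ.card := Finset.card_pos.2 h
      have hn0 : ((Sᶜ.card : ℕ) : ℝ) ≠ 0 := by positivity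
      rw [sum_permFixing_eq (Finset.mem_compl.1 hxS) _
        (fun l => w l * lexSum w m (Sᶜ.card - l) (fun v => f (Fin.cons l v))), lexSum,
        if_neg (by omega), ← factorial_sub_one_mul hn1]
      · congr 1
        field_simp
      intro C hxC hCS τ hτ
      have hterm : ∀ σ' ∈ permFixing (S ∪ C), elemWeight w S (τ * σ') *
          f (fun i : Fin (m + 1) => lexFrom (τ * σ') S i) = w C.card * (elemWeight w (S ∪ C) σ' *
            (fun v : Fin m → ℕ => f (Fin.cons C.card v)) fun i => lexFrom σ' (S ∪ C) i) := by
        intro σ' hσ'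
        rw [elemWeight_mul hw hxC hCS hτ hσ', mul_assoc]
        congr 3
        ext i
        refine Fin.cases ?_ (fun i => ?_) i
        · simp only [Fin.val_zero, Fin.cons_zero]
          rw [lexFrom, dif_pos h, cycleSet_mul_of_mem hτ hσ' hxC]
        · simp only [Fin.val_succ, Fin.cons_succ]
          rw [lexFrom, dif_pos h, cycleSet_mul_of_mem hτ hσ' hxC,
            lexFrom_mul hτ hσ' _ Finset.subset_union_right]
      rw [Finset.sum_congr rfl hterm, ← Finset.mul_sum,
        ih (S ∪ C) (fun v : Fin m → ℕ => f (Fin.cons C.card v)), card_compl_union hCS]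
      ring
    -- No free point is left, so this length and all later ones take the default value 0.
    · have h0 : Sᶜ.card = 0 := by rw [Finset.card_eq_zero]; exact Finset.not_nonempty_iff_eq_empty.1 h
      have hterm : ∀ σ : Equiv.Perm (Fin N), (fun i : Fin (m + 1) => lexFrom σ S i) =
          Fin.cons 0 (fun i : Fin m => lexFrom σ S i) := by
        intro σ
        ext i
        refine Fin.cases ?_ (fun i => ?_) i
        · simp only [Fin.val_zero, Fin.cons_zero]
          rw [lexFrom, dif_neg h]
        · simp only [Fin.val_succ, Fin.cons_succ]
          rw [lexFrom, dif_neg h]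
      simp_rw [hterm]
      rw [ih S (fun v => f (Fin.cons 0 v)), h0, lexSum, if_pos rfl]

/-- The point x is arbitrary and the right side does not depend on it, so all points have the same
law of cycle length. -/
theorem sum_cycle_card {w : ℕ → ℝ} (hw : ∀ j, 0 ≤ w j) (x : Fin N) (f : ℕ → ℝ) :
    ∑ σ : Equiv.Perm (Fin N), elemWeight w ∅ σ * f (cycleSet σ x).card =
      ((N - 1).factorial : ℝ) * ∑ l ∈ Finset.Icc 1 N, w l * f l * expCoeff w (N - l) := by
  have huniv : permFixing (∅ : Finset (Fin N)) = Finset.univ := by ext; simp [mem_permFixing]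
  have hcard : (∅ : Finset (Fin N))ᶜ.card = N := by simp
  have := sum_permFixing_eq (S := (∅ : Finset (Fin N))) (x := x) (by simp)
    (fun σ => elemWeight w ∅ σ * f (cycleSet σ x).card)
    (fun l => w l * f l * expCoeff w (N - l)) ?_
  · rw [huniv, hcard] at this
    exact this
  · intro C hxC hCS τ hτ
    have hterm : ∀ σ' ∈ permFixing (∅ ∪ C), elemWeight w ∅ (τ * σ') *
        f (cycleSet (τ * σ') x).card = w C.card * f C.card * elemWeight w (∅ ∪ C) σ' := by
      intro σ' hσ'
      rw [elemWeight_mul hw hxC hCS hτ hσ', cycleSet_mul_of_mem hτ hσ' hxC]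
      ring
    rw [Finset.sum_congr rfl hterm, ← Finset.mul_sum, sum_elemWeight hw, card_compl_union hCS, hcard]
    ring

theorem elemWeight_empty {w : ℕ → ℝ} (hw : ∀ j, 0 ≤ w j) (σ : Equiv.Perm (Fin N)) :
    elemWeight w ∅ σ = ∏ j ∈ Finset.Icc 1 N, w j ^ cycleCount σ j := by
  unfold elemWeight
  have hmaps : ∀ i ∈ (∅ : Finset (Fin N))ᶜ, (cycleSet σ i).card ∈ Finset.Icc 1 N := by
    intro i _
    rw [Finset.mem_Icc]
    refine ⟨Finset.card_pos.2 ⟨i, self_mem_cycleSet σ i⟩, ?_⟩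
    simpa using Finset.card_le_univ (cycleSet σ i)
  rw [← Finset.prod_fiberwise_of_maps_to hmaps]
  refine Finset.prod_congr rfl fun j hj => ?_
  rw [Finset.mem_Icc] at hj
  have hj0 : (j : ℝ) ≠ 0 := by
    have : 0 < j := hj.1
    positivity
  rw [Finset.prod_congr rfl (g := fun _ => w j ^ ((1 : ℝ) / j))
    (fun i hi => by rw [(Finset.mem_filter.1 hi).2]), Finset.prod_const, Finset.compl_empty,
    ← mul_cycleCount σ hj.1, ← Real.rpow_natCast, ← Real.rpow_mul (hw _)]
  push_cast
  rw [← mul_assoc, one_div, inv_mul_cancel₀ hj0, one_mul, Real.rpow_natCast]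

end permutations

/-! ### Lower bounds for limits inferior -/

theorem le_liminf_add_ennreal (u v : ℕ → ℝ≥0∞) :
    liminf u atTop + liminf v atTop ≤ liminf (fun n => u n + v n) atTop := by
  simp only [liminf_eq_iSup_iInf_of_nat]
  rw [ENNReal.iSup_add_iSup_of_monotone]
  · refine iSup_mono fun i => le_iInf₂ fun j hj => add_le_add ?_ ?_
    · exact iInf₂_le j hj
    · exact iInf₂_le j hj
  · exact fun i j hij => biInf_mono fun k hk => hij.trans hk
  · exact fun i j hij => biInf_mono fun k hk => hij.trans hk

/-- Fatou's lemma for sums. -/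
theorem tsum_liminf_le (u : ℕ → ℕ → ℝ≥0∞) :
    ∑' l, liminf (fun N => u N l) atTop ≤ liminf (fun N => ∑' l, u N l) atTop := by
  simp only [← lintegral_count]
  exact lintegral_liminf_le fun N => measurable_from_top

/-- Lower bound for `liminf (p_N r_N)` when `p_N` converges. -/
theorem ofReal_mul_le_liminf {p r : ℕ → ℝ} {q : ℝ} {Ψ : ℝ≥0∞} {t : ℕ → ℝ≥0∞}
    (hp0 : ∀ᶠ N in atTop, 0 ≤ p N)
    (hp : Tendsto p atTop (𝓝 q)) (hr : Ψ ≤ liminf (fun N => ENNReal.ofReal (r N)) atTop)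
    (ht : ∀ᶠ N in atTop, ENNReal.ofReal (p N * r N) ≤ t N) :
    ENNReal.ofReal q * Ψ ≤ liminf t atTop := by
  have h1 : liminf (fun N => ENNReal.ofReal (p N)) atTop = ENNReal.ofReal q :=
    (ENNReal.tendsto_ofReal hp).liminf_eq
  calc ENNReal.ofReal q * Ψ ≤ liminf (fun N => ENNReal.ofReal (p N)) atTop *
        liminf (fun N => ENNReal.ofReal (r N)) atTop := by rw [h1]; gcongr
    _ ≤ liminf ((fun N => ENNReal.ofReal (p N)) * fun N => ENNReal.ofReal (r N)) atTop :=
        ENNReal.le_liminf_mul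
    _ ≤ liminf t atTop := by
        refine liminf_le_liminf ?_
        filter_upwards [ht, hp0] with N hN h0
        rw [Pi.mul_apply, ← ENNReal.ofReal_mul h0]
        exact hN

/-! ### The supercritical regime: one step of the chain -/

/-- The weights `T_j + N K_j`. -/
def mixW (T K : ℕ → ℝ) (N j : ℕ) : ℝ := T j + N * K j

/-- What is needed of the normalized weights in the supercritical case. -/
structure Supercritical (T K : ℕ → ℝ) (c θs : ℝ) : Prop where
  T_nonneg : ∀ j, 0 ≤ T j
  K_nonneg : ∀ j, 0 ≤ K j
  K_zero : K 0 = 0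
  hasSum : HasSum K c
  c_pos : 0 < c
  c_lt : c < 1
  θ_pos : 0 < θs
  T_tendsto : Tendsto T atTop (𝓝 θs)
  K_tendsto : Tendsto (fun j : ℕ => (j : ℝ) * K j) atTop (𝓝 0)
  -- The value of A is immaterial, since only ratios of coefficients occur in the step
  -- probabilities.
  coeff : ∃ A : ℝ, 0 < A ∧ ∀ (n : ℕ → ℕ) (v : ℝ), c < v →
    Tendsto (fun N => (n N : ℝ) / N) atTop (𝓝 v) →
    Tendsto (fun N : ℕ => (N : ℝ) ^ (1 - θs) * mixedCoeff T K N (n N)) atTop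
      (𝓝 (A * (v - c) ^ (θs - 1)))

namespace Supercritical

variable {T K : ℕ → ℝ} {c θs : ℝ}

theorem mixW_nonneg (D : Supercritical T K c θs) (N j : ℕ) : 0 ≤ mixW T K N j :=
  add_nonneg (D.T_nonneg j) (mul_nonneg (Nat.cast_nonneg _) (D.K_nonneg j))

theorem expCoeff_nonneg (D : Supercritical T K c θs) (N n : ℕ) :
    0 ≤ expCoeff (mixW T K N) n :=
  SurrogateSpatial.expCoeff_nonneg (fun j _ => D.mixW_nonneg N j) n

theorem eventually_expCoeff_pos (D : Supercritical T K c θs) {n : ℕ → ℕ} {v : ℝ} (hv : c < v)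
    (hn : Tendsto (fun N => (n N : ℝ) / N) atTop (𝓝 v)) :
    ∀ᶠ N in atTop, 0 < expCoeff (mixW T K N) (n N) := by
  obtain ⟨A, hA, h⟩ := D.coeff
  have hpos : 0 < A * (v - c) ^ (θs - 1) := mul_pos hA (Real.rpow_pos_of_pos (sub_pos.2 hv) _)
  filter_upwards [(h n v hv hn).eventually (lt_mem_nhds hpos)] with N hN
  refine (D.expCoeff_nonneg N (n N)).lt_of_ne' fun h0 => ?_
  have : mixedCoeff T K N (n N) = 0 := by
    unfold mixedCoeff
    rw [show (fun j => T j + N * K j) = mixW T K N from rfl, h0, mul_zero]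
  rw [this, mul_zero] at hN
  exact lt_irrefl _ hN

theorem tendsto_expCoeff_div (D : Supercritical T K c θs) {n n' : ℕ → ℕ} {v v' : ℝ} (hv : c < v)
    (hn : Tendsto (fun N => (n N : ℝ) / N) atTop (𝓝 v)) (hv' : c < v')
    (hn' : Tendsto (fun N => (n' N : ℝ) / N) atTop (𝓝 v')) :
    Tendsto (fun N => expCoeff (mixW T K N) (n' N) / expCoeff (mixW T K N) (n N)) atTop
      (𝓝 (((v' - c) / (v - c)) ^ (θs - 1))) := by
  obtain ⟨A, hA, h⟩ := D.coeff
  have hr := Real.rpow_pos_of_pos (sub_pos.2 hv) (θs - 1)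
  have := (h n' v' hv' hn').div (h n v hv hn) (mul_pos hA hr).ne'
  rw [Real.div_rpow (sub_pos.2 hv').le (sub_pos.2 hv).le]
  rw [mul_div_mul_left _ _ hA.ne'] at this
  refine this.congr' ?_
  filter_upwards [eventually_gt_atTop 0] with N hN
  have hN' : (0 : ℝ) < N := by exact_mod_cast hN
  rw [Pi.div_apply]
  unfold mixedCoeff
  rw [mul_div_mul_left _ _ (Real.rpow_pos_of_pos hN' _).ne',
    mul_div_mul_left _ _ (Real.exp_pos _).ne']
  rfl

/-- The probability that the first of `n` elements lies in a cycle of length `l`. -/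
noncomputable def stepProb (T K : ℕ → ℝ) (N n l : ℕ) : ℝ :=
  mixW T K N l * expCoeff (mixW T K N) (n - l) / (n * expCoeff (mixW T K N) n)

theorem stepProb_nonneg (D : Supercritical T K c θs) (N n l : ℕ) : 0 ≤ stepProb T K N n l :=
  div_nonneg (mul_nonneg (D.mixW_nonneg _ _) (D.expCoeff_nonneg _ _))
    (mul_nonneg (Nat.cast_nonneg _) (D.expCoeff_nonneg _ _))

theorem tendsto_natSub_div {n : ℕ → ℕ} {v : ℝ}
    (hn : Tendsto (fun N => (n N : ℝ) / N) atTop (𝓝 v)) {l : ℕ → ℕ} {b : ℝ}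
    (hl : Tendsto (fun N => (l N : ℝ) / N) atTop (𝓝 b)) (hb : b < v) :
    (∀ᶠ N in atTop, l N ≤ n N) ∧
      Tendsto (fun N => ((n N - l N : ℕ) : ℝ) / N) atTop (𝓝 (v - b)) := by
  have hle : ∀ᶠ N in atTop, l N ≤ n N := by
    filter_upwards [hl.eventually_lt hn hb, eventually_gt_atTop 0] with N hN hN0
    have hN' : (0 : ℝ) < N := by exact_mod_cast hN0
    rw [div_lt_div_iff_of_pos_right hN'] at hN
    exact_mod_cast hN.le
  refine ⟨hle, (hn.sub hl).congr' ?_⟩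
  filter_upwards [hle] with N hN
  rw [Nat.cast_sub hN, sub_div]

/-- Removing boundedly many points does not change n/N in the limit, so the coefficient ratio tends
to 1; the contribution T_l / N of the other weight vanishes. -/
theorem tendsto_stepProb_const (D : Supercritical T K c θs) {n : ℕ → ℕ} {v : ℝ} (hv : c < v)
    (hn : Tendsto (fun N => (n N : ℝ) / N) atTop (𝓝 v)) (l : ℕ) :
    Tendsto (fun N => stepProb T K N (n N) l) atTop (𝓝 (K l / v)) := by
  have hv0 : 0 < v := D.c_pos.trans hv
  have h1 := (tendsto_natSub_div (l := fun _ => l) hn (tendsto_const_div_atTop_nhds_zero_nat _) hv0).2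
  rw [sub_zero] at h1
  have h2 := D.tendsto_expCoeff_div hv hn hv h1
  rw [div_self (sub_pos.2 hv).ne', Real.one_rpow] at h2
  have h3 : Tendsto (fun N : ℕ => (T l / N + K l) / ((n N : ℝ) / N)) atTop (𝓝 ((0 + K l) / v)) :=
    ((tendsto_const_div_atTop_nhds_zero_nat _).add_const _).div hn hv0.ne'
  have h4 := h3.mul h2
  rw [zero_add, mul_one] at h4
  refine h4.congr' ?_
  filter_upwards [eventually_gt_atTop 0] with N hN
  have hN' : (N : ℝ) ≠ 0 := by positivity
  unfold stepProb mixW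
  rw [mul_div_mul_comm]
  congr 1
  field_simp

/-- At lengths of order N the roles are exchanged: N K_l = (N/l)(l K_l) tends to 0, while T_l tends
to θ*. -/
theorem tendsto_stepProb_far (D : Supercritical T K c θs) {n : ℕ → ℕ} {v : ℝ}
    (hn : Tendsto (fun N => (n N : ℝ) / N) atTop (𝓝 v)) {l : ℕ → ℕ} {y : ℝ} (hy : 0 < y)
    (hl : Tendsto (fun N => (l N : ℝ) / N) atTop (𝓝 y)) (hyv : c < v - y) :
    Tendsto (fun N => N * stepProb T K N (n N) (l N)) atTop
      (𝓝 (θs / v * ((v - y - c) / (v - c)) ^ (θs - 1))) := by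
  have hc := D.c_pos
  have hv0 : 0 < v := by linarith
  have h1 := (tendsto_natSub_div hn hl (by linarith)).2
  have h2 := D.tendsto_expCoeff_div (by linarith) hn hyv h1
  have hltop : Tendsto l atTop atTop := by
    rw [← tendsto_natCast_atTop_iff (R := ℝ)]
    refine (hl.pos_mul_atTop hy tendsto_natCast_atTop_atTop).congr' ?_
    filter_upwards [eventually_gt_atTop 0] with N hN
    have hN' : (N : ℝ) ≠ 0 := by positivity
    field_simp
  have hNK : Tendsto (fun N : ℕ => (N : ℝ) * K (l N)) atTop (𝓝 (0 / y)) := by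
    refine ((D.K_tendsto.comp hltop).div hl hy.ne').congr' ?_
    filter_upwards [eventually_gt_atTop 0, hltop.eventually_gt_atTop 0] with N hN hl0
    have hN' : (N : ℝ) ≠ 0 := by positivity
    have hl' : (l N : ℝ) ≠ 0 := by positivity
    simp only [Function.comp_apply, Pi.div_apply]
    field_simp
  have h3 := ((D.T_tendsto.comp hltop).add hNK).div hn hv0.ne'
  have h4 := h3.mul h2
  rw [zero_div, add_zero] at h4
  refine h4.congr' ?_
  filter_upwards [eventually_gt_atTop 0] with N hN
  have hN' : (N : ℝ) ≠ 0 := by positivity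
  unfold stepProb mixW
  simp only [Function.comp_apply, Pi.div_apply]
  rw [mul_div_mul_comm, ← mul_assoc]
  congr 1
  field_simp

end Supercritical

/-! ### Lower bound for the expectations by Fatou's lemma -/

/-- The integral of `f` over the first `m` steps of the stick-breaking process with `η_0 = x`. -/
noncomputable def limLex (ν θs : ℝ) : (m : ℕ) → ℝ → ((Fin m → ℝ) → ℝ) → ℝ≥0∞
  | 0, _, f => ENNReal.ofReal (f Fin.elim0)
  | m + 1, x, f =>
    ENNReal.ofReal (1 - uStar ν x) * limLex ν θs m x (fun z => f (Fin.cons 0 z)) +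
    ENNReal.ofReal (uStar ν x) * ∫⁻ b in Ioo (0 : ℝ) 1, ENNReal.ofReal (θs * (1 - b) ^ (θs - 1)) *
      limLex ν θs m (x * (1 - b)) (fun z => f (Fin.cons (x * b) z))

theorem lexSum_nonneg {w : ℕ → ℝ} (hw : ∀ j, 0 ≤ w j) (m n : ℕ) {f : (Fin m → ℕ) → ℝ}
    (hf : ∀ v, 0 ≤ f v) : 0 ≤ lexSum w m n f := by
  induction m generalizing n with
  | zero => exact mul_nonneg (expCoeff_nonneg (fun j _ => hw j) n) (hf _)
  | succ m ih =>
    rw [lexSum]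
    split_ifs
    · exact ih _ fun v => hf _
    · exact mul_nonneg (by positivity)
        (Finset.sum_nonneg fun l _ => mul_nonneg (hw l) (ih _ fun v => hf _))

/-- A sum over `l` is bounded below by the integral of the step function with the values `a t_l`
on the intervals `((l - 1) / a, l / a]`. -/
theorem lintegral_step_eq {a : ℝ} (ha : 0 < a) (s : Finset ℕ) (t : ℕ → ℝ≥0∞) :
    ∫⁻ b, ∑ l ∈ s, (Ioc (((l : ℝ) - 1) / a) (l / a)).indicator
      (fun _ => ENNReal.ofReal a * t l) b = ∑ l ∈ s, t l := by
  rw [lintegral_finsetSum _ fun l _ => measurable_const.indicator measurableSet_Ioc]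
  refine Finset.sum_congr rfl fun l _ => ?_
  rw [lintegral_indicator_const measurableSet_Ioc, Real.volume_Ioc, ← sub_div,
    show (l : ℝ) - (l - 1) = 1 by ring, mul_comm (ENNReal.ofReal a), mul_assoc,
    ← ENNReal.ofReal_mul ha.le, mul_one_div_cancel ha.ne', ENNReal.ofReal_one, mul_one]

theorem le_sum_step {a b : ℝ} (ha : 0 < a) {s : Finset ℕ} (t : ℕ → ℝ≥0∞)
    (hs : ⌈a * b⌉₊ ∈ s) (hb : 0 < b) : ENNReal.ofReal a * t ⌈a * b⌉₊ ≤
      ∑ l ∈ s, (Ioc (((l : ℝ) - 1) / a) (l / a)).indicator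
        (fun _ => ENNReal.ofReal a * t l) b := by
  have hab : 0 < a * b := mul_pos ha hb
  have hmem : b ∈ Ioc (((⌈a * b⌉₊ : ℝ) - 1) / a) (⌈a * b⌉₊ / a) := by
    constructor
    · rw [div_lt_iff₀ ha]
      have := Nat.ceil_lt_add_one hab.le
      linarith
    · rw [le_div_iff₀ ha, mul_comm]
      exact Nat.le_ceil _
  refine le_trans (le_of_eq ?_) (Finset.single_le_sum (f := fun l : ℕ =>
    (Ioc (((l : ℝ) - 1) / a) (l / a)).indicator (fun _ => ENNReal.ofReal a * t l) b)
    (fun _ _ => zero_le) hs)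
  rw [indicator_of_mem hmem]

theorem mul_cons_natCast {m : ℕ} (a : ℝ) (l : ℕ) (v : Fin m → ℕ) :
    (fun i : Fin (m + 1) => a * ((Fin.cons l v : Fin (m + 1) → ℕ) i : ℝ)) =
      Fin.cons (a * l) (fun i => a * (v i : ℝ)) := by
  ext i
  refine Fin.cases ?_ (fun i => ?_) i <;> simp

theorem uStar_one_sub {c x : ℝ} : uStar (1 - c) x = (1 - c) * x / (c + (1 - c) * x) := by
  unfold uStar
  congr 1
  ring

/-- Induction on m over the possible values of the first length. A short cycle leaves x unchanged,
one of length about νxbN replaces it by x(1 - b), and Fatou's lemma bounds each part from below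
without domination. The test function depends on N because inserting the first coordinate l/(Nν)
gives a function that varies with N; continuous convergence survives this insertion. -/
theorem Supercritical.le_liminf_lexSum {T K : ℕ → ℝ} {c θs : ℝ} (D : Supercritical T K c θs)
    (m : ℕ) {x : ℝ} (hx : 0 < x) {n : ℕ → ℕ}
    (hn : Tendsto (fun N => (n N : ℝ) / N) atTop (𝓝 (c + (1 - c) * x)))
    {F : ℕ → (Fin m → ℝ) → ℝ} {f : (Fin m → ℝ) → ℝ} (hF0 : ∀ N z, 0 ≤ F N z)
    (hF : ∀ (z : ℕ → Fin m → ℝ) (z₀ : Fin m → ℝ), Tendsto z atTop (𝓝 z₀) →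
      Tendsto (fun N => F N (z N)) atTop (𝓝 (f z₀))) :
    limLex (1 - c) θs m x f ≤ liminf (fun N : ℕ => ENNReal.ofReal
      (lexSum (mixW T K N) m (n N) (fun v => F N (fun i => 1 / ((N : ℝ) * (1 - c)) * (v i : ℝ))) /
        expCoeff (mixW T K N) (n N))) atTop := by
  have hν : 0 < 1 - c := sub_pos.2 D.c_lt
  have hc := D.c_pos
  induction m generalizing x n with
  | zero =>
    have hcv : c < c + (1 - c) * x := by have := mul_pos hν hx; linarith
    have h := hF (fun _ => Fin.elim0) Fin.elim0 tendsto_const_nhds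
    rw [limLex, ← (ENNReal.tendsto_ofReal h).liminf_eq]
    refine liminf_le_liminf ?_
    filter_upwards [D.eventually_expCoeff_pos hcv hn] with N hN
    rw [lexSum, mul_div_cancel_left₀ _ hN.ne']
    refine le_of_eq (congrArg (fun z => ENNReal.ofReal (F N z)) (Subsingleton.elim _ _))
  | succ m ih =>
    set ν := 1 - c with hνdef
    set v := c + ν * x with hvdef
    have hνx : 0 < ν * x := mul_pos hν hx
    have hcv : c < v := by linarith
    have hv0 : 0 < v := by linarith
    set G : ℕ → ℕ → ℝ := fun N l => lexSum (mixW T K N) m (n N - l)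
      (fun u => F N (fun i => 1 / ((N : ℝ) * ν) * ((Fin.cons l u : Fin (m + 1) → ℕ) i : ℝ))) with hG
    set t : ℕ → ℕ → ℝ≥0∞ := fun N l => ENNReal.ofReal
      (mixW T K N l * G N l / (n N * expCoeff (mixW T K N) (n N))) with ht
    have hG0 : ∀ N l, 0 ≤ G N l := fun N l =>
      lexSum_nonneg (D.mixW_nonneg N) _ _ fun _ => hF0 _ _
    -- the induction hypothesis
    have hrest : ∀ b : ℝ, 0 ≤ b → b < 1 → ∀ l : ℕ → ℕ,
        Tendsto (fun N => (l N : ℝ) / N) atTop (𝓝 (ν * x * b)) →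
        limLex ν θs m (x * (1 - b)) (fun z => f (Fin.cons (x * b) z)) ≤
          liminf (fun N => ENNReal.ofReal (G N (l N) / expCoeff (mixW T K N) (n N - l N))) atTop := by
      intro b hb0 hb1 l hl
      have hlt : ν * x * b < v := by nlinarith
      have h1 := (tendsto_natSub_div hn hl hlt).2
      rw [show v - ν * x * b = c + ν * (x * (1 - b)) by rw [hvdef]; ring] at h1
      have := ih (mul_pos hx (sub_pos.2 hb1)) h1
        (F := fun N z => F N (Fin.cons (1 / ((N : ℝ) * ν) * l N) z))
        (f := fun z => f (Fin.cons (x * b) z)) (fun _ _ => hF0 _ _) ?_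
      · simpa only [hG, mul_cons_natCast] using this
      · intro z z₀ hz
        refine hF _ _ (Tendsto.finCons ?_ hz)
        have h2 := hl.div_const ν
        rw [show ν * x * b / ν = x * b by field_simp] at h2
        refine h2.congr fun N => ?_
        rw [div_div, one_div, div_eq_inv_mul]
    have hn0 : ∀ᶠ N in atTop, 0 < n N := by
      filter_upwards [hn.eventually (lt_mem_nhds hv0)] with N hN
      rcases Nat.eq_zero_or_pos (n N) with h | h
      · rw [h, Nat.cast_zero, zero_div] at hN
        exact absurd hN (lt_irrefl _)
      · exact h
    have hpr : ∀ N l : ℕ, 0 < expCoeff (mixW T K N) (n N - l) →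
        stepProb T K N (n N) l * (G N l / expCoeff (mixW T K N) (n N - l)) =
          mixW T K N l * G N l / (n N * expCoeff (mixW T K N) (n N)) := by
      intro N l h
      unfold stepProb
      field_simp
    -- short cycles
    have hshort : ENNReal.ofReal (1 - uStar ν x) * limLex ν θs m x (fun z => f (Fin.cons 0 z)) ≤
        liminf (fun N => ∑ l ∈ Finset.Icc 1 (n N) with l * l ≤ N, t N l) atTop := by
      -- Each fixed l eventually satisfies l² ≤ N, so the square-root cutoff separates the bounded
      -- lengths from those of order N.
      have h1 : ∀ l, ENNReal.ofReal (K l / v) * limLex ν θs m x (fun z => f (Fin.cons 0 z)) ≤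
          liminf (fun N => if l ∈ {l ∈ Finset.Icc 1 (n N) | l * l ≤ N} then t N l else 0)
            atTop := by
        intro l
        rcases Nat.eq_zero_or_pos l with rfl | hl
        · simp [D.K_zero]
        have hl0 : Tendsto (fun N : ℕ => (l : ℝ) / N) atTop (𝓝 (ν * x * 0)) := by
          rw [mul_zero]
          exact tendsto_const_div_atTop_nhds_zero_nat _
        have h2 := hrest 0 le_rfl one_pos (fun _ => l) hl0
        simp only [sub_zero, mul_one, mul_zero] at h2
        have h3 := tendsto_natSub_div (l := fun _ => l) hn hl0 (by rw [mul_zero]; exact hv0)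
        rw [mul_zero, sub_zero] at h3
        refine ofReal_mul_le_liminf (Eventually.of_forall fun N => D.stepProb_nonneg N (n N) l)
          (D.tendsto_stepProb_const hcv hn l) h2 ?_
        filter_upwards [h3.1, D.eventually_expCoeff_pos hcv h3.2, eventually_ge_atTop (l * l)]
          with N hN1 hN2 hN3
        rw [if_pos (Finset.mem_filter.2 ⟨Finset.mem_Icc.2 ⟨hl, hN1⟩, hN3⟩), hpr N l hN2]
      -- The total mass of the short lengths is c/v, and v = c + νx.
      have h4 : ∑' l, ENNReal.ofReal (K l / v) = ENNReal.ofReal (1 - uStar ν x) := by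
        rw [← ENNReal.ofReal_tsum_of_nonneg (fun l => div_nonneg (D.K_nonneg l) hv0.le)
          (D.hasSum.div_const v).summable, (D.hasSum.div_const v).tsum_eq]
        congr 1
        rw [hνdef, uStar_one_sub, ← hνdef, ← hvdef, eq_sub_iff_add_eq, ← add_div, ← hvdef,
          div_self hv0.ne']
      rw [← h4, ← ENNReal.tsum_mul_right]
      refine (ENNReal.tsum_le_tsum h1).trans ((tsum_liminf_le _).trans (le_of_eq ?_))
      congr 1
      ext N
      rw [tsum_eq_sum (s := {l ∈ Finset.Icc 1 (n N) | l * l ≤ N}) fun l hl => if_neg hl]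
      exact Finset.sum_congr rfl fun l hl => if_pos hl
    -- long cycles
    have hlong : ENNReal.ofReal (uStar ν x) * ∫⁻ b in Ioo (0 : ℝ) 1,
        ENNReal.ofReal (θs * (1 - b) ^ (θs - 1)) *
          limLex ν θs m (x * (1 - b)) (fun z => f (Fin.cons (x * b) z)) ≤
        liminf (fun N => ∑ l ∈ Finset.Icc 1 (n N) with ¬ l * l ≤ N, t N l) atTop := by
      -- The sum over long lengths becomes the integral of a step function of b = l/(νxN), so that
      -- Fatou's lemma for Lebesgue measure applies.
      set φ : ℕ → ℝ → ℝ≥0∞ := fun N b => ∑ l ∈ Finset.Icc 1 (n N) with ¬ l * l ≤ N,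
        (Ioc (((l : ℝ) - 1) / (ν * x * N)) (l / (ν * x * N))).indicator
          (fun _ => ENNReal.ofReal (ν * x * N) * t N l) b with hφ
      have hφm : ∀ N, Measurable (φ N) := fun N =>
        Finset.measurable_fun_sum _ fun l _ => measurable_const.indicator measurableSet_Ioc
      rw [← lintegral_const_mul' _ _ ENNReal.ofReal_ne_top]
      calc _ ≤ ∫⁻ b in Ioo (0 : ℝ) 1, liminf (fun N => φ N b) atTop := by
            refine setLIntegral_mono' measurableSet_Ioo fun b hb => ?_
            have hνxb : 0 < ν * x * b := mul_pos hνx hb.1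
            set l : ℕ → ℕ := fun N => ⌈ν * x * N * b⌉₊ with hldef
            have hl : Tendsto (fun N => (l N : ℝ) / N) atTop (𝓝 (ν * x * b)) := by
              refine ((tendsto_nat_ceil_mul_div_atTop hνxb.le).comp
                tendsto_natCast_atTop_atTop).congr fun N => ?_
              simp only [Function.comp_apply, hldef]
              rw [show ν * x * b * (N : ℝ) = ν * x * N * b by ring]
            have hlt : ν * x * b < v := by nlinarith [hb.2]
            have hvb : c < v - ν * x * b := by
              have := mul_pos hνx (sub_pos.2 hb.2)
              linarith
            have h3 := tendsto_natSub_div hn hl hlt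
            have hp := (D.tendsto_stepProb_far hn hνxb hl hvb).const_mul (ν * x)
            -- Since v - c = νx, the coefficient ratio is a power of 1 - b, and νx/v = u*(x).
            have hlim : ν * x * (θs / v * ((v - ν * x * b - c) / (v - c)) ^ (θs - 1)) =
                uStar ν x * (θs * (1 - b) ^ (θs - 1)) := by
              rw [show (v - ν * x * b - c) / (v - c) = 1 - b by
                rw [hvdef]; field_simp; ring]
              rw [hνdef, uStar_one_sub, ← hνdef, ← hvdef]
              field_simp
            rw [hlim] at hp
            have hu0 : 0 ≤ uStar ν x := by
              rw [hνdef, uStar_one_sub, ← hνdef, ← hvdef]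
              positivity
            rw [← mul_assoc, ← ENNReal.ofReal_mul hu0]
            refine ofReal_mul_le_liminf (Eventually.of_forall fun N => mul_nonneg hνx.le
              (mul_nonneg (Nat.cast_nonneg _) (D.stepProb_nonneg N (n N) (l N)))) hp
              (hrest b hb.1.le hb.2 l hl) ?_
            -- A length of order bN with b > 0 eventually exceeds the square root of N.
            have hbig : ∀ᶠ N : ℕ in atTop, 1 ≤ l N ∧ ¬ l N * l N ≤ N := by
              filter_upwards [eventually_gt_atTop 0, tendsto_natCast_atTop_atTop.eventually_gt_atTop
                (1 / (ν * x * b) ^ 2)] with N hN hN'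
              have hN0 : (0 : ℝ) < N := by exact_mod_cast hN
              have hle : ν * x * b * N ≤ l N := by
                rw [show ν * x * b * (N : ℝ) = ν * x * N * b by ring]
                exact Nat.le_ceil _
              have hpos : 0 < ν * x * b * N := mul_pos hνxb hN0
              constructor
              · exact_mod_cast hpos.trans_le hle
              · intro hcon
                have hcon' : (l N : ℝ) * l N ≤ N := by exact_mod_cast hcon
                have h5 : ν * x * b * N * (ν * x * b * N) ≤ N :=
                  (mul_le_mul hle hle hpos.le (hpos.le.trans hle)).trans hcon'
                rw [div_lt_iff₀ (by positivity)] at hN'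
                nlinarith
            filter_upwards [h3.1, D.eventually_expCoeff_pos hvb h3.2, hbig,
              eventually_gt_atTop 0] with N hN1 hN2 hN3 hN4
            have hN0 : (0 : ℝ) < N := by exact_mod_cast hN4
            have ha : 0 < ν * x * N := mul_pos hνx hN0
            refine le_trans (le_of_eq ?_) (le_sum_step ha (t N)
              (Finset.mem_filter.2 ⟨Finset.mem_Icc.2 ⟨hN3.1, hN1⟩, hN3.2⟩) hb.1)
            rw [ht]
            dsimp only
            rw [← ENNReal.ofReal_mul ha.le, ← hpr N _ hN2]
            congr 1
            ring
        _ ≤ liminf (fun N => ∫⁻ b in Ioo (0 : ℝ) 1, φ N b) atTop := lintegral_liminf_le hφm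
        _ ≤ _ := by
            refine liminf_le_liminf ?_
            filter_upwards [eventually_gt_atTop 0] with N hN
            have hN0 : (0 : ℝ) < N := by exact_mod_cast hN
            exact (setLIntegral_le_lintegral _ _).trans
              (lintegral_step_eq (mul_pos hνx hN0) _ _).le
    rw [limLex]
    refine (add_le_add hshort hlong).trans ((le_liminf_add_ennreal _ _).trans
      (liminf_le_liminf ?_))
    filter_upwards [hn0, D.eventually_expCoeff_pos hcv hn] with N hN1 hN2
    rw [Finset.sum_filter_add_sum_filter_not, lexSum, if_neg hN1.ne', ht,
      ← ENNReal.ofReal_sum_of_nonneg]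
    · refine le_of_eq (congrArg _ ?_)
      rw [← Finset.sum_div, one_div, inv_mul_eq_div, div_div]
    · intro l _
      exact div_nonneg (mul_nonneg (D.mixW_nonneg _ _) (hG0 _ _))
        (mul_nonneg (Nat.cast_nonneg _) hN2.le)

/-! ### The law of the stick-breaking process -/

theorem betaMeasure_one {θs : ℝ} (hθ : 0 < θs) : betaMeasure 1 θs =
    (volume.restrict (Ioo (0 : ℝ) 1)).withDensity
      (fun b => ENNReal.ofReal (θs * (1 - b) ^ (θs - 1))) := by
  rw [betaMeasure, ← withDensity_indicator measurableSet_Ioo]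
  congr 1
  ext b
  by_cases hb : b ∈ Ioo (0 : ℝ) 1
  · rw [indicator_of_mem hb, betaPDF_of_pos_lt_one hb.1 hb.2]
    congr 2
    unfold beta
    rw [sub_self, Real.rpow_zero, mul_one, Real.Gamma_one, one_mul, add_comm 1 θs,
      Real.Gamma_add_one hθ.ne']
    have := (Real.Gamma_pos_of_pos hθ).ne'
    field_simp
  · rw [indicator_of_notMem hb, betaPDF_eq, if_neg (show ¬ (0 < b ∧ b < 1) from hb),
      ENNReal.ofReal_zero]

theorem lintegral_betaMeasure_one {θs : ℝ} (hθ : 0 < θs) {f : ℝ → ℝ≥0∞} (hf : Measurable f) :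
    ∫⁻ b, f b ∂(betaMeasure 1 θs) =
      ∫⁻ b in Ioo (0 : ℝ) 1, ENNReal.ofReal (θs * (1 - b) ^ (θs - 1)) * f b := by
  rw [betaMeasure_one hθ, lintegral_withDensity_eq_lintegral_mul _ (by fun_prop) hf]
  rfl

instance isProbabilityMeasure_volume_Icc :
    IsProbabilityMeasure (volume.restrict (Icc (0 : ℝ) 1)) := ⟨by simp⟩

/-- The lengths of the first `m` sticks for given driving variables, from the length `x` on. -/
noncomputable def stickVec (ν : ℝ) : (m : ℕ) → ℝ → (Fin m → ℝ × ℝ) → (Fin m → ℝ)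
  | 0, _, _ => Fin.elim0
  | m + 1, x, p => Fin.cons (x * stickD ν x (p 0).1 (p 0).2)
      (stickVec ν m (x * (1 - stickD ν x (p 0).1 (p 0).2)) (fun i => p i.succ))

theorem stickVec_stickEta (ν : ℝ) (u b : ℕ → ℝ) (m k : ℕ) :
    stickVec ν m (stickEta ν u b k) (fun i => (u (k + i), b (k + i))) =
      fun i : Fin m => stickX ν u b (k + i) := by
  induction m generalizing k with
  | zero => exact Subsingleton.elim _ _
  | succ m ih =>
    ext i
    refine Fin.cases ?_ (fun i => ?_) i
    · rfl
    · have := congrFun (ih (k + 1)) i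
      simp only [stickVec, Fin.cons_succ, Fin.val_succ, Fin.val_zero, add_zero]
      simp only [add_assoc, add_comm 1] at this
      exact this

theorem measurable_stickD (ν : ℝ) {α : Type*} [MeasurableSpace α] {x u b : α → ℝ}
    (hx : Measurable x) (hu : Measurable u) (hb : Measurable b) :
    Measurable fun a => stickD ν (x a) (u a) (b a) := by
  unfold stickD uStar
  refine Measurable.mul (Measurable.ite ?_ measurable_const measurable_const) hb
  exact measurableSet_le hu (by fun_prop)

theorem measurable_stickVec (ν : ℝ) (m : ℕ) {α : Type*} [MeasurableSpace α] {x : α → ℝ}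
    {p : α → Fin m → ℝ × ℝ} (hx : Measurable x) (hp : Measurable p) :
    Measurable fun a => stickVec ν m (x a) (p a) := by
  induction m generalizing x with
  | zero => exact measurable_const
  | succ m ih =>
    have hp' : ∀ i, Measurable fun a => p a i := fun i => (measurable_pi_apply i).comp hp
    have hD := measurable_stickD ν hx (hp' 0).fst (hp' 0).snd
    refine measurable_pi_iff.2 fun i => Fin.cases ?_ (fun i => ?_) i
    · simp only [stickVec, Fin.cons_zero]
      exact hx.mul hD
    · simp only [stickVec, Fin.cons_succ]
      exact (measurable_pi_apply i).comp (ih (hx.mul (measurable_const.sub hD))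
        (measurable_pi_iff.2 fun i => hp' _))

theorem lintegral_Icc_ite {s : ℝ} (hs0 : 0 ≤ s) (hs1 : s ≤ 1) (A C : ℝ≥0∞) :
    ∫⁻ u in Icc (0 : ℝ) 1, (if u ≤ s then A else C) =
      ENNReal.ofReal (1 - s) * C + ENNReal.ofReal s * A := by
  rw [← lintegral_add_compl _ (measurableSet_Iic (a := s)),
    setLIntegral_congr_fun (g := fun _ => A) measurableSet_Iic
      fun u (hu : u ≤ s) => if_pos hu,
    setLIntegral_congr_fun (g := fun _ => C) measurableSet_Iic.compl
      fun u (hu : ¬ u ≤ s) => if_neg hu, setLIntegral_const, setLIntegral_const,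
    Measure.restrict_apply measurableSet_Iic, Measure.restrict_apply measurableSet_Iic.compl,
    compl_Iic, show Iic s ∩ Icc 0 1 = Icc 0 s by
      ext u; simp only [mem_inter_iff, mem_Iic, mem_Icc]; constructor <;> intro h <;>
        refine ⟨?_, ?_⟩ <;> try constructor
      all_goals linarith [h.1, h.2],
    show Ioi s ∩ Icc 0 1 = Ioc s 1 by
      ext u; simp only [mem_inter_iff, mem_Ioi, mem_Icc, mem_Ioc]; constructor
      · exact fun h => ⟨h.1, h.2.2⟩
      · exact fun h => ⟨h.1, (hs0.trans_lt h.1).le, h.2⟩,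
    Real.volume_Icc, Real.volume_Ioc, sub_zero, add_comm, mul_comm C, mul_comm A]

theorem uStar_mem {ν x : ℝ} (hν0 : 0 < ν) (hν1 : ν < 1) (hx : 0 < x) :
    0 ≤ uStar ν x ∧ uStar ν x ≤ 1 := by
  have h1 : 0 < ν * x := mul_pos hν0 hx
  unfold uStar
  refine ⟨div_nonneg h1.le (by linarith), (div_le_one (by linarith)).2 (by linarith)⟩

/-- Conditioning on the first driving pair: D is 0 with probability 1 - u*(x) and otherwise an
independent Beta variable, which is the recursion of `limLex`. The starting length is kept general
for the induction. -/
theorem lintegral_stickVec {ν θs : ℝ} (hν0 : 0 < ν) (hν1 : ν < 1) (hθ : 0 < θs) (m : ℕ) {x : ℝ}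
    (hx : 0 < x) {f : (Fin m → ℝ) → ℝ} (hf : Measurable f) :
    ∫⁻ p, ENNReal.ofReal (f (stickVec ν m x p))
      ∂(Measure.pi fun _ : Fin m => (volume.restrict (Icc (0 : ℝ) 1)).prod (betaMeasure 1 θs)) =
      limLex ν θs m x f := by
  have := isProbabilityMeasureBeta one_pos hθ
  induction m generalizing x with
  | zero => simp [limLex, stickVec]
  | succ m ih =>
    set μ := (volume.restrict (Icc (0 : ℝ) 1)).prod (betaMeasure 1 θs) with hμ
    set H : ℝ → ℝ≥0∞ := fun d => ∫⁻ q, ENNReal.ofReal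
      (f (Fin.cons (x * d) (stickVec ν m (x * (1 - d)) q))) ∂(Measure.pi fun _ : Fin m => μ) with hH
    have hcons : ∀ {y : ℝ}, Measurable fun z : Fin m → ℝ => (Fin.cons y z : Fin (m + 1) → ℝ) :=
      fun {y} => (continuous_const.finCons continuous_id).measurable
    have hHm : Measurable H := by
      refine Measurable.lintegral_prod_right' (f := fun a : ℝ × (Fin m → ℝ × ℝ) => ENNReal.ofReal
        (f (Fin.cons (x * a.1) (stickVec ν m (x * (1 - a.1)) a.2)))) ?_
      refine (hf.comp (measurable_pi_iff.2 fun i => Fin.cases ?_ (fun i => ?_) i)).ennreal_ofReal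
      · simp only [Fin.cons_zero]
        fun_prop
      · simp only [Fin.cons_succ]
        exact (measurable_pi_apply i).comp (measurable_stickVec ν m (by fun_prop) measurable_snd)
    have hmp := (measurePreserving_piFinSuccAbove (fun _ : Fin (m + 1) => μ) 0).symm
    have hGm : Measurable fun p => ENNReal.ofReal (f (stickVec ν (m + 1) x p)) :=
      (hf.comp (measurable_stickVec ν (m + 1) measurable_const measurable_id)).ennreal_ofReal
    have hD : Measurable fun q : ℝ × ℝ => stickD ν x q.1 q.2 :=
      measurable_stickD ν measurable_const measurable_fst measurable_snd
    have h0 : H 0 = limLex ν θs m x (fun z => f (Fin.cons 0 z)) := by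
      rw [← ih hx (f := fun z => f (Fin.cons 0 z)) (hf.comp hcons), hH]
      simp only [mul_zero, sub_zero, mul_one]
    have h1 : ∀ b ∈ Ioo (0 : ℝ) 1, H b =
        limLex ν θs m (x * (1 - b)) (fun z => f (Fin.cons (x * b) z)) := by
      intro b hb
      rw [← ih (mul_pos hx (sub_pos.2 hb.2)) (f := fun z => f (Fin.cons (x * b) z))
        (hf.comp hcons)]
    rw [← hmp.lintegral_comp hGm]
    refine (lintegral_prod _ (hGm.comp hmp.measurable).aemeasurable).trans ?_
    have hstep : ∀ q : ℝ × ℝ, ∫⁻ y, ENNReal.ofReal (f (stickVec ν (m + 1) x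
        ((MeasurableEquiv.piFinSuccAbove (fun _ => ℝ × ℝ) 0).symm (q, y))))
          ∂(Measure.pi fun _ : Fin m => μ) = H (stickD ν x q.1 q.2) := by
      intro q
      rfl
    refine (lintegral_congr hstep).trans ?_
    refine (lintegral_prod _ (hHm.comp hD).aemeasurable).trans ?_
    -- For fixed u the indicator is constant in b, so D is either b throughout or 0 throughout.
    have hu : ∀ u, ∫⁻ b, H (stickD ν x u b) ∂(betaMeasure 1 θs) =
        if u ≤ uStar ν x then ∫⁻ b, H b ∂(betaMeasure 1 θs) else H 0 := by
      intro u
      unfold stickD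
      split_ifs
      · simp
      · simp
    obtain ⟨hs0, hs1⟩ := uStar_mem hν0 hν1 hx
    refine (lintegral_congr hu).trans ?_
    rw [lintegral_Icc_ite hs0 hs1, lintegral_betaMeasure_one hθ hHm, h0, limLex]
    congr 2
    exact setLIntegral_congr_fun measurableSet_Ioo fun b hb => by
      rw [h1 b hb]

/-- The joint law of the first m variables of both kinds is a product over a disjoint union, which
is regrouped into a product of pairs. -/
theorem map_driving_eq {Ω : Type*} [MeasurableSpace Ω] {P : Measure Ω} [IsProbabilityMeasure P]
    {U B : ℕ → Ω → ℝ} {θs : ℝ} (hθ : 0 < θs)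
    (hU : ∀ n, HasLaw (U n) (volume.restrict (Icc (0 : ℝ) 1)) P)
    (hB : ∀ n, HasLaw (B n) (betaMeasure 1 θs) P) (hindep : iIndepFun (Sum.elim U B) P) (m : ℕ) :
    P.map (fun ω (i : Fin m) => (U i ω, B i ω)) =
      Measure.pi fun _ : Fin m => (volume.restrict (Icc (0 : ℝ) 1)).prod (betaMeasure 1 θs) := by
  have := isProbabilityMeasureBeta one_pos hθ
  set g : Fin m ⊕ Fin m → ℕ ⊕ ℕ := Sum.map (fun i => (i : ℕ)) (fun i => (i : ℕ)) with hg
  have hginj : Function.Injective g := Sum.map_injective.2 ⟨Fin.val_injective, Fin.val_injective⟩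
  have hae : ∀ i, AEMeasurable (Sum.elim U B (g i)) P := by
    rintro (i | i)
    · exact (hU i).aemeasurable
    · exact (hB i).aemeasurable
  have h1 := (hindep.precomp hginj).map_fun_eq_pi_map hae
  set law : Fin m ⊕ Fin m → Measure ℝ :=
    Sum.elim (fun _ => volume.restrict (Icc (0 : ℝ) 1)) (fun _ => betaMeasure 1 θs) with hlaw
  have h2 : (fun i => P.map (Sum.elim U B (g i))) = law := by
    ext1 i
    rcases i with i | i
    · exact (hU i).map_eq
    · exact (hB i).map_eq
  have : ∀ i, SigmaFinite (law i) := by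
    rintro (i | i)
    · exact inferInstanceAs (SigmaFinite (volume.restrict (Icc (0 : ℝ) 1)))
    · exact inferInstanceAs (SigmaFinite (betaMeasure 1 θs))
  have h3 := (measurePreserving_sumPiEquivProdPi law).trans
    (measurePreserving_arrowProdEquivProdArrow ℝ ℝ (Fin m)
      (fun _ => volume.restrict (Icc (0 : ℝ) 1)) (fun _ => betaMeasure 1 θs)).symm
  rw [← h3.map_eq, ← h2, ← h1, AEMeasurable.map_map_of_aemeasurable]
  · rfl
  · exact h3.measurable.aemeasurable
  · exact aemeasurable_pi_lambda _ hae

theorem stickX_eq_stickVec (ν : ℝ) (u b : ℕ → ℝ) (m : ℕ) :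
    (fun i : Fin m => stickX ν u b i) = stickVec ν m 1 (fun i => (u i, b i)) := by
  have := stickVec_stickEta ν u b m 0
  simp only [zero_add] at this
  exact this.symm

theorem aemeasurable_stickX {Ω : Type*} [MeasurableSpace Ω] {P : Measure Ω} {U B : ℕ → Ω → ℝ}
    (hU : ∀ n, AEMeasurable (U n) P) (hB : ∀ n, AEMeasurable (B n) P) (ν : ℝ) (m : ℕ) :
    AEMeasurable (fun ω (i : Fin m) => stickX ν (fun n => U n ω) (fun n => B n ω) i) P := by
  have h := (measurable_stickVec ν m (x := fun _ => 1) measurable_const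
    measurable_id).comp_aemeasurable
      (aemeasurable_pi_lambda _ fun i : Fin m => (hU i).prodMk (hB i))
  exact h.congr (Eventually.of_forall fun ω =>
    (stickX_eq_stickVec ν (fun n => U n ω) (fun n => B n ω) m).symm)

theorem lintegral_stickX {Ω : Type*} [MeasurableSpace Ω] {P : Measure Ω} [IsProbabilityMeasure P]
    {U B : ℕ → Ω → ℝ} {ν θs : ℝ} (hν0 : 0 < ν) (hν1 : ν < 1) (hθ : 0 < θs)
    (hU : ∀ n, HasLaw (U n) (volume.restrict (Icc (0 : ℝ) 1)) P)
    (hB : ∀ n, HasLaw (B n) (betaMeasure 1 θs) P) (hindep : iIndepFun (Sum.elim U B) P) (m : ℕ)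
    {f : (Fin m → ℝ) → ℝ} (hf : Measurable f) :
    ∫⁻ ω, ENNReal.ofReal (f fun i => stickX ν (fun n => U n ω) (fun n => B n ω) i) ∂P =
      limLex ν θs m 1 f := by
  rw [← lintegral_stickVec hν0 hν1 hθ m one_pos hf, ← map_driving_eq hθ hU hB hindep m,
    lintegral_map']
  · exact lintegral_congr fun ω => by rw [stickX_eq_stickVec]
  · exact (hf.comp (measurable_stickVec ν m measurable_const
      measurable_id)).ennreal_ofReal.aemeasurable
  · exact aemeasurable_pi_lambda _ fun i => (hU i).aemeasurable.prodMk (hB i).aemeasurable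

/-- The law of the first stick. -/
theorem map_stickX_zero {Ω : Type*} [MeasurableSpace Ω] {P : Measure Ω} [IsProbabilityMeasure P]
    {U B : ℕ → Ω → ℝ} {ν θs : ℝ} (hν0 : 0 < ν) (hν1 : ν < 1) (hθ : 0 < θs)
    (hU : ∀ n, HasLaw (U n) (volume.restrict (Icc (0 : ℝ) 1)) P)
    (hB : ∀ n, HasLaw (B n) (betaMeasure 1 θs) P) (hindep : iIndepFun (Sum.elim U B) P) :
    P.map (fun ω => stickX ν (fun n => U n ω) (fun n => B n ω) 0) =
      ENNReal.ofReal (1 - ν) • Measure.dirac (0 : ℝ) +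
        (volume.restrict (Ioo (0 : ℝ) 1)).withDensity
          (fun x => ENNReal.ofReal (ν * θs * (1 - x) ^ (θs - 1))) := by
  have hae := aemeasurable_stickX (fun n => (hU n).aemeasurable) (fun n => (hB n).aemeasurable) ν 1
  have hae0 : AEMeasurable (fun ω => stickX ν (fun n => U n ω) (fun n => B n ω) 0) P :=
    (measurable_pi_apply (0 : Fin 1)).comp_aemeasurable hae
  have hu1 : uStar ν 1 = ν := by unfold uStar; rw [mul_one, sub_add_cancel, div_one]
  ext s hs
  -- Applied to the indicator of s, the recursion for m = 1 and x = 1 displays the atom and the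
  -- density; there u*(1) = ν.
  have hfm : Measurable fun z : Fin 1 → ℝ => s.indicator (fun _ => (1 : ℝ)) (z 0) :=
    (measurable_const.indicator hs).comp (measurable_pi_apply 0)
  have h1 := lintegral_stickX hν0 hν1 hθ hU hB hindep 1 hfm
  have hind : ∀ y : ℝ, ENNReal.ofReal (s.indicator (fun _ => (1 : ℝ)) y) =
      s.indicator (fun _ => (1 : ℝ≥0∞)) y := by
    intro y
    by_cases hy : y ∈ s <;> simp [hy]
  simp only [limLex, hu1, Fin.cons_zero, one_mul, hind, Fin.val_zero] at h1
  rw [← lintegral_map' (f := s.indicator fun _ => (1 : ℝ≥0∞))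
    (measurable_const.indicator hs).aemeasurable hae0, lintegral_indicator_const hs, one_mul] at h1
  rw [h1, Measure.add_apply, Measure.smul_apply, smul_eq_mul, Measure.dirac_apply' _ hs]
  congr 1
  rw [withDensity_apply _ hs, ← lintegral_indicator hs, ← lintegral_const_mul' _ _
    ENNReal.ofReal_ne_top]
  refine lintegral_congr fun y => ?_
  by_cases hy : y ∈ s
  · rw [indicator_of_mem hy, indicator_of_mem hy, mul_one, ← ENNReal.ofReal_mul hν0.le, mul_assoc]
  · rw [indicator_of_notMem hy, indicator_of_notMem hy, mul_zero, mul_zero]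

/-! ### The supercritical conditions for the rescaled weights -/

/-- Some κ_j > 0 gives c > 0; s > 1 gives j K_j → 0; d > 0 makes the deviations of T_j from θ* tend
to 0 and summable against 1/j, as the coefficient asymptotics require. -/
theorem supercritical_scaled {θ κ : ℕ → ℝ≥0} {R s C c θs : ℝ} (hR : 0 < R) (hs : 1 < s)
    (hC0 : 0 ≤ C) (hC : ∀ j, 1 ≤ j → scaled κ R j ≤ C * (j : ℝ) ^ (-s))
    (hsum : HasSum (scaled κ R) c) (hκ : ∃ j, 1 ≤ j ∧ 0 < κ j) (hc : c < 1) (hθs : 0 < θs)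
    {d C' : ℝ} (hd : 0 < d)
    (hC' : ∀ j, 1 ≤ j → |scaled θ R j - θs| ≤ C' * (j : ℝ) ^ (-d)) :
    Supercritical (scaled θ R) (scaled κ R) c θs := by
  have hKnn : ∀ j, 0 ≤ scaled κ R j := fun j => scaled_nonneg hR j
  have hTnn : ∀ j, 0 ≤ scaled θ R j := fun j => scaled_nonneg hR j
  have hK0 : scaled κ R 0 = 0 := if_pos rfl
  have hcpos : 0 < c := by
    obtain ⟨j, hj, hκj⟩ := hκ
    refine lt_of_lt_of_le ?_ (le_hasSum hsum j fun i _ => hKnn i)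
    rw [scaled, if_neg (by omega)]
    have : (0 : ℝ) < κ j := hκj
    positivity
  set ε : ℕ → ℝ := fun j => scaled θ R j - θs with hε
  have hε0 : Tendsto ε atTop (𝓝 0) := by
    have h1 : Tendsto (fun j : ℕ => C' * (j : ℝ) ^ (-d)) atTop (𝓝 0) := by
      simpa using ((tendsto_rpow_neg_atTop hd).comp tendsto_natCast_atTop_atTop).const_mul C'
    refine squeeze_zero_norm' ?_ h1
    filter_upwards [eventually_ge_atTop 1] with j hj
    exact hC' j hj
  have hεsum : Summable fun j => |ε j| / j := by
    rw [← summable_nat_add_iff 1]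
    have h1 : Summable fun j : ℕ => C' * ((j + 1 : ℕ) : ℝ) ^ (-d - 1) :=
      ((summable_nat_add_iff 1).2 (Real.summable_nat_rpow.2 (by linarith))).mul_left C'
    refine Summable.of_nonneg_of_le (fun j => by positivity) (fun j => ?_) h1
    have hj : (0 : ℝ) < ((j + 1 : ℕ) : ℝ) := by positivity
    rw [Real.rpow_sub_one hj.ne', ← mul_div_assoc]
    exact div_le_div_of_nonneg_right (hC' _ (by omega)) hj.le
  have hT : (fun j => θs + ε j) = scaled θ R := by
    ext j
    simp [hε]
  refine ⟨hTnn, hKnn, hK0, hsum, hcpos, hc, hθs, ?_, ?_, ?_⟩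
  · simpa [hε] using hε0.add_const θs
  · have h1 : Tendsto (fun j : ℕ => C * (j : ℝ) ^ (-(s - 1))) atTop (𝓝 0) := by
      simpa using ((tendsto_rpow_neg_atTop (sub_pos.2 hs)).comp
        tendsto_natCast_atTop_atTop).const_mul C
    refine squeeze_zero' (Eventually.of_forall fun j => mul_nonneg (Nat.cast_nonneg _) (hKnn j))
      ?_ h1
    filter_upwards [eventually_ge_atTop 1] with j hj
    have hj' : (0 : ℝ) < j := by exact_mod_cast hj
    calc (j : ℝ) * scaled κ R j ≤ j * (C * (j : ℝ) ^ (-s)) :=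
          mul_le_mul_of_nonneg_left (hC j hj) hj'.le
      _ = C * (j : ℝ) ^ (-(s - 1)) := by
          rw [show -(s - 1) = -s + 1 by ring, Real.rpow_add_one hj'.ne']
          ring
  · refine ⟨(Real.Gamma θs)⁻¹ * Real.exp (∑' j, ε j / j), by
      have := Real.Gamma_pos_of_pos hθs
      positivity, fun n v hv hn => ?_⟩
    have := tendsto_rpow_mul_mixedCoeff hKnn hsum hK0 hcpos.le hs hC0 hC hθs hε0 hεsum
      (fun j _ => by rw [show θs + ε j = scaled θ R j from congrFun hT j]; exact hTnn j) hv hn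
    rwa [hT] at this

/-! ### Expectations under the permutation measure and weak convergence -/

section expectation

variable {θ κ : ℕ → ℝ≥0} {R : ℝ}

/-- Each point of a cycle of length l receives the factor (R^l)^(1/l) = R, so the rescaling
contributes R^N whatever the cycle structure; it cancels on normalization. -/
theorem elemWeight_mixW (hR : 0 < R) (N : ℕ) (σ : Equiv.Perm (Fin N)) :
    elemWeight (mixW (scaled θ R) (scaled κ R) N) ∅ σ = (weight θ κ N σ : ℝ) * R ^ N := by
  set w : ℕ → ℝ := fun j => (θ j : ℝ) + N * κ j with hw
  have hw0 : ∀ j, 0 ≤ w j := fun j => by positivity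
  have h1 : (weight θ κ N σ : ℝ) = elemWeight w ∅ σ := by
    rw [elemWeight_empty hw0, weight]
    push_cast
    rfl
  rw [h1]
  unfold elemWeight
  have h2 : R ^ N = ∏ _i ∈ (∅ : Finset (Fin N))ᶜ, R := by simp
  rw [h2, ← Finset.prod_mul_distrib]
  refine Finset.prod_congr rfl fun i _ => ?_
  have hl : (cycleSet σ i).card ≠ 0 := (Finset.card_pos.2 ⟨i, self_mem_cycleSet σ i⟩).ne'
  set l := (cycleSet σ i).card
  have h3 : mixW (scaled θ R) (scaled κ R) N l = w l * R ^ l := by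
    simp only [mixW, scaled, if_neg hl, hw]
    ring
  rw [h3, Real.mul_rpow (hw0 l) (by positivity), one_div, Real.pow_rpow_inv_natCast hR.le hl]

theorem mixW_scaled_nonneg (hR : 0 < R) (N j : ℕ) :
    0 ≤ mixW (scaled θ R) (scaled κ R) N j :=
  add_nonneg (scaled_nonneg hR j) (mul_nonneg (Nat.cast_nonneg _) (scaled_nonneg hR j))

theorem permFixing_empty (N : ℕ) : permFixing (∅ : Finset (Fin N)) = Finset.univ := by
  ext
  simp [mem_permFixing]

theorem sum_weight_mul_pow (hR : 0 < R) (N : ℕ) :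
    (∑ σ : Equiv.Perm (Fin N), (weight θ κ N σ : ℝ)) * R ^ N =
      N.factorial * expCoeff (mixW (scaled θ R) (scaled κ R) N) N := by
  have := sum_elemWeight (mixW_scaled_nonneg (θ := θ) (κ := κ) hR N) (∅ : Finset (Fin N))
  rw [permFixing_empty, Finset.compl_empty, Finset.card_univ, Fintype.card_fin] at this
  rw [← this, Finset.sum_mul]
  exact Finset.sum_congr rfl fun σ _ => (elemWeight_mixW hR N σ).symm

theorem normConst_pos (hR : 0 < R) {N : ℕ}
    (hN : 0 < expCoeff (mixW (scaled θ R) (scaled κ R) N) N) : 0 < normConst θ κ N := by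
  refine pos_iff_ne_zero.2 fun h => ?_
  unfold normConst at h
  rw [div_eq_zero_iff, or_iff_left (by exact_mod_cast N.factorial_ne_zero)] at h
  have h1 := sum_weight_mul_pow (θ := θ) (κ := κ) hR N
  have h2 : (∑ σ : Equiv.Perm (Fin N), (weight θ κ N σ : ℝ)) = 0 := by exact_mod_cast h
  rw [h2, zero_mul] at h1
  have : (0 : ℝ) < N.factorial := by exact_mod_cast N.factorial_pos
  exact (mul_pos this hN).ne h1

theorem integral_surrogateMeasure (hR : 0 < R) {N : ℕ}
    (hN : 0 < expCoeff (mixW (scaled θ R) (scaled κ R) N) N) (g : Equiv.Perm (Fin N) → ℝ) :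
    ∫ σ, g σ ∂(surrogateMeasure θ κ N) =
      (∑ σ, elemWeight (mixW (scaled θ R) (scaled κ R) N) ∅ σ * g σ) /
        (N.factorial * expCoeff (mixW (scaled θ R) (scaled κ R) N) N) := by
  have hsing : MeasurableSingletonClass (Equiv.Perm (Fin N)) := ⟨fun _ => trivial⟩
  have h0 := (normConst_pos hR hN).ne'
  have hRN : R ^ N ≠ 0 := by positivity
  rw [integral_fintype .of_finite, Finset.sum_div]
  refine Finset.sum_congr rfl fun σ _ => ?_
  have hfac : (N.factorial : ℝ≥0) ≠ 0 := by exact_mod_cast N.factorial_ne_zero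
  have h1 : (N.factorial : ℝ≥0) * normConst θ κ N = ∑ σ : Equiv.Perm (Fin N), weight θ κ N σ := by
    unfold normConst
    field_simp
  have h2 : (surrogateMeasure θ κ N).real {σ} =
      (weight θ κ N σ : ℝ) / ∑ σ : Equiv.Perm (Fin N), (weight θ κ N σ : ℝ) := by
    rw [surrogateMeasure, if_neg h0, h1, measureReal_def]
    simp only [Measure.coe_finsetSum, Finset.sum_apply, Measure.smul_apply, smul_eq_mul]
    rw [Finset.sum_eq_single σ]
    · rw [Measure.dirac_apply' _ (measurableSet_singleton σ), indicator_of_mem (mem_singleton σ)]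
      simp
    · intro τ _ hτ
      rw [Measure.dirac_apply' _ (measurableSet_singleton σ), indicator_of_notMem (by simpa using hτ),
        mul_zero]
    · exact fun h => absurd (Finset.mem_univ _) h
  rw [h2, smul_eq_mul, elemWeight_mixW hR, ← sum_weight_mul_pow hR, mul_right_comm,
    mul_div_mul_right _ _ hRN, div_mul_eq_mul_div]

theorem integral_lexLength (hR : 0 < R) {N : ℕ}
    (hN : 0 < expCoeff (mixW (scaled θ R) (scaled κ R) N) N) (m : ℕ) (f : (Fin m → ℕ) → ℝ) :
    ∫ σ, f (fun i => lexLength σ i) ∂(surrogateMeasure θ κ N) =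
      lexSum (mixW (scaled θ R) (scaled κ R) N) m N f /
        expCoeff (mixW (scaled θ R) (scaled κ R) N) N := by
  have h := sum_lexFrom (mixW_scaled_nonneg (θ := θ) (κ := κ) hR N) m (∅ : Finset (Fin N)) f
  rw [permFixing_empty, Finset.compl_empty, Finset.card_univ, Fintype.card_fin] at h
  simp only [lexFrom_empty] at h
  have : (N.factorial : ℝ) ≠ 0 := by exact_mod_cast N.factorial_ne_zero
  rw [integral_surrogateMeasure hR hN, h, mul_div_mul_left _ _ this]

theorem sum_mul_cycleCount {N : ℕ} (K : ℕ) (σ : Equiv.Perm (Fin N)) :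
    ∑ j ∈ Finset.Ioc K N, (j : ℝ) * (cycleCount σ j : ℝ) =
      ∑ i : Fin N, if K < (cycleSet σ i).card then (1 : ℝ) else 0 := by
  have h1 : ∀ j ∈ Finset.Ioc K N, (j : ℝ) * (cycleCount σ j : ℝ) =
      ∑ i : Fin N, if (cycleSet σ i).card = j then (1 : ℝ) else 0 := by
    intro j hj
    rw [Finset.sum_boole]
    exact_mod_cast mul_cycleCount σ (j := j) (by have := (Finset.mem_Ioc.1 hj).1; omega)
  rw [Finset.sum_congr rfl h1, Finset.sum_comm]
  refine Finset.sum_congr rfl fun i _ => ?_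
  rw [Finset.sum_ite_eq]
  have : (cycleSet σ i).card ≤ N := by simpa using Finset.card_le_univ (cycleSet σ i)
  simp [Finset.mem_Ioc, this]

/-- The expected fraction is an average over points of the probability of a cycle longer than K. All
points contribute equally, and the step probabilities of all lengths add up to 1. -/
theorem integral_long_cycles (hR : 0 < R) {N : ℕ} (hN0 : 0 < N)
    (hN : 0 < expCoeff (mixW (scaled θ R) (scaled κ R) N) N) {K : ℕ} (hK : K ≤ N) :
    (1 / (N : ℝ)) * ∫ σ, (∑ j ∈ Finset.Ioc K N, (j : ℝ) * (cycleCount σ j : ℝ))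
        ∂(surrogateMeasure θ κ N) =
      1 - ∑ l ∈ Finset.Icc 1 K, Supercritical.stepProb (scaled θ R) (scaled κ R) N N l := by
  set w := mixW (scaled θ R) (scaled κ R) N with hw
  have hNR : (N : ℝ) ≠ 0 := by positivity
  have hfac : ((N - 1).factorial : ℝ) ≠ 0 := by exact_mod_cast (N - 1).factorial_ne_zero
  simp only [sum_mul_cycleCount]
  rw [integral_surrogateMeasure hR hN]
  simp only [Finset.mul_sum]
  rw [Finset.sum_comm, Finset.sum_congr rfl fun x _ =>
    sum_cycle_card (mixW_scaled_nonneg (θ := θ) (κ := κ) hR N) x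
      (fun l => if K < l then (1 : ℝ) else 0)]
  rw [Finset.sum_const, Finset.card_univ, Fintype.card_fin, nsmul_eq_mul, ← hw]
  have hf : (N.factorial : ℝ) = N * (N - 1).factorial := by
    rw [← Nat.mul_factorial_pred hN0.ne']
    push_cast
    rfl
  have hsplit : (N : ℝ) * expCoeff w N = ∑ l ∈ Finset.Icc 1 K, w l * expCoeff w (N - l) +
      ∑ l ∈ Finset.Icc 1 N, w l * (if K < l then (1 : ℝ) else 0) * expCoeff w (N - l) := by
    rw [mul_expCoeff, ← Finset.sum_filter_not_add_sum_filter (Finset.Icc 1 N) (fun l => K < l)]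
    congr 1
    · refine Finset.sum_congr ?_ fun _ _ => rfl
      ext l
      simp only [Finset.mem_filter, Finset.mem_Icc]
      omega
    · rw [Finset.sum_filter]
      refine Finset.sum_congr rfl fun l _ => ?_
      split_ifs <;> simp
  have hsp : ∑ l ∈ Finset.Icc 1 K, Supercritical.stepProb (scaled θ R) (scaled κ R) N N l =
      (∑ l ∈ Finset.Icc 1 K, w l * expCoeff w (N - l)) / (N * expCoeff w N) := by
    rw [Finset.sum_div]
    rfl
  have hne : (N : ℝ) * expCoeff w N ≠ 0 := mul_ne_zero hNR hN.ne'
  rw [hsp, eq_sub_iff_add_eq, hf]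
  have hN' := hN.ne'
  field_simp
  linarith

theorem Supercritical.tendsto_self_div : Tendsto (fun N : ℕ => (N : ℝ) / N) atTop (𝓝 1) := by
  refine tendsto_const_nhds.congr' ?_
  filter_upwards [eventually_gt_atTop 0] with N hN
  have : (N : ℝ) ≠ 0 := by positivity
  rw [div_self this]

variable {c θs : ℝ}

theorem Supercritical.eventually_pos (D : Supercritical (scaled θ R) (scaled κ R) c θs) :
    ∀ᶠ N in atTop, 0 < expCoeff (mixW (scaled θ R) (scaled κ R) N) N :=
  D.eventually_expCoeff_pos (n := fun N => N) D.c_lt Supercritical.tendsto_self_div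

/-- For fixed K the liminf is a limit, equal to 1 minus a partial sum of ∑ K_l = c. -/
theorem tendsto_longFraction (hR : 0 < R) (D : Supercritical (scaled θ R) (scaled κ R) c θs) :
    Tendsto (longFraction θ κ) atTop (𝓝 (1 - c)) := by
  have h1 : ∀ K, longFraction θ κ K = 1 - ∑ l ∈ Finset.Icc 1 K, scaled κ R l := by
    intro K
    refine Tendsto.liminf_eq ?_
    have h2 := (tendsto_finsetSum (Finset.Icc 1 K) fun l _ =>
      D.tendsto_stepProb_const (n := fun N => N) D.c_lt Supercritical.tendsto_self_div l).const_sub 1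
    simp only [div_one] at h2
    refine h2.congr' ?_
    filter_upwards [D.eventually_pos, eventually_ge_atTop K, eventually_gt_atTop 0]
      with N hN hK hN0
    exact (integral_long_cycles hR hN0 hN hK).symm
  rw [show longFraction θ κ = fun K => 1 - ∑ l ∈ Finset.Icc 1 K, scaled κ R l from funext h1]
  refine Tendsto.const_sub 1 ?_
  refine (D.hasSum.tendsto_sum_nat.comp (tendsto_add_atTop_nat 1)).congr fun K => ?_
  simp only [Function.comp_apply]
  rw [Finset.sum_range_succ', D.K_zero, add_zero, Finset.range_eq_Ico, Finset.sum_Ico_add'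
    (fun l => scaled κ R l) 0 K 1]
  rfl

/-- The upper bound M keeps the real liminf from being a default value. -/
theorem le_liminf_of_ofReal_le {u : ℕ → ℝ} {A M : ℝ} (hu0 : ∀ N, 0 ≤ u N) (hM : ∀ N, u N ≤ M)
    (h : ENNReal.ofReal A ≤ liminf (fun N => ENNReal.ofReal (u N)) atTop) :
    A ≤ liminf u atTop := by
  refine le_of_forall_lt fun b hb => ?_
  obtain ⟨b', hb1, hb2⟩ := exists_between hb
  refine hb1.trans_le (le_liminf_of_le (isCoboundedUnder_ge_of_le atTop hM) ?_)
  rcases lt_or_ge b' 0 with hneg | hpos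
  · exact Eventually.of_forall fun N => hneg.le.trans (hu0 N)
  · have h1 : ENNReal.ofReal b' < liminf (fun N => ENNReal.ofReal (u N)) atTop :=
      ((ENNReal.ofReal_lt_ofReal_iff (hpos.trans_lt hb2)).2 hb2).trans_le h
    filter_upwards [eventually_lt_of_lt_liminf h1] with N hN
    exact ((ENNReal.ofReal_lt_ofReal_iff_of_nonneg hpos).1 hN).le

theorem tendstoInDistribution_lexLength (hR : 0 < R)
    (D : Supercritical (scaled θ R) (scaled κ R) c θs)
    {Ω : Type*} [MeasurableSpace Ω] {P : Measure Ω} [IsProbabilityMeasure P] {U B : ℕ → Ω → ℝ}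
    (hU : ∀ n, HasLaw (U n) (volume.restrict (Icc (0 : ℝ) 1)) P)
    (hB : ∀ n, HasLaw (B n) (betaMeasure 1 θs) P) (hindep : iIndepFun (Sum.elim U B) P) (m : ℕ) :
    TendstoInDistribution
      (fun (N : ℕ) (σ : Equiv.Perm (Fin N)) (i : Fin m) =>
        1 / ((N : ℝ) * (1 - c)) * (lexLength σ (i : ℕ) : ℝ))
      atTop
      (fun (ω : Ω) (i : Fin m) => stickX (1 - c) (fun n => U n ω) (fun n => B n ω) (i : ℕ))
      (fun N : ℕ => surrogateMeasure θ κ N) P := by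
  have hae := aemeasurable_stickX (fun n => (hU n).aemeasurable) (fun n => (hB n).aemeasurable)
    (1 - c) m
  have hm : ∀ N : ℕ, Measurable (fun (σ : Equiv.Perm (Fin N)) (i : Fin m) =>
      1 / ((N : ℝ) * (1 - c)) * (lexLength σ (i : ℕ) : ℝ)) := fun N => measurable_from_top
  refine ⟨fun N => (hm N).aemeasurable, hae, ?_⟩
  refine ProbabilityMeasure.tendsto_iff_forall_integral_tendsto.2 ?_
  have := fun N => Measure.isProbabilityMeasure_map (μ := surrogateMeasure θ κ N)
    (hm N).aemeasurable
  have := Measure.isProbabilityMeasure_map hae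
  -- Lower bounds for non-negative f suffice for probability measures: applied to ‖f‖ - f they give
  -- the upper bounds.
  refine BoundedContinuousFunction.tendsto_integral_of_forall_integral_le_liminf_integral
    (μ := P.map fun (ω : Ω) (i : Fin m) =>
      stickX (1 - c) (fun n => U n ω) (fun n => B n ω) (i : ℕ))
    (μs := fun N : ℕ => (surrogateMeasure θ κ N).map fun (σ : Equiv.Perm (Fin N)) (i : Fin m) =>
      1 / ((N : ℝ) * (1 - c)) * (lexLength σ (i : ℕ) : ℝ))
    fun f hf => ?_
  have hf0 : ∀ z, 0 ≤ f z := hf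
  refine le_liminf_of_ofReal_le (M := ‖f‖) (fun N => integral_nonneg hf) (fun N => ?_) ?_
  · refine (integral_mono (f.integrable _) (integrable_const ‖f‖)
      fun z => (le_abs_self _).trans (f.norm_coe_le_norm z)).trans (le_of_eq ?_)
    rw [integral_const, probReal_univ, one_smul]
  · rw [ofReal_integral_eq_lintegral_ofReal (f.integrable _) (Eventually.of_forall hf0),
      lintegral_map' f.continuous.measurable.ennreal_ofReal.aemeasurable hae,
      lintegral_stickX (sub_pos.2 D.c_lt) (by linarith [D.c_pos]) D.θ_pos hU hB hindep m
        f.continuous.measurable]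
    have h1 := D.le_liminf_lexSum m one_pos (n := fun N => N)
      (by simpa using Supercritical.tendsto_self_div) (F := fun _ => f) (f := f) (fun _ => hf0)
      (fun z z₀ hz => (f.continuous.tendsto z₀).comp hz)
    refine h1.trans (liminf_le_liminf ?_)
    filter_upwards [D.eventually_pos] with N hN
    rw [integral_map (hm N).aemeasurable f.continuous.aestronglyMeasurable,
      integral_lexLength hR hN m
        (fun v => f (fun i => 1 / ((N : ℝ) * (1 - c)) * (v i : ℝ)))]

end expectation

end SurrogateSpatial

theorem mainTheorem6
    -- the weights
    (θ κ : ℕ → ℝ≥0)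
    (hκ_nonarith : ∀ d : ℕ, 1 < d → ∃ j : ℕ, 1 ≤ j ∧ κ j ≠ 0 ∧ ¬ d ∣ j)
    (hκ_nondeg : ∃ j : ℕ, 2 ≤ j ∧ 0 < κ j)
    -- both generating functions have radius of convergence `R` and extend to `Δ₀`
    (R η φ : ℝ) (hR : 0 < R) (hη : 0 < η) (hφ : 0 < φ) (hφ' : φ < Real.pi / 2)
    (hθ_radius : (genSeries θ).radius = ENNReal.ofReal R)
    (hκ_radius : (genSeries κ).radius = ENNReal.ofReal R)
    (gθ gκ : ℂ → ℂ)
    (hgθ : ∀ z : ℂ, ‖z‖ < R → gθ z = (genSeries θ).sum z)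
    (hgκ : ∀ z : ℂ, ‖z‖ < R → gκ z = (genSeries κ).sum z)
    (hgθ_holo : DifferentiableOn ℂ gθ (domainDelta R η φ))
    (hgκ_holo : DifferentiableOn ℂ gκ (domainDelta R η φ))
    -- `c n` is the left limit at `R` of the modified derivative of order `n < s`;
    -- for `n > s` that limit is infinite
    (s : ℝ) (hs : 1 < s) (hs_nonint : ∀ k : ℤ, s ≠ k)
    (c : ℕ → ℝ)
    (hc : ∀ n : ℕ, (n : ℝ) < s →
      Tendsto (fun r : ℝ => modDeriv gκ n (r : ℂ)) (𝓝[<] R) (𝓝 (c n : ℂ)))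
    (hc_top : ∀ n : ℕ, s < n →
      Tendsto (fun r : ℝ => (modDeriv gκ n (r : ℂ)).re) (𝓝[<] R) atTop)
    -- the supercritical case
    (hsuper : c 1 < 1)
    -- asymptotics of the generating functions at `R`
    (θs : ℝ) (hθs : 0 < θs) (δ : ℝ) (hδ : 0 < δ)
    (hgθ_as : (fun z : ℂ => gθ z - -(θs : ℂ) * Complex.log (1 - z / R))
      =O[𝓝[domainDelta R η φ] (R : ℂ)] fun z : ℂ => ‖1 - z / R‖ ^ δ)
    (hgκ_as : (fun z : ℂ => gκ z - ((c 0 : ℂ) - (c 1 : ℂ) * (1 - z / R)))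
      =O[𝓝[domainDelta R η φ] (R : ℂ)] fun z : ℂ => ‖1 - z / R‖ ^ (1 + δ))
    -- asymptotics of the modified derivatives at `R`
    (a : ℝ) (ha : a ≠ 0)
    (hgκ_low : ∀ n : ℕ, (n : ℝ) < s → ∃ d : ℝ, 0 < d ∧
      (fun z : ℂ => modDeriv gκ n z - (c n : ℂ))
        =O[𝓝[domainDelta R η φ] (R : ℂ)] fun z : ℂ => ‖1 - z / R‖ ^ d)
    (hgκ_high : ∀ n : ℕ, s < n → ∃ d : ℝ, 0 < d ∧
      (fun z : ℂ => modDeriv gκ n z -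
          ((Real.Gamma (-s + n) * a / Real.Gamma (-s) : ℝ) : ℂ) * (1 - z / R) ^ ((s - n : ℝ) : ℂ))
        =O[𝓝[domainDelta R η φ] (R : ℂ)] fun z : ℂ => ‖1 - z / R‖ ^ (s - n + d))
    (hgθ_deriv : ∀ n : ℕ, 1 ≤ n → ∃ d : ℝ, 0 < d ∧
      (fun z : ℂ => modDeriv gθ n z - (θs : ℂ) * ((n - 1).factorial : ℂ) / (1 - z / R) ^ n)
        =O[𝓝[domainDelta R η φ] (R : ℂ)] fun z : ℂ => ‖1 - z / R‖ ^ (-(n : ℝ) + d))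
    -- the limiting fraction of points in long cycles
    (ν : ℝ) (hν : ν = 1 - c 1)
    -- the variables that drive the stick-breaking process
    {Ω : Type*} [MeasurableSpace Ω] (P : Measure Ω) [IsProbabilityMeasure P]
    (U B : ℕ → Ω → ℝ)
    (hU : ∀ n, HasLaw (U n) (volume.restrict (Set.Icc (0 : ℝ) 1)) P)
    (hB : ∀ n, HasLaw (B n) (betaMeasure 1 θs) P)
    (hindep : iIndepFun (Sum.elim U B) P) :
    -- the measures are eventually well defined
    (∀ᶠ N : ℕ in atTop, 0 < normConst θ κ N) ∧
    -- `ν` is the limiting expected fraction of points in long cycles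
    0 < ν ∧
    Tendsto (longFraction θ κ) atTop (𝓝 ν) ∧
    -- joint convergence
    (∀ m : ℕ, TendstoInDistribution
      (fun (N : ℕ) (σ : Equiv.Perm (Fin N)) (i : Fin m) =>
        1 / ((N : ℝ) * ν) * (lexLength σ (i : ℕ) : ℝ))
      atTop
      (fun (ω : Ω) (i : Fin m) => stickX ν (fun n => U n ω) (fun n => B n ω) (i : ℕ))
      (fun N : ℕ => surrogateMeasure θ κ N) P) ∧
    -- the first cycle
    TendstoInDistribution
      (fun (N : ℕ) (σ : Equiv.Perm (Fin N)) => (lexLength σ 0 : ℝ) / ((N : ℝ) * ν))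
      atTop
      (fun ω : Ω => stickX ν (fun n => U n ω) (fun n => B n ω) 0)
      (fun N : ℕ => surrogateMeasure θ κ N) P ∧
    P.map (fun ω : Ω => stickX ν (fun n => U n ω) (fun n => B n ω) 0) =
      ENNReal.ofReal (1 - ν) • Measure.dirac (0 : ℝ) +
        (volume.restrict (Set.Ioo (0 : ℝ) 1)).withDensity
          (fun x => ENNReal.ofReal (ν * θs * (1 - x) ^ (θs - 1))) := by
  obtain ⟨C, hC0, hC⟩ := exists_scaled_le_rpow hR hη hφ hφ' hκ_radius hgκ hgκ_holo hs hgκ_high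
  obtain ⟨d, hd, C', _, hC'⟩ := exists_abs_scaled_sub_le_rpow hR hη hφ hφ' hθ_radius hgθ hgθ_holo
    hgθ_deriv
  have hsum := hasSum_scaled hR hη hφ hφ' hκ_radius hgκ hgκ_holo (summable_scaled hR hs hC)
    (hc 1 (by exact_mod_cast hs))
  have hκ_pos : ∃ j, 1 ≤ j ∧ 0 < κ j := by
    obtain ⟨j, hj, hκj⟩ := hκ_nondeg
    exact ⟨j, by omega, hκj⟩
  have D := supercritical_scaled hR hs hC0 hC hsum hκ_pos hsuper hθs hd hC'
  subst hν
  have hν0 : 0 < 1 - c 1 := sub_pos.2 hsuper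
  have hconv := tendstoInDistribution_lexLength hR D hU hB hindep
  refine ⟨?_, hν0, tendsto_longFraction hR D, hconv, ?_,
    map_stickX_zero hν0 (by linarith [D.c_pos]) hθs hU hB hindep⟩
  · filter_upwards [D.eventually_pos] with N hN
    exact normConst_pos hR hN
  -- The first length is the continuous image of the vector with m = 1 under its only coordinate.
  · have h := (hconv 1).continuous_comp (continuous_apply (0 : Fin 1))
    have e : (fun (N : ℕ) (σ : Equiv.Perm (Fin N)) => (lexLength σ 0 : ℝ) / ((N : ℝ) * (1 - c 1))) =
        fun (N : ℕ) => (fun z : Fin 1 → ℝ => z 0) ∘ fun (σ : Equiv.Perm (Fin N)) (i : Fin 1) =>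
          1 / ((N : ℝ) * (1 - c 1)) * (lexLength σ (i : ℕ) : ℝ) := by
      ext N σ
      simp only [Function.comp_apply, Fin.val_zero]
      rw [one_div, div_eq_inv_mul]
    rw [e]
    exact h
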